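/- Let $N\ge 1$, $p,q\in[1,\infty]$ with $\frac1p+\frac1q=1$, $m\in\mathbb{N}_0$, $\rho_0\in W^{m,p}(\mathbb{R}^N)$ (real-valued), and let $W\in L^1_{loc}(\mathbb{R}^N)$ have weak gradient $\nabla W\in (L^q(\mathbb{R}^N))^N$. Consider $$\partial_t\rho=\nabla\cdot(\rho\,(\nabla W*\rho))+\Delta\rho,\qquad \rho(0,\cdot)=\rho_0. \tag{AE}$$ **Definitions.** Let $G(t,x)=(4\pi t)^{-N/2}e^{-|x|^2/(4t)}$, $e^{t\Delta}f=G(t,\cdot)*f$, and $\nabla e^{t\Delta}\cdot F=\sum_i\partial_iG(t,\cdot)*F_i$. For $T\in(0,\infty]$, a mild $L^p$ solution of (AE) on $[0,T)$ is a function $\rho\in L^1_{loc}([0,T),L^p)$ such that for all $t\in(0,T)$ $$\rho_t=e^{t\Delta}\rho_0+\int_0^t\nabla e^{(t-s)\Delta}\cdot\big(\rho_s\,(\nabla W*\rho_s)\big)\,ds,$$ where the integral exists as a Bochner integral in $L^p$. The norm on $W^{m,p}$ is $\|f\|_{m,p}=\big(\sum_{|\gamma|\le m}\|\partial^\gamma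 f\|_p^p\big)^{1/p}$ (the maximum of the $\|\partial^\gamma f\|_\infty$ if $p=\infty$). If $p<\infty$, put $X^{m,p}_T=C([0,T),W^{m,p})$; if $p=\infty$, let $X^{m,\infty}_T$ be the set of $u:[0,T)\to W^{m,\infty}$ that are continuous on $(0,T)$ and bounded on $[0,T']$ for every $T'<T$. **Theorem.** There exist $T^*\in(0,+\infty]$ and a mild $L^p$ solution $\rho\in X^{m,p}_{T^*}$ of (AE) on $[0,T^*)$ with $\rho(0)=\rho_0$ and $\rho_t-e^{t\Delta}\rho_0\to0$ in $W^{m,p}$ as $t\to0^+$ (so that, also for $p=\infty$, $\rho\in C([0,T^*),W^{m,p})$ whenever $e^{t\Delta}\rho_0\to\rho_0$ in $W^{m,p}$ as $t \to 0^+$). It is maximal and unique: if $T\in(0,\infty]$ and $\sigma\in X^{m,p}_T$ is a mild $L^p$ solution of (AE) on $[0,T)$, then $T\le T^*$ and $\sigma=\rho$ on $[0,T)$ (on $(0,T)$ if $p=\infty$, where the value $\sigma(0)$ is not prescribed). If $T^*<+\infty$, then $$\|\rho_t\|_{m,p}\to+\infty\quad\text{as }t\to T^*.$$ Moreover, let $p',q'\in[1,\infty]$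 with $\frac1{p'}+\frac1{q'}=1$ and $m'\in\mathbb{N}_0$. If additionally $\rho_0\in W^{m',p'}$ and $\nabla W\in(L^{q'})^N$, then the same solution $\rho$, on the same interval $[0,T^*)$, also belongs to $X^{m',p'}_{T^*}$, and $\rho_t-e^{t\Delta}\rho_0\to0$ in $W^{m',p'}$ as $t\to0^+$. In particular, if $p,p'<\infty$, then $\rho\in BC([0,T),W^{m,p}\cap W^{m',p'})$ for every finite $T<T^*$. -/

import Mathlib

open MeasureTheory Filter Topology
open scoped ENNReal ContDiff Convolution

noncomputable section

namespace AggDiff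

/-- The space `ℝ^N` with its Euclidean norm. -/
abbrev E (N : ℕ) : Type := EuclideanSpace ℝ (Fin N)

/-- The first-order partial derivative `∂f/∂x_i`. -/
def partialDeriv {N : ℕ} (i : Fin N) (f : E N → ℝ) : E N → ℝ :=
  fun x => fderiv ℝ f x (EuclideanSpace.single i 1)

/-- The classical derivative `∂^γ f = ∂_{x_1}^{γ_1} ⋯ ∂_{x_N}^{γ_N} f`. -/
def multiDeriv {N : ℕ} (γ : Fin N → ℕ) (f : E N → ℝ) : E N → ℝ :=
  (List.finRange N).foldr (fun i g => (partialDeriv i)^[γ i] g) f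

/-- `φ ∈ C_c^∞(ℝ^N)`. -/
def IsTestFunction {N : ℕ} (φ : E N → ℝ) : Prop :=
  ContDiff ℝ ∞ φ ∧ HasCompactSupport φ

/-- `g` is the generalized derivative `∂^γ f`, for locally integrable `f` and `g`. -/
def HasWeakDeriv {N : ℕ} (γ : Fin N → ℕ) (f g : E N → ℝ) : Prop :=
  ∀ φ : E N → ℝ, IsTestFunction φ →
    ∫ x, f x * multiDeriv γ φ x = (-1) ^ (∑ i, γ i) * ∫ x, g x * φ x

/-- The vector field `K` is the generalized gradient of `W`. -/
def IsWeakGradient {N : ℕ} (W : E N → ℝ) (K : Fin N → E N → ℝ) : Prop :=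
  ∀ i, HasWeakDeriv (Pi.single i 1) W (K i)

theorem IsTestFunction.partialDeriv {N : ℕ} {φ : E N → ℝ} (h : IsTestFunction φ) (i : Fin N) :
    IsTestFunction (partialDeriv i φ) :=
  ⟨(h.1.fderiv_right (m := ∞) (by simp)).clm_apply contDiff_const,
    h.2.fderiv_apply (𝕜 := ℝ) _⟩

theorem IsTestFunction.multiDeriv {N : ℕ} {φ : E N → ℝ} (h : IsTestFunction φ)
    (γ : Fin N → ℕ) : IsTestFunction (multiDeriv γ φ) := by
  unfold AggDiff.multiDeriv
  induction List.finRange N with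
  | nil => simpa using h
  | cons i l ih =>
    rw [List.foldr_cons]
    generalize γ i = k
    induction k with
    | zero => simpa using ih
    | succ k ihk =>
      rw [Function.iterate_succ_apply']
      exact ihk.partialDeriv i

theorem integrable_mul_test {N : ℕ} {p : ℝ≥0∞} [hp : Fact (1 ≤ p)]
    (f : Lp ℝ p (volume : Measure (E N))) {φ : E N → ℝ} (hφ : IsTestFunction φ) :
    Integrable (fun x => f x * φ x) := by
  have h := ((Lp.memLp f).locallyIntegrable hp.out).integrable_smul_right_of_hasCompactSupport
    hφ.1.continuous hφ.2
  simpa [smul_eq_mul] using h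

/-- The multi-indices `γ` with `|γ| ≤ m`. -/
def multiIndices (N m : ℕ) : Finset (Fin N → ℕ) :=
  {γ ∈ Finset.Iic (fun _ : Fin N => m) | ∑ i, γ i ≤ m}

theorem mem_multiIndices {N m : ℕ} {γ : Fin N → ℕ} :
    γ ∈ multiIndices N m ↔ ∑ i, γ i ≤ m := by
  simp only [multiIndices, Finset.mem_filter, Finset.mem_Iic, and_iff_right_iff_imp]
  exact fun h i => (Finset.single_le_sum (fun j _ => Nat.zero_le (γ j)) (Finset.mem_univ i)).trans h

/-- The multi-index `0`. -/
def zeroIndex (N m : ℕ) : multiIndices N m := ⟨0, mem_multiIndices.2 (by simp)⟩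

/-- The Sobolev space `W^{m,p}(ℝ^N)`. A function `f ∈ L^p` whose generalized derivatives up to
order `m` are in `L^p` is recorded by the family `(∂^γ f)_{|γ| ≤ m}` of these (unique) derivatives,
so that the norm inherited from the `ℓ^p`-sum of copies of `L^p` is
`‖f‖_{m,p} = (∑_{|γ| ≤ m} ‖∂^γ f‖_p^p)^{1/p}` (the maximum of the `‖∂^γ f‖_∞` if `p = ∞`). -/
def sobolevSubmodule (N m : ℕ) (p : ℝ≥0∞) [Fact (1 ≤ p)] :
    Submodule ℝ (PiLp p fun _ : multiIndices N m => Lp ℝ p (volume : Measure (E N))) where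
  carrier := {u | ∀ γ : multiIndices N m, HasWeakDeriv γ.1 (u (zeroIndex N m)) (u γ)}
  zero_mem' := by
    intro γ φ _
    have h0 : ∀ ψ : E N → ℝ,
        ∫ x, (0 : Lp ℝ p (volume : Measure (E N))) x * ψ x = 0 := by
      intro ψ
      refine integral_eq_zero_of_ae ?_
      filter_upwards [Lp.coeFn_zero ℝ p (volume : Measure (E N))] with x hx
      have hx' : (0 : Lp ℝ p (volume : Measure (E N))) x = 0 := hx
      show (0 : Lp ℝ p (volume : Measure (E N))) x * ψ x = 0
      rw [hx', zero_mul]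
    simp only [PiLp.zero_apply]
    rw [h0, h0, mul_zero]
  add_mem' := by
    intro u v hu hv γ φ hφ
    have key : ∀ (f g : Lp ℝ p (volume : Measure (E N))) {ψ : E N → ℝ}, IsTestFunction ψ →
        ∫ x, (f + g) x * ψ x = (∫ x, f x * ψ x) + ∫ x, g x * ψ x := by
      intro f g ψ hψ
      rw [← integral_add (integrable_mul_test f hψ) (integrable_mul_test g hψ)]
      refine integral_congr_ae ?_
      filter_upwards [Lp.coeFn_add f g] with x hx
      have hx' : (f + g) x = f x + g x := hx
      show (f + g) x * ψ x = f x * ψ x + g x * ψ x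
      rw [hx', add_mul]
    simp only [PiLp.add_apply]
    rw [key _ _ (hφ.multiDeriv γ.1), key _ _ hφ, hu γ φ hφ, hv γ φ hφ, mul_add]
  smul_mem' := by
    intro c u hu γ φ hφ
    have key : ∀ (f : Lp ℝ p (volume : Measure (E N))) (ψ : E N → ℝ),
        ∫ x, (c • f) x * ψ x = c * ∫ x, f x * ψ x := by
      intro f ψ
      rw [← integral_const_mul]
      refine integral_congr_ae ?_
      filter_upwards [Lp.coeFn_smul c f] with x hx
      have hx' : (c • f) x = c * f x := hx
      show (c • f) x * ψ x = c * (f x * ψ x)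
      rw [hx', mul_assoc]
    simp only [PiLp.smul_apply]
    rw [key, key, hu γ φ hφ, mul_left_comm]

abbrev Sobolev (N m : ℕ) (p : ℝ≥0∞) [Fact (1 ≤ p)] : Type := ↥(sobolevSubmodule N m p)

/-- The element of `L^p` underlying an element of `W^{m,p}`. -/
def Sobolev.toLp {N m : ℕ} {p : ℝ≥0∞} [Fact (1 ≤ p)] (u : Sobolev N m p) :
    Lp ℝ p (volume : Measure (E N)) :=
  u.1 (zeroIndex N m)

theorem Sobolev.norm_eq_sum {N m : ℕ} {p : ℝ≥0∞} [Fact (1 ≤ p)] (hp : p ≠ ⊤)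
    (u : Sobolev N m p) :
    ‖u‖ = (∑ γ : multiIndices N m, ‖u.1 γ‖ ^ p.toReal) ^ (1 / p.toReal) :=
  PiLp.norm_eq_sum (ENNReal.toReal_pos (zero_lt_one.trans_le (Fact.out : 1 ≤ p)).ne' hp) u.1

/-- The heat kernel `G(t,x) = (4πt)^{-N/2} exp(-|x|²/(4t))`. -/
def heatKernel (N : ℕ) (t : ℝ) (x : E N) : ℝ :=
  (4 * Real.pi * t) ^ (-(N : ℝ) / 2) * Real.exp (-‖x‖ ^ 2 / (4 * t))

/-- Convolution of real functions on `ℝ^N`. -/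
def conv {N : ℕ} (f g : E N → ℝ) : E N → ℝ :=
  f ⋆[ContinuousLinearMap.mul ℝ ℝ, volume] g

/-- The heat semigroup `e^{tΔ} f = G(t,·) * f`, for `t > 0`. -/
def heatFlow {N : ℕ} (t : ℝ) (f : E N → ℝ) : E N → ℝ := conv (heatKernel N t) f

/-- `∇ e^{τΔ} · (f (K * f)) = ∑_i ∂_i G(τ,·) * (f (K_i * f))`, for `τ > 0`. -/
def duhamelTerm {N : ℕ} (K : Fin N → E N → ℝ) (τ : ℝ) (f : E N → ℝ) : E N → ℝ :=
  fun x => ∑ i, conv (partialDeriv i (heatKernel N τ)) (fun y => f y * conv (K i) f y) x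

/-- `ρ` is a mild `L^p` solution on `[0,T)` of `∂_t ρ = ∇·(ρ (K * ρ)) + Δρ` with initial condition
`ρ₀`: `ρ ∈ L^1_loc([0,T), L^p)` and, for all `t ∈ (0,T)`,
`ρ_t = e^{tΔ} ρ₀ + ∫_0^t ∇ e^{(t-s)Δ} · (ρ_s (K * ρ_s)) ds`, where the integral is an existing
Bochner integral in `L^p`: `Φ` is the integrand as an integrable `L^p`-valued function. -/
def IsMildSolution {N : ℕ} {p : ℝ≥0∞} [Fact (1 ≤ p)] (K : Fin N → E N → ℝ)
    (ρ₀ : Lp ℝ p (volume : Measure (E N))) (T : EReal)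
    (ρ : ℝ → Lp ℝ p (volume : Measure (E N))) : Prop :=
  (∀ t : ℝ, 0 < t → (t : EReal) < T → IntegrableOn ρ (Set.Ioc 0 t)) ∧
  ∀ t : ℝ, 0 < t → (t : EReal) < T →
    ∃ Φ : ℝ → Lp ℝ p (volume : Measure (E N)),
      (∀ᵐ s ∂(volume.restrict (Set.Ioo 0 t)), ⇑(Φ s) =ᵐ[volume] duhamelTerm K (t - s) (ρ s)) ∧
      IntegrableOn Φ (Set.Ioo 0 t) ∧
      ⇑(ρ t) =ᵐ[volume] heatFlow t ρ₀ + ⇑(∫ s in Set.Ioo 0 t, Φ s)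

/-- The class `C([0,T), W^{m,p})` if `p < ∞`. If `p = ∞`, continuity at `t = 0` is relaxed to
boundedness near `0`. (For `p < ∞` the conditions `continuousOn_Ioo` and `bounded` follow from
`continuousOn_Ico`.) -/
structure InSolutionClass {N m : ℕ} {p : ℝ≥0∞} [Fact (1 ≤ p)] (T : EReal)
    (u : ℝ → Sobolev N m p) : Prop where
  continuousOn_Ico : p ≠ ⊤ → ContinuousOn u {t : ℝ | 0 ≤ t ∧ (t : EReal) < T}
  continuousOn_Ioo : ContinuousOn u {t : ℝ | 0 < t ∧ (t : EReal) < T}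
  bounded : ∀ T' : ℝ, (T' : EReal) < T → ∃ C : ℝ, ∀ t ∈ Set.Icc 0 T', ‖u t‖ ≤ C

/-- `u_0 = ρ₀`, and `u_t - e^{tΔ} ρ₀ → 0` in `W^{m,p}` as `t → 0⁺`. Here `Z` is the heat flow of
`ρ₀` as a curve in `W^{m,p}`. -/
def AttainsData {N m : ℕ} {p : ℝ≥0∞} [Fact (1 ≤ p)] (ρ₀ : Sobolev N m p)
    (u : ℝ → Sobolev N m p) : Prop :=
  u 0 = ρ₀ ∧
  ∃ Z : ℝ → Sobolev N m p, (∀ t : ℝ, 0 < t → ⇑(Z t).toLp =ᵐ[volume] heatFlow t ρ₀.toLp) ∧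
    Tendsto (fun t => u t - Z t) (𝓝[>] 0) (𝓝 0)

end AggDiff

end

/-! Write K = ∇W. By Hölder, ‖K * g‖_∞ ≤ ‖K‖_q ‖g‖_p, so (f, g) ↦ f (K * g) is a bounded bilinear
map on L^p. Derivatives of K * g fall on g, hence by the product rule the map is bounded on W^{m,p}
too (`SobBound.mulConvL`). Since ‖∂_i G(τ)‖_1 ≤ C τ^{-1/2}, the equation takes the form u_t = S_t z₀
+ ∫₀ᵗ P_{t-s}(u_s, u_s) ds with P_τ bilinear of size τ^{-1/2}, an integrable singularity. The
kernels are continuous in L^1 for positive time, so S and P are continuous in operator norm there,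
even for p = ∞. This is all that `MildSystem` records.

For such a system the nonlinearity is composed with a radial retraction onto a ball, which makes it
globally Lipschitz. A contraction argument in a norm with weight e^{-λt}, λ large, then solves the
truncated equation for all time (`MildSystem.exists_isSol_truncated`). As long as the solution stays
inside the ball it solves the true equation, which gives local existence and extension of bounded
solutions. A Gronwall inequality for the kernel (t-s)^{-1/2} gives uniqueness, so solutions glue to
a maximal one. If its norm stayed below some M at times accumulating at a finite end T, the
restarted equation would bound it on intervals of length δ(M), hence up to T, and it could be
extended; this is why the full norm tends to infinity (`MildSystem.exists_maximal`).

For persistence the equation is solved in the intersection Z of W^{m,p} and W^{m',p'}. The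
restriction to the maximal solution in W^{m,p} is automatic, so only an earlier end of existence in
Z has to be excluded. Up to that end the W^{m,p} norm is bounded. The estimate ‖ρ (K * ρ)‖_{p'} ≤
‖K‖_q ‖ρ‖_p ‖ρ‖_{p'} is linear in the L^{p'} norm, and with K ∈ L^{q'} the derivatives of order n +
1 obey an estimate linear in them once those up to order n are bounded. Gronwall, applied order by
order, bounds the norm of Z and contradicts blow-up (`MildSystem.exists_isSol_of_tower`,
`exists_isSol_sobolev`). -/

noncomputable section

namespace AggDiff

section

/-! ### The singular kernel `τ ^ (-1/2)` -/

theorem measurePreserving_reflect (t : ℝ) :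
    MeasurePreserving (fun s => t - s) (volume.restrict (Set.Ioo 0 t))
      (volume.restrict (Set.Ioo 0 t)) := by
  have h := (Measure.measurePreserving_sub_left (volume : Measure ℝ) t).restrict_preimage
    (measurableSet_Ioo (a := (0 : ℝ)) (b := t))
  simpa using h

theorem measurableEmbedding_reflect (t : ℝ) : MeasurableEmbedding (fun s : ℝ => t - s) :=
  (MeasurableEquiv.subLeft t).measurableEmbedding

theorem integrableOn_singular (t : ℝ) :
    IntegrableOn (fun s : ℝ => s ^ (-(1 / 2) : ℝ)) (Set.Ioo 0 t) := by
  rcases le_or_gt t 0 with ht | ht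
  · simp [Set.Ioo_eq_empty_of_le ht]
  · rw [intervalIntegral.integrableOn_Ioo_rpow_iff ht]
    norm_num

theorem integrableOn_singular_sub (t : ℝ) :
    IntegrableOn (fun s : ℝ => (t - s) ^ (-(1 / 2) : ℝ)) (Set.Ioo 0 t) :=
  (measurePreserving_reflect t).integrable_comp_of_integrable (integrableOn_singular t)

theorem integral_singular_sub {t : ℝ} (ht : 0 ≤ t) :
    ∫ s in Set.Ioo 0 t, (t - s) ^ (-(1 / 2) : ℝ) = 2 * t ^ (1 / 2 : ℝ) := by
  rw [(measurePreserving_reflect t).integral_comp (measurableEmbedding_reflect t)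
    (fun s => s ^ (-(1 / 2) : ℝ)), ← integral_Ioc_eq_integral_Ioo,
    ← intervalIntegral.integral_of_le ht, integral_rpow (by norm_num)]
  norm_num
  ring_nf

theorem integrableOn_singular_exp (lam t : ℝ) :
    IntegrableOn (fun s : ℝ => (t - s) ^ (-(1 / 2) : ℝ) * Real.exp (lam * s)) (Set.Ioo 0 t) := by
  refine (integrableOn_singular_sub t).mul_bdd (c := Real.exp (|lam| * |t|))
    (by fun_prop) ?_
  refine (ae_restrict_iff' measurableSet_Ioo).2 (Eventually.of_forall fun s hs => ?_)
  rw [Real.norm_eq_abs, Real.abs_exp, Real.exp_le_exp]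
  calc lam * s ≤ |lam * s| := le_abs_self _
    _ = |lam| * |s| := abs_mul _ _
    _ ≤ _ := by
      gcongr
      · exact hs.1.le
      · exact hs.2.le

/-- Reflecting s to t - s splits off e^{λt} and leaves a truncated Gamma integral. The remaining
factor decays like λ^{-1/2}, uniformly in t. -/
theorem integral_singular_exp_le {lam : ℝ} (hl : 0 < lam) (t : ℝ) :
    ∫ s in Set.Ioo 0 t, (t - s) ^ (-(1 / 2) : ℝ) * Real.exp (lam * s) ≤
      ((1 / lam) ^ (1 / 2 : ℝ) * Real.Gamma (1 / 2)) * Real.exp (lam * t) := by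
  have h1 : ∫ s in Set.Ioo 0 t, (t - s) ^ (-(1 / 2) : ℝ) * Real.exp (lam * s) =
      Real.exp (lam * t) * ∫ s in Set.Ioo 0 t, s ^ (-(1 / 2) : ℝ) * Real.exp (-(lam * s)) := by
    rw [← (measurePreserving_reflect t).integral_comp (measurableEmbedding_reflect t)
      (fun s => s ^ (-(1 / 2) : ℝ) * Real.exp (-(lam * s))), ← integral_const_mul]
    refine integral_congr_ae (Eventually.of_forall fun s => ?_)
    simp only
    rw [mul_left_comm, ← Real.exp_add]
    ring_nf
  have hG := Real.integral_rpow_mul_exp_neg_mul_Ioi (a := 1 / 2) (by norm_num) hl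
  have hint : IntegrableOn (fun s : ℝ => s ^ (-(1 / 2) : ℝ) * Real.exp (-(lam * s)))
      (Set.Ioi 0) := by
    have : (1 / 2 - 1 : ℝ) = -(1 / 2) := by norm_num
    rw [← this]
    refine .of_integral_ne_zero ?_
    rw [hG]
    have := Real.Gamma_pos_of_pos (show (0 : ℝ) < 1 / 2 by norm_num)
    positivity
  rw [h1, mul_comm]
  gcongr
  rw [← hG]
  have : (1 / 2 - 1 : ℝ) = -(1 / 2) := by norm_num
  rw [this]
  refine setIntegral_mono_set hint ?_ (Set.Ioo_subset_Ioi_self).eventuallyLE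
  refine (ae_restrict_iff' measurableSet_Ioi).2 (Eventually.of_forall fun s hs => ?_)
  have : (0 : ℝ) < s := hs
  simp only [Pi.zero_apply]
  positivity

/-- In the sup norm weighted by e^{-λt}, the Volterra operator with kernel c (t-s)^{-1/2} has norm
at most 1/2 once λ is large, on time intervals of any length. -/
theorem exists_weight (c : ℝ) : ∃ lam κ : ℝ, 0 < lam ∧ 0 ≤ κ ∧ c * κ ≤ 1 / 2 ∧ ∀ t : ℝ,
    ∫ s in Set.Ioo 0 t, (t - s) ^ (-(1 / 2) : ℝ) * Real.exp (lam * s) ≤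
      κ * Real.exp (lam * t) := by
  have hG := Real.Gamma_pos_of_pos (show (0 : ℝ) < 1 / 2 by norm_num)
  -- With λ = D² the Gamma bound is κ = Γ(1/2)/D; the summand 1 only keeps D positive.
  set D : ℝ := 2 * |c| * Real.Gamma (1 / 2) + 1 with hD
  have hD0 : 0 < D := by positivity
  refine ⟨D ^ 2, (1 / D ^ 2) ^ (1 / 2 : ℝ) * Real.Gamma (1 / 2), by positivity, by positivity, ?_,
    integral_singular_exp_le (by positivity)⟩
  have h1 : (1 / D ^ 2) ^ (1 / 2 : ℝ) = 1 / D := by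
    rw [← Real.sqrt_eq_rpow, Real.sqrt_eq_iff_eq_sq (by positivity) (by positivity)]
    ring_nf
  rw [h1]
  calc c * (1 / D * Real.Gamma (1 / 2)) ≤ |c| * (1 / D * Real.Gamma (1 / 2)) := by
        gcongr
        exact le_abs_self c
    _ = (|c| * Real.Gamma (1 / 2)) / D := by ring
    _ ≤ 1 / 2 := by
        rw [div_le_iff₀ hD0, hD]
        linarith

/-- The integral term is absorbed into half of the weighted supremum. The bound C is needed only for
that supremum to be finite and does not enter the conclusion, and λ depends on c alone; both facts
are what later make bounds uniform up to the end of an interval. -/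
theorem singular_gronwall {c : ℝ} (hc : 0 ≤ c) : ∃ lam : ℝ, 0 < lam ∧
    ∀ (φ : ℝ → ℝ) (a C t₁ : ℝ), 0 ≤ a → (∀ t ∈ Set.Ioc 0 t₁, 0 ≤ φ t) →
      (∀ t ∈ Set.Ioc 0 t₁, φ t ≤ C) →
      (∀ t ∈ Set.Ioc 0 t₁, φ t ≤ a + c * ∫ s in Set.Ioo 0 t, (t - s) ^ (-(1 / 2) : ℝ) * φ s) →
      ∀ t ∈ Set.Ioc 0 t₁, φ t ≤ 2 * a * Real.exp (lam * t) := by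
  obtain ⟨lam, κ, hl, hκ, hcκ, hker⟩ := exists_weight c
  refine ⟨lam, hl, fun φ a C t₁ ha h0 hC hineq => ?_⟩
  set A : Set ℝ := (fun t => Real.exp (-(lam * t)) * φ t) '' Set.Ioc 0 t₁ with hA
  have hbdd : BddAbove A := by
    refine ⟨C, ?_⟩
    rintro _ ⟨t, ht, rfl⟩
    have : Real.exp (-(lam * t)) ≤ 1 := by
      rw [Real.exp_le_one_iff]
      have := mul_pos hl ht.1
      linarith
    exact (mul_le_of_le_one_left (h0 t ht) this).trans (hC t ht)
  have hle : ∀ t ∈ Set.Ioc 0 t₁, φ t ≤ sSup A * Real.exp (lam * t) := by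
    intro t ht
    have := le_csSup hbdd (Set.mem_image_of_mem (fun t => Real.exp (-(lam * t)) * φ t) ht)
    calc φ t = (Real.exp (-(lam * t)) * φ t) * Real.exp (lam * t) := by
          rw [mul_right_comm, ← Real.exp_add]; simp
      _ ≤ _ := by gcongr
  intro t ht
  have hM0 : 0 ≤ sSup A := by
    have h1 := hle t ht
    have h2 := h0 t ht
    by_contra hneg
    have := mul_neg_of_neg_of_pos (not_le.1 hneg) (Real.exp_pos (lam * t))
    linarith
  have hstep : ∀ t ∈ Set.Ioc 0 t₁,
      Real.exp (-(lam * t)) * φ t ≤ a + sSup A / 2 := by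
    intro t ht
    have h1 : ∫ s in Set.Ioo 0 t, (t - s) ^ (-(1 / 2) : ℝ) * φ s ≤
        ∫ s in Set.Ioo 0 t, sSup A * ((t - s) ^ (-(1 / 2) : ℝ) * Real.exp (lam * s)) := by
      -- Only the majorant has to be integrable here, so no measurability of φ is required.
      refine integral_mono_of_nonneg ?_ ((integrableOn_singular_exp lam t).const_mul _) ?_
      · refine (ae_restrict_iff' measurableSet_Ioo).2 (Eventually.of_forall fun s hs => ?_)
        have h3 := h0 s ⟨hs.1, hs.2.le.trans ht.2⟩
        have : 0 < t - s := sub_pos.2 hs.2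
        simp only [Pi.zero_apply]
        positivity
      · refine (ae_restrict_iff' measurableSet_Ioo).2 (Eventually.of_forall fun s hs => ?_)
        have h3 := hle s ⟨hs.1, hs.2.le.trans ht.2⟩
        have : 0 < t - s := sub_pos.2 hs.2
        simp only
        calc (t - s) ^ (-(1 / 2) : ℝ) * φ s
            ≤ (t - s) ^ (-(1 / 2) : ℝ) * (sSup A * Real.exp (lam * s)) := by gcongr
          _ = _ := by ring
    rw [integral_const_mul] at h1
    have hφ : φ t ≤ a + sSup A / 2 * Real.exp (lam * t) := by
      calc φ t ≤ a + c * ∫ s in Set.Ioo 0 t, (t - s) ^ (-(1 / 2) : ℝ) * φ s := hineq t ht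
        _ ≤ a + c * (sSup A * (κ * Real.exp (lam * t))) := by
          have := hker t
          gcongr
          exact h1.trans (by gcongr)
        _ = a + (c * κ) * (sSup A * Real.exp (lam * t)) := by ring
        _ ≤ a + (1 / 2) * (sSup A * Real.exp (lam * t)) := by gcongr
        _ = _ := by ring
    have he : Real.exp (-(lam * t)) ≤ 1 := by
      rw [Real.exp_le_one_iff]
      have := mul_pos hl ht.1
      linarith
    calc Real.exp (-(lam * t)) * φ t
        ≤ Real.exp (-(lam * t)) * (a + sSup A / 2 * Real.exp (lam * t)) := by gcongr
      _ = Real.exp (-(lam * t)) * a + sSup A / 2 * (Real.exp (-(lam * t)) * Real.exp (lam * t)) := by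
          ring
      _ = Real.exp (-(lam * t)) * a + sSup A / 2 := by rw [← Real.exp_add]; simp
      _ ≤ a + sSup A / 2 := by
          gcongr
          exact mul_le_of_le_one_left ha he
  have hM : sSup A ≤ 2 * a := by
    have : sSup A ≤ a + sSup A / 2 := by
      refine csSup_le ⟨_, Set.mem_image_of_mem _ ht⟩ ?_
      rintro _ ⟨s, hs, rfl⟩
      exact hstep s hs
    linarith
  exact (hle t ht).trans (by gcongr)

/-! ### Radial truncation -/

section Truncation

variable {V : Type*} [NormedAddCommGroup V] [NormedSpace ℝ V]

/-- The radial retraction onto the closed ball of radius `R`. -/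
def radialRetraction (R : ℝ) (v : V) : V := (R / max R ‖v‖) • v

theorem radialRetraction_of_norm_le {R : ℝ} (hR : 0 < R) {v : V} (hv : ‖v‖ ≤ R) :
    radialRetraction R v = v := by
  rw [radialRetraction, max_eq_left hv, div_self hR.ne', one_smul]

theorem norm_radialRetraction_le {R : ℝ} (hR : 0 < R) (v : V) : ‖radialRetraction R v‖ ≤ R := by
  have hm : 0 < max R ‖v‖ := hR.trans_le (le_max_left _ _)
  rw [radialRetraction, norm_smul, Real.norm_of_nonneg (by positivity), div_mul_eq_mul_div,
    div_le_iff₀ hm]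
  gcongr
  exact le_max_right _ _

theorem norm_radialRetraction_le_norm {R : ℝ} (hR : 0 < R) (v : V) :
    ‖radialRetraction R v‖ ≤ ‖v‖ := by
  have hm : 0 < max R ‖v‖ := hR.trans_le (le_max_left _ _)
  rw [radialRetraction, norm_smul, Real.norm_of_nonneg (by positivity)]
  exact mul_le_of_le_one_left (norm_nonneg _) ((div_le_one hm).2 (le_max_left _ _))

/-- The difference splits into a change of vector at a fixed scalar and a change of scalar at a
fixed vector. Each part costs at most ‖v - w‖, whence the factor 2, which is available in every
normed space. -/
theorem norm_radialRetraction_sub_le {R : ℝ} (hR : 0 < R) (v w : V) :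
    ‖radialRetraction R v - radialRetraction R w‖ ≤ 2 * ‖v - w‖ := by
  set a := max R ‖v‖ with ha
  set b := max R ‖w‖ with hb
  have ha0 : 0 < a := hR.trans_le (le_max_left _ _)
  have hb0 : 0 < b := hR.trans_le (le_max_left _ _)
  have hab : |b - a| ≤ ‖v - w‖ := by
    rw [ha, hb, max_comm R, max_comm R, norm_sub_rev]
    exact (abs_max_sub_max_le_abs ‖w‖ ‖v‖ R).trans (abs_norm_sub_norm_le w v)
  have key : radialRetraction R v - radialRetraction R w =
      (R / a) • (v - w) + (R / a * ((b - a) / b)) • w := by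
    rw [radialRetraction, radialRetraction, ← ha, ← hb]
    have : R / a * ((b - a) / b) = R / a - R / b := by field_simp
    rw [this, smul_sub, sub_smul]
    abel
  rw [key]
  refine (norm_add_le _ _).trans ?_
  have h1 : R / a ≤ 1 := (div_le_one ha0).2 (le_max_left _ _)
  have h2 : ‖w‖ / b ≤ 1 := (div_le_one hb0).2 (le_max_right _ _)
  rw [norm_smul, norm_smul, norm_mul, norm_div, norm_div, Real.norm_of_nonneg hR.le,
    Real.norm_of_nonneg ha0.le, Real.norm_of_nonneg hb0.le, Real.norm_eq_abs]
  calc R / a * ‖v - w‖ + R / a * (|b - a| / b) * ‖w‖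
      = R / a * ‖v - w‖ + R / a * |b - a| * (‖w‖ / b) := by ring
    _ ≤ 1 * ‖v - w‖ + 1 * ‖v - w‖ * 1 := by gcongr
    _ = 2 * ‖v - w‖ := by ring

end Truncation

end

section

/-! ### Mild equations `u_t = S_t z₀ + ∫₀ᵗ P_{t-s}(u_s, u_s) ds` in a Banach space -/

/-- A semigroup `S` with a family of bilinear operators `P` of size `τ^{-1/2}`. -/
structure MildSystem (V : Type*) [NormedAddCommGroup V] [NormedSpace ℝ V] where
  S : ℝ → V →L[ℝ] V
  P : ℝ → V →L[ℝ] V →L[ℝ] V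
  cS : ℝ
  cP : ℝ
  norm_S_le : ∀ t, 0 < t → ‖S t‖ ≤ cS
  norm_P_le : ∀ t, 0 < t → ‖P t‖ ≤ cP * t ^ (-(1 / 2) : ℝ)
  continuousOn_S : ContinuousOn S (Set.Ioi 0)
  continuousOn_P : ContinuousOn P (Set.Ioi 0)
  S_S : ∀ s t v, 0 < s → 0 < t → S s (S t v) = S (s + t) v
  S_P : ∀ s t v w, 0 < s → 0 < t → S s (P t v w) = P (s + t) v w

namespace MildSystem

variable {V : Type*} [NormedAddCommGroup V] [NormedSpace ℝ V] (Y : MildSystem V)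

theorem cS_nonneg : 0 ≤ Y.cS := (norm_nonneg _).trans (Y.norm_S_le 1 one_pos)

theorem cP_nonneg : 0 ≤ Y.cP := by
  have h := (norm_nonneg (Y.P 1)).trans (Y.norm_P_le 1 one_pos)
  simpa using h

theorem norm_S_apply_le {t : ℝ} (ht : 0 < t) (v : V) : ‖Y.S t v‖ ≤ Y.cS * ‖v‖ :=
  (Y.S t).le_of_opNorm_le (Y.norm_S_le t ht) v

theorem norm_P_apply_le {t : ℝ} (ht : 0 < t) (v w : V) :
    ‖Y.P t v w‖ ≤ Y.cP * t ^ (-(1 / 2) : ℝ) * ‖v‖ * ‖w‖ :=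
  (Y.P t).le_of_opNorm₂_le_of_le (Y.norm_P_le t ht) le_rfl le_rfl

theorem norm_P_sub_le {t : ℝ} (ht : 0 < t) (v w : V) :
    ‖Y.P t v v - Y.P t w w‖ ≤ Y.cP * t ^ (-(1 / 2) : ℝ) * ((‖v‖ + ‖w‖) * ‖v - w‖) := by
  have h : Y.P t v v - Y.P t w w = Y.P t (v - w) v + Y.P t w (v - w) := by
    simp [map_sub]
  rw [h]
  refine (norm_add_le _ _).trans ((add_le_add (Y.norm_P_apply_le ht _ _)
    (Y.norm_P_apply_le ht _ _)).trans (le_of_eq ?_))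
  ring

/-- The Duhamel integral. -/
def duhamel (g : ℝ → V) (t : ℝ) : V := ∫ s in Set.Ioo 0 t, Y.P (t - s) (g s) (g s)

theorem continuousOn_integrand {g : ℝ → V} {t : ℝ} (hg : ContinuousOn g (Set.Ioo 0 t)) :
    ContinuousOn (fun s => Y.P (t - s) (g s) (g s)) (Set.Ioo 0 t) := by
  have h : ContinuousOn (fun s => Y.P (t - s)) (Set.Ioo 0 t) :=
    Y.continuousOn_P.comp (by fun_prop) fun s hs => by simpa using hs.2
  exact (h.clm_apply hg).clm_apply hg

theorem norm_integrand_le {g : ℝ → V} {t R : ℝ} (hR : ∀ s ∈ Set.Ioo 0 t, ‖g s‖ ≤ R) :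
    ∀ s ∈ Set.Ioo 0 t, ‖Y.P (t - s) (g s) (g s)‖ ≤ Y.cP * R ^ 2 * (t - s) ^ (-(1 / 2) : ℝ) := by
  intro s hs
  have hts : 0 < t - s := sub_pos.2 hs.2
  have hcP := Y.cP_nonneg
  have h := hR s hs
  have h0 := (norm_nonneg _).trans h
  calc _ ≤ Y.cP * (t - s) ^ (-(1 / 2) : ℝ) * ‖g s‖ * ‖g s‖ := Y.norm_P_apply_le hts _ _
    _ ≤ Y.cP * (t - s) ^ (-(1 / 2) : ℝ) * R * R := by gcongr
    _ = _ := by ring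

theorem integrableOn_integrand {g : ℝ → V} {t R : ℝ} (hg : ContinuousOn g (Set.Ioo 0 t))
    (hR : ∀ s ∈ Set.Ioo 0 t, ‖g s‖ ≤ R) :
    IntegrableOn (fun s => Y.P (t - s) (g s) (g s)) (Set.Ioo 0 t) := by
  refine Integrable.mono' ((integrableOn_singular_sub t).const_mul (Y.cP * R ^ 2))
    ((Y.continuousOn_integrand hg).aestronglyMeasurable measurableSet_Ioo) ?_
  exact (ae_restrict_iff' measurableSet_Ioo).2 (Eventually.of_forall (Y.norm_integrand_le hR))

theorem norm_duhamel_le {g : ℝ → V} {t R : ℝ} (ht : 0 ≤ t)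
    (hR : ∀ s ∈ Set.Ioo 0 t, ‖g s‖ ≤ R) :
    ‖Y.duhamel g t‖ ≤ Y.cP * R ^ 2 * (2 * t ^ (1 / 2 : ℝ)) := by
  rw [← integral_singular_sub ht, ← integral_const_mul]
  refine norm_integral_le_of_norm_le ((integrableOn_singular_sub t).const_mul (Y.cP * R ^ 2)) ?_
  exact (ae_restrict_iff' measurableSet_Ioo).2 (Eventually.of_forall (Y.norm_integrand_le hR))

/-- After reflection the singularity sits at r = 0 for every t, and t enters only through the
translate of g and the cut-off. This is the form suited to dominated convergence in t. -/
theorem duhamel_eq (g : ℝ → V) (t : ℝ) :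
    Y.duhamel g t = ∫ r, (Set.Ioo 0 t).indicator (fun r => Y.P r (g (t - r)) (g (t - r))) r := by
  rw [integral_indicator measurableSet_Ioo, duhamel,
    ← (measurePreserving_reflect t).integral_comp (measurableEmbedding_reflect t)
    (fun r => Y.P r (g (t - r)) (g (t - r)))]
  simp

theorem continuous_duhamel {g : ℝ → V} {R : ℝ} (hg : ContinuousOn g (Set.Ioi 0))
    (hR : ∀ s, 0 < s → ‖g s‖ ≤ R) : Continuous (Y.duhamel g) := by
  rw [continuous_iff_continuousAt]
  intro t₀
  have hfun : Y.duhamel g = fun t => ∫ r, (Set.Ioo 0 t).indicator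
      (fun r => Y.P r (g (t - r)) (g (t - r))) r := funext (Y.duhamel_eq g)
  rw [hfun]
  refine continuousAt_of_dominated (bound := (Set.Ioo 0 (t₀ + 1)).indicator
    (fun r => Y.cP * R ^ 2 * r ^ (-(1 / 2) : ℝ))) ?_ ?_ ?_ ?_
  · refine Eventually.of_forall fun t => ?_
    rw [aestronglyMeasurable_indicator_iff measurableSet_Ioo]
    refine ContinuousOn.aestronglyMeasurable ?_ measurableSet_Ioo
    have h1 : ContinuousOn (fun r => g (t - r)) (Set.Ioo 0 t) :=
      hg.comp (by fun_prop) fun r hr => by simpa using hr.2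
    exact ((Y.continuousOn_P.mono Set.Ioo_subset_Ioi_self).clm_apply h1).clm_apply h1
  · filter_upwards [Iio_mem_nhds (lt_add_one t₀)] with t ht
    refine Eventually.of_forall fun r => ?_
    by_cases hr : r ∈ Set.Ioo 0 t
    · have hr' : r ∈ Set.Ioo 0 (t₀ + 1) := ⟨hr.1, hr.2.trans ht⟩
      rw [Set.indicator_of_mem hr, Set.indicator_of_mem hr']
      have h2 := Y.norm_integrand_le (g := g) (t := t) (R := R) (fun s hs => hR s hs.1) (t - r)
        ⟨sub_pos.2 hr.2, by linarith [hr.1]⟩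
      simpa using h2
    · rw [Set.indicator_of_notMem hr, norm_zero]
      refine Set.indicator_nonneg (fun r hr => ?_) _
      have := Y.cP_nonneg
      have h3 : 0 < r := hr.1
      positivity
  · rw [integrable_indicator_iff measurableSet_Ioo]
    exact (integrableOn_singular _).const_mul _
  -- Off the null set {t₀}, the cut-off at r is constant for t near t₀, so only the continuity of g
  -- at the positive time t₀ - r matters.
  · have h0 : ∀ᵐ r : ℝ, r ≠ t₀ := Measure.ae_ne volume t₀
    filter_upwards [h0] with r hr
    by_cases hr0 : 0 < r
    · rcases lt_or_gt_of_ne hr with h | h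
      · have hc : ContinuousAt (fun t => Y.P r (g (t - r)) (g (t - r))) t₀ := by
          have h1 : ContinuousAt (fun t => g (t - r)) t₀ :=
            ContinuousAt.comp (f := fun t => t - r) (g := g)
              (hg.continuousAt (Ioi_mem_nhds (sub_pos.2 h))) (by fun_prop)
          exact (continuousAt_const.clm_apply h1).clm_apply h1
        refine hc.congr ?_
        filter_upwards [Ioi_mem_nhds h] with t ht
        rw [Set.indicator_of_mem (show r ∈ Set.Ioo 0 t from ⟨hr0, ht⟩)]
      · refine (continuousAt_const (y := (0 : V))).congr ?_
        filter_upwards [Iio_mem_nhds h] with t ht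
        rw [Set.indicator_of_notMem fun hm => (lt_asymm hm.2 ht).elim]
    · refine (continuousAt_const (y := (0 : V))).congr ?_
      refine Eventually.of_forall fun t => ?_
      simp only
      rw [Set.indicator_of_notMem fun hm => hr0 hm.1]

theorem continuousOn_S_apply (v : V) : ContinuousOn (fun t => Y.S t v) (Set.Ioi 0) :=
  Y.continuousOn_S.clm_apply continuousOn_const

/-- `u` solves on `(0,T)` the mild equation in which the nonlinearity is composed with `θ`. -/
structure IsSol (θ : V → V) (z₀ : V) (T : EReal) (u : ℝ → V) : Prop where
  continuousOn : ContinuousOn u {t : ℝ | 0 < t ∧ (t : EReal) < T}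
  bounded : ∀ T' : ℝ, (T' : EReal) < T → ∃ C, ∀ t ∈ Set.Ioc 0 T', ‖u t‖ ≤ C
  eq : ∀ t : ℝ, 0 < t → (t : EReal) < T → u t = Y.S t z₀ + Y.duhamel (fun s => θ (u s)) t

variable {Y}

theorem IsSol.mono {θ : V → V} {z₀ : V} {T T' : EReal} {u : ℝ → V} (h : Y.IsSol θ z₀ T u)
    (hT : T' ≤ T) : Y.IsSol θ z₀ T' u :=
  ⟨h.continuousOn.mono fun _ ht => ⟨ht.1, ht.2.trans_le hT⟩,
    fun t ht => h.bounded t (ht.trans_le hT), fun t ht ht' => h.eq t ht (ht'.trans_le hT)⟩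

theorem isOpen_Ioo_EReal (T : EReal) : IsOpen {t : ℝ | 0 < t ∧ (t : EReal) < T} :=
  (isOpen_lt continuous_const continuous_id).inter
    (isOpen_lt continuous_coe_real_ereal continuous_const)

theorem duhamel_congr {g h : ℝ → V} {t : ℝ} (hgh : ∀ s ∈ Set.Ioo 0 t, g s = h s) :
    Y.duhamel g t = Y.duhamel h t :=
  setIntegral_congr_fun measurableSet_Ioo fun s hs => by simp only [hgh s hs]

/-- Changing θ along with the curve is what allows passage between the truncated and the true
equation while the solution stays in the ball. -/
theorem IsSol.congr {θ θ' : V → V} {z₀ : V} {T : EReal} {u v : ℝ → V} (h : Y.IsSol θ z₀ T u)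
    (huv : ∀ t : ℝ, 0 < t → (t : EReal) < T → u t = v t)
    (hθ : ∀ t : ℝ, 0 < t → (t : EReal) < T → θ (u t) = θ' (v t)) : Y.IsSol θ' z₀ T v := by
  refine ⟨h.continuousOn.congr fun t ht => (huv t ht.1 ht.2).symm, fun T' hT' => ?_,
    fun t ht ht' => ?_⟩
  · obtain ⟨C, hC⟩ := h.bounded T' hT'
    exact ⟨C, fun t ht => huv t ht.1 ((EReal.coe_le_coe_iff.2 ht.2).trans_lt hT') ▸ hC t ht⟩
  · rw [← huv t ht ht', h.eq t ht ht']
    congr 1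
    exact duhamel_congr fun s hs => hθ s hs.1 ((EReal.coe_lt_coe_iff.2 hs.2).trans ht')

theorem IsSol.continuousOn_Ioo {θ : V → V} {z₀ : V} {T : EReal} {u : ℝ → V}
    (h : Y.IsSol θ z₀ T u) {t : ℝ} (ht : (t : EReal) < T) : ContinuousOn u (Set.Ioc 0 t) :=
  h.continuousOn.mono fun _ hs => ⟨hs.1, (EReal.coe_le_coe_iff.2 hs.2).trans_lt ht⟩

/-- Uniqueness. -/
theorem IsSol.unique {θ : V → V} (hθ : Continuous θ) (hθ0 : ∀ v, ‖θ v‖ ≤ ‖v‖)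
    (hθ2 : ∀ v w, ‖θ v - θ w‖ ≤ 2 * ‖v - w‖) {z₀ : V} {T : EReal}
    {u v : ℝ → V} (hu : Y.IsSol θ z₀ T u) (hv : Y.IsSol θ z₀ T v) :
    ∀ t : ℝ, 0 < t → (t : EReal) < T → u t = v t := by
  intro t₁ ht₁ ht₁T
  obtain ⟨C, hC⟩ := hu.bounded t₁ ht₁T
  obtain ⟨D, hD⟩ := hv.bounded t₁ ht₁T
  have hC0 : 0 ≤ C := (norm_nonneg _).trans (hC t₁ ⟨ht₁, le_rfl⟩)
  have hD0 : 0 ≤ D := (norm_nonneg _).trans (hD t₁ ⟨ht₁, le_rfl⟩)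
  have hcP := Y.cP_nonneg
  -- Bilinearity contributes C + D and the Lipschitz constant of θ contributes 2. Gronwall is
  -- applied with zero inhomogeneity.
  obtain ⟨lam, -, hG⟩ := singular_gronwall (c := Y.cP * ((C + D) * 2)) (by positivity)
  have := hG (fun t => ‖u t - v t‖) 0 (C + D) t₁ le_rfl (fun _ _ => norm_nonneg _)
    (fun t ht => (norm_sub_le _ _).trans (add_le_add (hC t ht) (hD t ht))) ?_ t₁ ⟨ht₁, le_rfl⟩
  · simp only [mul_zero, zero_mul] at this
    exact sub_eq_zero.1 (norm_le_zero_iff.1 this)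
  · intro t ht
    have htT : (t : EReal) < T := (EReal.coe_le_coe_iff.2 ht.2).trans_lt ht₁T
    have hsub : ∀ s ∈ Set.Ioo 0 t, s ∈ Set.Ioc 0 t₁ := fun s hs => ⟨hs.1, hs.2.le.trans ht.2⟩
    have hcu : ContinuousOn u (Set.Ioo 0 t) :=
      (hu.continuousOn_Ioo ht₁T).mono hsub
    have hcv : ContinuousOn v (Set.Ioo 0 t) :=
      (hv.continuousOn_Ioo ht₁T).mono hsub
    rw [hu.eq t ht.1 htT, hv.eq t ht.1 htT, add_sub_add_left_eq_sub, zero_add, duhamel, duhamel,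
      ← integral_sub (Y.integrableOn_integrand (g := fun s => θ (u s)) (R := C) (hθ.comp_continuousOn hcu)
        fun s hs => (hθ0 _).trans (hC s (hsub s hs)))
      (Y.integrableOn_integrand (g := fun s => θ (v s)) (R := D) (hθ.comp_continuousOn hcv)
        fun s hs => (hθ0 _).trans (hD s (hsub s hs))), ← integral_const_mul]
    refine norm_integral_le_of_norm_le ?_ ?_
    · refine Integrable.const_mul ?_ _
      refine (integrableOn_singular_sub t).mul_bdd (c := C + D)
        ((hcu.sub hcv).norm.aestronglyMeasurable measurableSet_Ioo) ?_
      refine (ae_restrict_iff' measurableSet_Ioo).2 (Eventually.of_forall fun s hs => ?_)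
      rw [norm_norm]
      exact (norm_sub_le _ _).trans (add_le_add (hC s (hsub s hs)) (hD s (hsub s hs)))
    · refine (ae_restrict_iff' measurableSet_Ioo).2 (Eventually.of_forall fun s hs => ?_)
      have hts : 0 < t - s := sub_pos.2 hs.2
      refine (Y.norm_P_sub_le hts _ _).trans ?_
      have h1 := (hθ0 _).trans (hC s (hsub s hs))
      have h2 := (hθ0 _).trans (hD s (hsub s hs))
      calc _ ≤ Y.cP * (t - s) ^ (-(1 / 2) : ℝ) * ((C + D) * (2 * ‖u s - v s‖)) := by
            gcongr
            exact hθ2 _ _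
        _ = _ := by ring

/-- The Duhamel term of a bounded curve is O(t^{1/2}). Nothing is claimed about S_t z₀ itself, which
need not converge to z₀. -/
theorem IsSol.tendsto_zero {θ : V → V} (hθ0 : ∀ v, ‖θ v‖ ≤ ‖v‖) {z₀ : V} {T : EReal}
    (hT : 0 < T) {u : ℝ → V} (hu : Y.IsSol θ z₀ T u) :
    Tendsto (fun t => u t - Y.S t z₀) (𝓝[>] 0) (𝓝 0) := by
  obtain ⟨t₁, ht₁, ht₁T⟩ := EReal.lt_iff_exists_real_btwn.1 hT
  have ht₁0 : 0 < t₁ := by exact_mod_cast ht₁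
  obtain ⟨C, hC⟩ := hu.bounded t₁ ht₁T
  have hlim : Tendsto (fun t : ℝ => Y.cP * C ^ 2 * (2 * t ^ (1 / 2 : ℝ))) (𝓝[>] 0) (𝓝 0) := by
    have h1 : Continuous fun t : ℝ => Y.cP * C ^ 2 * (2 * t ^ (1 / 2 : ℝ)) := by
      have := Real.continuous_rpow_const (q := 1 / 2) (by norm_num)
      fun_prop
    have := h1.tendsto 0
    simp only [one_div, ne_eq, inv_eq_zero, OfNat.ofNat_ne_zero, not_false_eq_true,
      Real.zero_rpow, mul_zero] at this
    simpa using this.mono_left nhdsWithin_le_nhds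
  refine squeeze_zero_norm' ?_ hlim
  filter_upwards [Ioc_mem_nhdsGT ht₁0] with t ht
  rw [hu.eq t ht.1 ((EReal.coe_le_coe_iff.2 ht.2).trans_lt ht₁T), add_sub_cancel_left]
  exact Y.norm_duhamel_le ht.1.le fun s hs => (hθ0 _).trans (hC s ⟨hs.1, hs.2.le.trans ht.2⟩)

/-- The truncated equation is globally solvable. -/
theorem exists_isSol_truncated [CompleteSpace V] (Y : MildSystem V) (z₀ : V) {R : ℝ} (hR : 0 < R) :
    ∃ u, Y.IsSol (radialRetraction R) z₀ ⊤ u ∧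
      ∀ t, 0 < t → ‖u t‖ ≤ Y.cS * ‖z₀‖ + Y.cP * R ^ 2 * (2 * t ^ (1 / 2 : ℝ)) := by
  have hcP := Y.cP_nonneg
  -- This is the Lipschitz constant of the truncated nonlinearity: two arguments of norm at most R,
  -- and the factor 2 of the retraction.
  obtain ⟨lam, κ, hl, hκ, hcκ, hker⟩ := exists_weight (Y.cP * ((R + R) * 2))
  have hθc : Continuous (radialRetraction R : V → V) := by
    refine (LipschitzWith.of_dist_le_mul (K := 2) fun v w => ?_).continuous
    rw [dist_eq_norm, dist_eq_norm]
    exact norm_radialRetraction_sub_le hR v w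
  -- The unknown is w_s = e^{-λs}(u_s - S_s z₀). Unlike u it extends continuously to all of ℝ,
  -- vanishing for s ≤ 0, even when S_s z₀ is discontinuous at 0; the weight makes it bounded.
  set y : BoundedContinuousFunction ℝ V → ℝ → V :=
    fun w s => Y.S s z₀ + Real.exp (lam * s) • w s with hy
  have hyc : ∀ w, ContinuousOn (y w) (Set.Ioi 0) := fun w =>
    (Y.continuousOn_S_apply z₀).add (by fun_prop)
  have hgc : ∀ w, ContinuousOn (fun s => radialRetraction R (y w s)) (Set.Ioi 0) := fun w =>
    hθc.comp_continuousOn (hyc w)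
  have hgR : ∀ w s, ‖radialRetraction R (y w s)‖ ≤ R := fun w s => norm_radialRetraction_le hR _
  have hexp : ∀ t : ℝ, Real.exp (-(lam * t)) * Real.exp (lam * t) = 1 := fun t => by
    rw [← Real.exp_add]; simp
  have hbound : ∀ w t, ‖Real.exp (-(lam * t)) •
      Y.duhamel (fun s => radialRetraction R (y w s)) t‖ ≤ Y.cP * R ^ 2 * κ := by
    intro w t
    rw [norm_smul, Real.norm_eq_abs, Real.abs_exp]
    have : ‖Y.duhamel (fun s => radialRetraction R (y w s)) t‖ ≤
        Y.cP * R ^ 2 * (κ * Real.exp (lam * t)) := by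
      refine le_trans ?_ (mul_le_mul_of_nonneg_left (hker t) (by positivity))
      rw [← integral_const_mul]
      refine norm_integral_le_of_norm_le ((integrableOn_singular_exp lam t).const_mul _) ?_
      refine (ae_restrict_iff' measurableSet_Ioo).2 (Eventually.of_forall fun s hs => ?_)
      have hts : 0 < t - s := sub_pos.2 hs.2
      refine (Y.norm_integrand_le (fun s _ => hgR w s) s hs).trans ?_
      gcongr
      -- The factor e^{λs} ≥ 1 is inserted so that the weighted kernel bound applies to a constant
      -- majorant as well.
      refine le_mul_of_one_le_right (by positivity) (Real.one_le_exp ?_)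
      have := hs.1
      positivity
    calc _ ≤ Real.exp (-(lam * t)) * (Y.cP * R ^ 2 * (κ * Real.exp (lam * t))) := by gcongr
      _ = Y.cP * R ^ 2 * κ * (Real.exp (-(lam * t)) * Real.exp (lam * t)) := by ring
      _ = _ := by rw [hexp, mul_one]
  have hcont : ∀ w, Continuous fun t => Real.exp (-(lam * t)) •
      Y.duhamel (fun s => radialRetraction R (y w s)) t := fun w =>
    (by fun_prop : Continuous fun t => Real.exp (-(lam * t))).smul
      (Y.continuous_duhamel (hgc w) fun s _ => hgR w s)
  set Ψ : BoundedContinuousFunction ℝ V → BoundedContinuousFunction ℝ V := fun w =>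
    BoundedContinuousFunction.ofNormedAddCommGroup _ (hcont w) _ (hbound w) with hΨ
  have hcontr : ContractingWith (1 / 2) Ψ := by
    refine ⟨by rw [← NNReal.coe_lt_coe]; norm_num, LipschitzWith.of_dist_le_mul fun w v => ?_⟩
    rw [BoundedContinuousFunction.dist_le (by positivity)]
    intro t
    rw [dist_eq_norm]
    simp only [hΨ, BoundedContinuousFunction.coe_ofNormedAddCommGroup]
    rw [← smul_sub, norm_smul, Real.norm_eq_abs, Real.abs_exp, duhamel, duhamel,
      ← integral_sub (Y.integrableOn_integrand ((hgc w).mono Set.Ioo_subset_Ioi_self)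
        fun s _ => hgR w s)
      (Y.integrableOn_integrand ((hgc v).mono Set.Ioo_subset_Ioi_self) fun s _ => hgR v s)]
    have hd : ∀ s, ‖w s - v s‖ ≤ dist w v := fun s => by
      rw [← dist_eq_norm]; exact BoundedContinuousFunction.dist_coe_le_dist s
    have : ‖∫ s in Set.Ioo 0 t, (Y.P (t - s) (radialRetraction R (y w s))
        (radialRetraction R (y w s)) - Y.P (t - s) (radialRetraction R (y v s))
        (radialRetraction R (y v s)))‖ ≤
        Y.cP * ((R + R) * 2) * dist w v * (κ * Real.exp (lam * t)) := by
      refine le_trans ?_ (mul_le_mul_of_nonneg_left (hker t) (by positivity))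
      rw [← integral_const_mul]
      refine norm_integral_le_of_norm_le ((integrableOn_singular_exp lam t).const_mul _) ?_
      refine (ae_restrict_iff' measurableSet_Ioo).2 (Eventually.of_forall fun s hs => ?_)
      have hts : 0 < t - s := sub_pos.2 hs.2
      refine (Y.norm_P_sub_le hts _ _).trans ?_
      have h3 : ‖radialRetraction R (y w s) - radialRetraction R (y v s)‖ ≤
          2 * (Real.exp (lam * s) * dist w v) := by
        refine (norm_radialRetraction_sub_le hR _ _).trans ?_
        rw [hy]
        simp only
        rw [add_sub_add_left_eq_sub, ← smul_sub, norm_smul, Real.norm_eq_abs, Real.abs_exp]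
        gcongr
        exact hd s
      calc _ ≤ Y.cP * (t - s) ^ (-(1 / 2) : ℝ) *
            ((R + R) * (2 * (Real.exp (lam * s) * dist w v))) := by
            gcongr
            · exact hgR w s
            · exact hgR v s
        _ = _ := by ring
    calc _ ≤ Real.exp (-(lam * t)) *
          (Y.cP * ((R + R) * 2) * dist w v * (κ * Real.exp (lam * t))) := by gcongr
      _ = Y.cP * ((R + R) * 2) * κ * dist w v * (Real.exp (-(lam * t)) * Real.exp (lam * t)) := by
          ring
      _ = Y.cP * ((R + R) * 2) * κ * dist w v := by rw [hexp, mul_one]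
      _ ≤ 1 / 2 * dist w v := by gcongr
      _ = _ := by norm_num
  set w := ContractingWith.fixedPoint Ψ hcontr with hw
  have hfix : Ψ w = w := hcontr.fixedPoint_isFixedPt
  have heq : ∀ t, y w t = Y.S t z₀ + Y.duhamel (fun s => radialRetraction R (y w s)) t := by
    intro t
    have h1 : Real.exp (-(lam * t)) • Y.duhamel (fun s => radialRetraction R (y w s)) t = w t :=
      congrArg (fun f : BoundedContinuousFunction ℝ V => f t) hfix
    have h2 : y w t = Y.S t z₀ + Real.exp (lam * t) • w t := rfl
    rw [h2, ← h1, smul_smul, mul_comm, hexp, one_smul]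
  have hb : ∀ t, 0 < t → ‖y w t‖ ≤ Y.cS * ‖z₀‖ + Y.cP * R ^ 2 * (2 * t ^ (1 / 2 : ℝ)) := by
    intro t ht
    rw [heq t]
    exact (norm_add_le _ _).trans (add_le_add (Y.norm_S_apply_le ht z₀)
      (Y.norm_duhamel_le ht.le fun s _ => hgR w s))
  refine ⟨y w, ⟨(hyc w).mono fun t ht => ht.1, fun T' _ => ?_, fun t _ _ => heq t⟩, hb⟩
  refine ⟨Y.cS * ‖z₀‖ + Y.cP * R ^ 2 * (2 * T' ^ (1 / 2 : ℝ)), fun t ht => (hb t ht.1).trans ?_⟩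
  have := ht.1.le
  gcongr
  exact ht.2

end MildSystem

end

/-! ### Maximal solutions, blow-up, and transfer of solutions along bounded linear maps -/

section

namespace MildSystem

variable {V : Type*} [NormedAddCommGroup V] [NormedSpace ℝ V] {Y : MildSystem V}

theorem continuous_radialRetraction {R : ℝ} (hR : 0 < R) :
    Continuous (radialRetraction R : V → V) := by
  refine (LipschitzWith.of_dist_le_mul (K := 2) fun v w => ?_).continuous
  rw [dist_eq_norm, dist_eq_norm]
  exact norm_radialRetraction_sub_le hR v w

theorem IsSol.unique_id {z₀ : V} {T : EReal}
    {u v : ℝ → V} (hu : Y.IsSol id z₀ T u) (hv : Y.IsSol id z₀ T v) :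
    ∀ t : ℝ, 0 < t → (t : EReal) < T → u t = v t :=
  hu.unique continuous_id (fun _ => le_rfl)
    (fun v w => by simpa using le_mul_of_one_le_left (norm_nonneg (v - w)) one_le_two) hv

/-- A truncated solution that stays below the truncation level is a solution. -/
theorem IsSol.of_truncated {z₀ : V} {T : EReal} {R : ℝ} (hR : 0 < R) {u : ℝ → V}
    (hu : Y.IsSol (radialRetraction R) z₀ ⊤ u)
    (hb : ∀ t : ℝ, 0 < t → (t : EReal) < T → ‖u t‖ ≤ R) : Y.IsSol id z₀ T u :=
  (hu.mono le_top).congr (fun _ _ _ => rfl)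
    fun t ht ht' => radialRetraction_of_norm_le hR (hb t ht ht')

variable [CompleteSpace V]

theorem exists_local (Y : MildSystem V) (z₀ : V) : ∃ T : EReal, 0 < T ∧ ∃ u, Y.IsSol id z₀ T u := by
  have hcS := Y.cS_nonneg
  -- The linear part uses cS ‖z₀‖, and the spare 1 is room for the Duhamel term, which is below 1
  -- for short times.
  set R := Y.cS * ‖z₀‖ + 1 with hRdef
  have hR : 0 < R := by positivity
  obtain ⟨u, hu, hb⟩ := Y.exists_isSol_truncated z₀ hR
  have h1 : Continuous fun t : ℝ => Y.cP * R ^ 2 * (2 * t ^ (1 / 2 : ℝ)) := by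
    have := Real.continuous_rpow_const (q := 1 / 2) (by norm_num)
    fun_prop
  have h2 : ∀ᶠ t in 𝓝 (0 : ℝ), Y.cP * R ^ 2 * (2 * t ^ (1 / 2 : ℝ)) < 1 := by
    refine h1.tendsto 0 |>.eventually_lt_const ?_
    simp
  obtain ⟨ε, hε, hball⟩ := Metric.eventually_nhds_iff.1 h2
  refine ⟨(ε : ℝ), by exact_mod_cast hε, u, hu.of_truncated hR fun t ht htε => ?_⟩
  have htε' : t < ε := by exact_mod_cast htε
  have := hball (y := t) (by rw [dist_zero_right, Real.norm_of_nonneg ht.le]; exact htε')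
  exact (hb t ht).trans (by rw [hRdef]; linarith)

/-- A solution bounded on `(0,T)` extends beyond `T`. -/
theorem IsSol.exists_extension {z₀ : V} {T R : ℝ} (hT : 0 < T) {u : ℝ → V}
    (hu : Y.IsSol id z₀ T u) (hb : ∀ t ∈ Set.Ioo 0 T, ‖u t‖ ≤ R) :
    ∃ ε : ℝ, 0 < ε ∧ ∃ v, Y.IsSol id z₀ ((T + ε : ℝ) : EReal) v := by
  have hR0 : 0 ≤ R := (norm_nonneg _).trans (hb (T / 2) ⟨by linarith, by linarith⟩)
  have hR : 0 < R + 1 := by linarith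
  -- Truncation at R + 1 leaves a margin: the global truncated solution agrees with u before T, has
  -- norm at most R at T by continuity, and so stays below R + 1 for some time after T.
  obtain ⟨v, hv, -⟩ := Y.exists_isSol_truncated z₀ hR
  have hu' : Y.IsSol (radialRetraction (R + 1)) z₀ T u :=
    hu.congr (fun _ _ _ => rfl) fun t ht ht' =>
      (radialRetraction_of_norm_le hR ((hb t ⟨ht, by exact_mod_cast ht'⟩).trans (by linarith))).symm
  have huv : ∀ t ∈ Set.Ioo 0 T, ‖v t‖ ≤ R := fun t ht => by
    rw [← hu'.unique (continuous_radialRetraction hR) (norm_radialRetraction_le_norm hR)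
      (norm_radialRetraction_sub_le hR) (hv.mono le_top) t ht.1 (by exact_mod_cast ht.2)]
    exact hb t ht
  have hvT : ContinuousAt v T :=
    hv.continuousOn.continuousAt ((isOpen_Ioo_EReal ⊤).mem_nhds ⟨hT, EReal.coe_lt_top T⟩)
  have hvR : ‖v T‖ ≤ R := by
    have h1 : Tendsto (fun t => ‖v t‖) (𝓝[<] T) (𝓝 ‖v T‖) :=
      (hvT.norm.tendsto).mono_left nhdsWithin_le_nhds
    refine le_of_tendsto h1 ?_
    filter_upwards [Ioo_mem_nhdsLT hT] with t ht using huv t ht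
  have h2 : ∀ᶠ t in 𝓝 T, ‖v t‖ < R + 1 := hvT.norm.eventually_lt_const (by linarith)
  obtain ⟨ε, hε, hball⟩ := Metric.eventually_nhds_iff.1 h2
  refine ⟨ε, hε, v, hv.of_truncated hR fun t ht htε => ?_⟩
  have htε' : t < T + ε := by exact_mod_cast htε
  rcases lt_or_ge t T with h | h
  · exact (huv t ⟨ht, h⟩).trans (by linarith)
  · refine (hball ?_).le
    rw [Real.dist_eq, abs_of_nonneg (by linarith)]
    linarith

/-- The equation restarted at time `t₀`. -/
theorem IsSol.restart {z₀ : V} {T : EReal} {u : ℝ → V} (hu : Y.IsSol id z₀ T u) {t₀ t : ℝ}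
    (ht₀ : 0 < t₀) (h : t₀ < t) (ht : (t : EReal) < T) :
    u t = Y.S (t - t₀) (u t₀) + ∫ s in Set.Ioo t₀ t, Y.P (t - s) (u s) (u s) := by
  have hh : 0 < t - t₀ := sub_pos.2 h
  have htpos := ht₀.trans h
  obtain ⟨C, hC⟩ := hu.bounded t ht
  have hc : ContinuousOn u (Set.Ioo 0 t) :=
    (hu.continuousOn_Ioo ht).mono Set.Ioo_subset_Ioc_self
  have hint := Y.integrableOn_integrand hc fun s hs => hC s ⟨hs.1, hs.2.le⟩
  have hint₀ := Y.integrableOn_integrand (t := t₀) (hc.mono (Set.Ioo_subset_Ioo_right h.le))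
    fun s hs => hC s ⟨hs.1, (hs.2.trans h).le⟩
  -- The part of the history before t₀ is, by the semigroup laws, S_{t-t₀} applied to the Duhamel
  -- term at t₀.
  have hunion : Set.Ioo 0 t = Set.Ioc 0 t₀ ∪ Set.Ioo t₀ t :=
    (Set.Ioc_union_Ioo_eq_Ioo ht₀.le h).symm
  have hdisj : Disjoint (Set.Ioc 0 t₀) (Set.Ioo t₀ t) :=
    Set.disjoint_left.2 fun s hs hs' => (hs.2.not_gt hs'.1).elim
  have h0 : (t₀ : EReal) < T := (EReal.coe_lt_coe_iff.2 h).trans ht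
  rw [hu.eq t htpos ht, hu.eq t₀ ht₀ h0, map_add, Y.S_S _ _ _ hh ht₀, sub_add_cancel, add_assoc]
  congr 1
  simp only [duhamel, id]
  rw [hunion, setIntegral_union hdisj measurableSet_Ioo
    (hint.mono_set (hunion ▸ Set.subset_union_left))
    (hint.mono_set (hunion ▸ Set.subset_union_right)), integral_Ioc_eq_integral_Ioo,
    ← ContinuousLinearMap.integral_comp_comm _ hint₀]
  congr 1
  refine setIntegral_congr_fun measurableSet_Ioo fun s hs => ?_
  rw [Y.S_P _ _ _ _ hh (sub_pos.2 hs.2)]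
  congr 3
  ring

theorem IsSol.norm_le_restart {z₀ : V} {T : EReal} {u : ℝ → V} (hu : Y.IsSol id z₀ T u)
    {t₀ t R : ℝ} (ht₀ : 0 < t₀) (h : t₀ < t) (ht : (t : EReal) < T)
    (hR : ∀ s ∈ Set.Ioo t₀ t, ‖u s‖ ≤ R) :
    ‖u t‖ ≤ Y.cS * ‖u t₀‖ + Y.cP * R ^ 2 * (2 * (t - t₀) ^ (1 / 2 : ℝ)) := by
  have hh : 0 < t - t₀ := sub_pos.2 h
  rw [hu.restart ht₀ h ht]
  refine (norm_add_le _ _).trans (add_le_add (Y.norm_S_apply_le hh _) ?_)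
  have hshift : ∫ s in Set.Ioo t₀ t, Y.P (t - s) (u s) (u s) =
      Y.duhamel (fun s => u (s + t₀)) (t - t₀) := by
    have hmp := (measurePreserving_add_right (volume : Measure ℝ) t₀).restrict_preimage
      (measurableSet_Ioo (a := t₀) (b := t))
    rw [← hmp.integral_comp (measurableEmbedding_addRight t₀)]
    simp only [Set.preimage_add_const_Ioo, sub_self, duhamel]
    refine setIntegral_congr_fun measurableSet_Ioo fun s _ => ?_
    congr 3
    ring
  rw [hshift]
  exact Y.norm_duhamel_le hh.le fun s hs => hR _ ⟨by linarith [hs.1], by linarith [hs.2]⟩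

/-- A solution below `M` at some time is bounded on a time interval of length depending on `M`. -/
theorem exists_norm_bound (Y : MildSystem V) (M : ℝ) : ∃ δ R : ℝ, 0 < δ ∧
    ∀ (z₀ : V) (T : EReal) (u : ℝ → V), Y.IsSol id z₀ T u → ∀ t₀ t : ℝ, 0 < t₀ → ‖u t₀‖ ≤ M →
      t₀ ≤ t → t < t₀ + δ → (t : EReal) < T → ‖u t‖ ≤ R := by
  have hcS := Y.cS_nonneg
  have hcP := Y.cP_nonneg
  rcases lt_or_ge M 0 with hM | hM
  · exact ⟨1, 0, one_pos, fun _ _ _ _ _ _ _ h => absurd ((norm_nonneg _).trans h) hM.not_ge⟩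
  -- R exceeds M, so the level R is not yet reached at t₀, and R is at least cS M + 1, the bound
  -- that the restarted equation gives on a short interval.
  set R := (Y.cS + 1) * M + 1 with hR
  have h1 : Continuous fun t : ℝ => Y.cP * R ^ 2 * (2 * t ^ (1 / 2 : ℝ)) := by
    have := Real.continuous_rpow_const (q := 1 / 2) (by norm_num)
    fun_prop
  have h2 : ∀ᶠ t in 𝓝 (0 : ℝ), Y.cP * R ^ 2 * (2 * t ^ (1 / 2 : ℝ)) < 1 := by
    refine h1.tendsto 0 |>.eventually_lt_const ?_
    simp
  obtain ⟨δ, hδ, hball⟩ := Metric.eventually_nhds_iff.1 h2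
  refine ⟨δ, R, hδ, fun z₀ T u hu t₀ t ht₀ hM₀ htt₀ htδ htT => ?_⟩
  by_contra hcon
  rw [not_le] at hcon
  -- At the first time s at which the level R is reached, the restarted estimate on (t₀, s) gives a
  -- norm strictly below R.
  set B := {s ∈ Set.Icc t₀ t | R ≤ ‖u s‖} with hB
  have hcont : ContinuousOn (fun s => ‖u s‖) (Set.Icc t₀ t) :=
    ((hu.continuousOn_Ioo htT).mono fun s hs => ⟨ht₀.trans_le hs.1, hs.2⟩).norm
  have hBc : IsCompact B := by
    have : IsClosed B := hcont.preimage_isClosed_of_isClosed isClosed_Icc isClosed_Ici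
    exact isCompact_Icc.of_isClosed_subset this fun s hs => hs.1
  obtain ⟨s, hsB, hsmin⟩ := hBc.exists_isLeast ⟨t, ⟨htt₀, le_rfl⟩, hcon.le⟩
  have hst₀ : t₀ < s := by
    refine lt_of_le_of_ne hsB.1.1 fun h => ?_
    have h3 := hsB.2
    rw [← h] at h3
    have h4 : (Y.cS + 1) * M = Y.cS * M + M := by ring
    have : 0 ≤ Y.cS * M := by positivity
    linarith
  have h3 := hu.norm_le_restart (R := R) ht₀ hst₀ ((EReal.coe_le_coe_iff.2 hsB.1.2).trans_lt htT)
    fun r hr => by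
      by_contra hrR
      rw [not_le] at hrR
      exact (hsmin ⟨⟨hr.1.le, hr.2.le.trans hsB.1.2⟩, hrR.le⟩).not_gt hr.2
  have h4 := hball (y := s - t₀) (by
    rw [dist_zero_right, Real.norm_of_nonneg (by linarith)]
    linarith [hsB.1.2])
  have h5 : Y.cS * ‖u t₀‖ ≤ Y.cS * M := by gcongr
  have h6 : (Y.cS + 1) * M = Y.cS * M + M := by ring
  linarith [hsB.2]

/-- The maximal solution is the union of all solutions, consistent by uniqueness. Divergence of the
norm, rather than mere unboundedness, comes from `exists_norm_bound`, whose interval length depends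
only on the norm at the restarting time. -/
theorem exists_maximal (Y : MildSystem V) (z₀ : V) : ∃ (Tmax : EReal) (u : ℝ → V), 0 < Tmax ∧
    Y.IsSol id z₀ Tmax u ∧
    (∀ (T : EReal) (v : ℝ → V), 0 < T → Y.IsSol id z₀ T v →
      T ≤ Tmax ∧ ∀ t : ℝ, 0 < t → (t : EReal) < T → v t = u t) ∧
    (∀ T : ℝ, Tmax = (T : EReal) → Tendsto (fun t => ‖u t‖) (𝓝[<] T) atTop) := by
  classical
  set A : Set EReal := {T | 0 < T ∧ ∃ v, Y.IsSol id z₀ T v} with hA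
  -- The solution chosen at each t is arbitrary; uniqueness makes the choice immaterial. The value 0
  -- past the end is never used.
  set u : ℝ → V := fun t =>
    if h : ∃ T ∈ A, (t : EReal) < T then h.choose_spec.1.2.choose t else 0 with hu
  obtain ⟨T₀, hT₀, u₀, hu₀⟩ := Y.exists_local z₀
  have hagree : ∀ (T : EReal) (v : ℝ → V), 0 < T → Y.IsSol id z₀ T v →
      ∀ t : ℝ, 0 < t → (t : EReal) < T → v t = u t := by
    intro T v hT hv t ht htT
    have h : ∃ T ∈ A, (t : EReal) < T := ⟨T, ⟨hT, v, hv⟩, htT⟩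
    have h1 := h.choose_spec.1.2.choose_spec
    have h2 := h.choose_spec.2
    simp only [hu, dif_pos h]
    exact (hv.mono (min_le_left T h.choose)).unique_id (h1.mono (min_le_right _ _)) t ht
      (lt_min htT h2)
  have hsol : Y.IsSol id z₀ (sSup A) u := by
    have hloc : ∀ t : ℝ, (t : EReal) < sSup A → ∃ T, (t : EReal) < T ∧ Y.IsSol id z₀ T u := by
      intro t ht
      obtain ⟨T, ⟨hT, v, hv⟩, htT⟩ := lt_sSup_iff.1 ht
      exact ⟨T, htT, hv.congr (hagree T v hT hv) (hagree T v hT hv)⟩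
    refine ⟨fun t ht => ?_, fun T' hT' => ?_, fun t ht ht' => ?_⟩
    · obtain ⟨T, htT, hT⟩ := hloc t ht.2
      exact (hT.continuousOn.continuousAt ((isOpen_Ioo_EReal T).mem_nhds
        ⟨ht.1, htT⟩)).continuousWithinAt
    · obtain ⟨T, htT, hT⟩ := hloc T' hT'
      exact hT.bounded T' htT
    · obtain ⟨T, htT, hT⟩ := hloc t ht'
      exact hT.eq t ht htT
  have hpos : 0 < sSup A := hT₀.trans_le (le_sSup ⟨hT₀, u₀, hu₀⟩)
  refine ⟨sSup A, u, hpos, hsol, fun T v hT hv => ⟨le_sSup ⟨hT, v, hv⟩, hagree T v hT hv⟩,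
    fun T hTmax => ?_⟩
  rw [hTmax] at hsol hpos
  have hT : 0 < T := by exact_mod_cast hpos
  by_contra hcon
  rw [tendsto_atTop] at hcon
  push Not at hcon
  obtain ⟨M, hM⟩ := hcon
  obtain ⟨δ, R, hδ, hδR⟩ := Y.exists_norm_bound M
  -- A restarting time t₀ closer to T than δ, with norm below M, makes the solution bounded all the
  -- way to T.
  have hev : ∀ᶠ t in 𝓝[<] T, t ∈ Set.Ioo (max 0 (T - δ)) T :=
    Ioo_mem_nhdsLT (max_lt hT (by linarith))
  obtain ⟨t₀, ht₀M, ht₀⟩ := (hM.and_eventually hev).exists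
  have ht₀pos : 0 < t₀ := (le_max_left _ _).trans_lt ht₀.1
  have ht₀δ : T - δ < t₀ := (le_max_right _ _).trans_lt ht₀.1
  obtain ⟨C, hC⟩ := hsol.bounded t₀ (by exact_mod_cast ht₀.2)
  obtain ⟨ε, hε, v, hv⟩ := hsol.exists_extension (R := max C R) hT fun t ht => by
    rcases le_or_gt t t₀ with h | h
    · exact (hC t ⟨ht.1, h⟩).trans (le_max_left _ _)
    · exact (hδR z₀ T u hsol t₀ t ht₀pos ht₀M.le h.le (by linarith [ht.2])
        (by exact_mod_cast ht.2)).trans (le_max_right _ _)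
  have hle : ((T + ε : ℝ) : EReal) ≤ T := by
    rw [← hTmax]
    exact le_sSup ⟨by exact_mod_cast (by linarith : (0 : ℝ) < T + ε), v, hv⟩
  have : T + ε ≤ T := by exact_mod_cast hle
  linarith

/-- If the image of a solution under `π` obeys a linear singular integral inequality, it stays
bounded. -/
theorem IsSol.bounded_map {W W' : Type*} [NormedAddCommGroup W] [NormedSpace ℝ W] [CompleteSpace W]
    [NormedAddCommGroup W'] [NormedSpace ℝ W'] (π : V →L[ℝ] W) (π' : V →L[ℝ] W') {z₀ : V} {T : ℝ}
    {u : ℝ → V} (hu : Y.IsSol id z₀ T u) {C M A : ℝ} (hC : 0 ≤ C)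
    (hP : ∀ τ v, 0 < τ → ‖π (Y.P τ v v)‖ ≤ C * τ ^ (-(1 / 2) : ℝ) * ‖π' v‖ * ‖π v‖)
    (hM : ∀ t ∈ Set.Ioo 0 T, ‖π' (u t)‖ ≤ M) (hA : ∀ t, 0 < t → ‖π (Y.S t z₀)‖ ≤ A) :
    ∃ R, ∀ t ∈ Set.Ioo 0 T, ‖π (u t)‖ ≤ R := by
  rcases le_or_gt T 0 with hT | hT
  · exact ⟨0, fun t ht => absurd (ht.1.trans ht.2) hT.not_gt⟩
  have hM0 : 0 ≤ M := (norm_nonneg _).trans (hM (T / 2) ⟨by linarith, by linarith⟩)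
  have hA0 : 0 ≤ A := (norm_nonneg _).trans (hA 1 one_pos)
  obtain ⟨lam, hl, hG⟩ := singular_gronwall (c := C * M) (by positivity)
  refine ⟨2 * A * Real.exp (lam * T), fun t₁ ht₁ => ?_⟩
  have ht₁T : (t₁ : EReal) < T := by exact_mod_cast ht₁.2
  -- The bound B may deteriorate as t₁ approaches T, but it serves only as the a priori bound in
  -- Gronwall and drops out of the result.
  obtain ⟨B, hB⟩ := hu.bounded t₁ ht₁T
  refine (hG (fun t => ‖π (u t)‖) A (‖π‖ * B) t₁ hA0 (fun _ _ => norm_nonneg _)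
    (fun t ht => π.le_opNorm_of_le (hB t ht)) ?_ t₁ ⟨ht₁.1, le_rfl⟩).trans ?_
  · intro t ht
    have hsub : ∀ s ∈ Set.Ioo 0 t, s ∈ Set.Ioc 0 t₁ := fun s hs => ⟨hs.1, hs.2.le.trans ht.2⟩
    have hc : ContinuousOn u (Set.Ioo 0 t) := (hu.continuousOn_Ioo ht₁T).mono hsub
    have hint := Y.integrableOn_integrand hc fun s hs => hB s (hsub s hs)
    rw [hu.eq t ht.1 ((EReal.coe_le_coe_iff.2 ht.2).trans_lt ht₁T), map_add]
    refine (norm_add_le _ _).trans (add_le_add (hA t ht.1) ?_)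
    simp only [duhamel, id]
    rw [← ContinuousLinearMap.integral_comp_comm _ hint, ← integral_const_mul]
    refine norm_integral_le_of_norm_le ?_ ?_
    · refine Integrable.const_mul ?_ _
      refine (integrableOn_singular_sub t).mul_bdd (c := ‖π‖ * B)
        ((π.continuous.comp_continuousOn hc).norm.aestronglyMeasurable measurableSet_Ioo) ?_
      refine (ae_restrict_iff' measurableSet_Ioo).2 (Eventually.of_forall fun s hs => ?_)
      rw [norm_norm]
      exact π.le_opNorm_of_le (hB s (hsub s hs))
    · refine (ae_restrict_iff' measurableSet_Ioo).2 (Eventually.of_forall fun s hs => ?_)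
      have hts : 0 < t - s := sub_pos.2 hs.2
      have h1 := hM s ⟨hs.1, hs.2.trans_le (ht.2.trans ht₁.2.le)⟩
      calc _ ≤ C * (t - s) ^ (-(1 / 2) : ℝ) * ‖π' (u s)‖ * ‖π (u s)‖ := hP _ _ hts
        _ ≤ C * (t - s) ^ (-(1 / 2) : ℝ) * M * ‖π (u s)‖ := by gcongr
        _ = _ := by ring
  · have := ht₁.2.le
    gcongr

/-- The image of a solution under a morphism of systems. -/
theorem IsSol.map {W : Type*} [NormedAddCommGroup W] [NormedSpace ℝ W] [CompleteSpace W]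
    {X : MildSystem W} (π : V →L[ℝ] W) (hS : ∀ t v, 0 < t → π (Y.S t v) = X.S t (π v))
    (hP : ∀ t v w, 0 < t → π (Y.P t v w) = X.P t (π v) (π w)) {z₀ : V} {T : EReal} {u : ℝ → V}
    (hu : Y.IsSol id z₀ T u) : X.IsSol id (π z₀) T (fun t => π (u t)) := by
  refine ⟨π.continuous.comp_continuousOn hu.continuousOn, fun T' hT' => ?_, fun t ht htT => ?_⟩
  · obtain ⟨C, hC⟩ := hu.bounded T' hT'
    exact ⟨‖π‖ * C, fun t ht => π.le_opNorm_of_le (hC t ht)⟩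
  · obtain ⟨B, hB⟩ := hu.bounded t htT
    have hc : ContinuousOn u (Set.Ioo 0 t) :=
      (hu.continuousOn_Ioo htT).mono Set.Ioo_subset_Ioc_self
    have hint := Y.integrableOn_integrand hc fun s hs => hB s ⟨hs.1, hs.2.le⟩
    rw [hu.eq t ht htT, map_add, hS t _ ht]
    congr 1
    simp only [duhamel, id]
    rw [← ContinuousLinearMap.integral_comp_comm _ hint]
    exact setIntegral_congr_fun measurableSet_Ioo fun s hs => hP _ _ _ (sub_pos.2 hs.2)

end MildSystem

end

section

/-! ### Convolution in `L^p` -/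

/-- `L^p(ℝ^N)`. -/
abbrev LpE (N : ℕ) (p : ℝ≥0∞) : Type := Lp ℝ p (volume : Measure (E N))

variable {N : ℕ} {p q : ℝ≥0∞}

theorem conv_apply (f g : E N → ℝ) (x : E N) : conv f g x = ∫ t, f t * g (x - t) := rfl

theorem conv_congr {f f' g g' : E N → ℝ} (hf : f =ᵐ[volume] f') (hg : g =ᵐ[volume] g') :
    conv f g = conv f' g' :=
  convolution_congr _ hf hg

/-- The convolution integral of `f` and `g` converges absolutely at `x`. -/
def ConvAt (f g : E N → ℝ) (x : E N) : Prop := Integrable fun t => f t * g (x - t)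

theorem conv_add_left {f f' g : E N → ℝ} {x : E N} (h : ConvAt f g x) (h' : ConvAt f' g x) :
    conv (f + f') g x = conv f g x + conv f' g x := by
  simp only [conv_apply, Pi.add_apply, add_mul]
  exact integral_add h h'

theorem conv_add_right {f g g' : E N → ℝ} {x : E N} (h : ConvAt f g x) (h' : ConvAt f g' x) :
    conv f (g + g') x = conv f g x + conv f g' x := by
  simp only [conv_apply, Pi.add_apply, mul_add]
  exact integral_add h h'

theorem conv_smul_left (c : ℝ) (f g : E N → ℝ) : conv (c • f) g = c • conv f g :=
  smul_convolution

theorem conv_smul_right (c : ℝ) (f g : E N → ℝ) : conv f (c • g) = c • conv f g :=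
  convolution_smul

theorem measurePreserving_sub_left' (x : E N) :
    MeasurePreserving (fun t : E N => x - t) volume volume :=
  Measure.measurePreserving_sub_left volume x

theorem aestronglyMeasurable_conv_integrand {f g : E N → ℝ} (hf : AEStronglyMeasurable f)
    (hg : AEStronglyMeasurable g) :
    AEStronglyMeasurable (fun z : E N × E N => f z.2 * g (z.1 - z.2)) (volume.prod volume) :=
  hf.convolution_integrand (ContinuousLinearMap.mul ℝ ℝ) hg

theorem aestronglyMeasurable_conv {f g : E N → ℝ} (hf : AEStronglyMeasurable f)
    (hg : AEStronglyMeasurable g) : AEStronglyMeasurable (conv f g) :=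
  (aestronglyMeasurable_conv_integrand hf hg).integral_prod_right'

theorem aestronglyMeasurable_translate {g : E N → ℝ} (hg : AEStronglyMeasurable g) (x : E N) :
    AEStronglyMeasurable (fun t => g (x - t)) :=
  hg.comp_measurePreserving (measurePreserving_sub_left' x)

/-- `∫ |k(t)| |f(x-t)| dt`. -/
def absConv (k f : E N → ℝ) (x : E N) : ℝ≥0∞ := ∫⁻ t, ‖k t‖ₑ * ‖f (x - t)‖ₑ

theorem aemeasurable_absConv {k f : E N → ℝ} (hk : AEStronglyMeasurable k)
    (hf : AEStronglyMeasurable f) : AEMeasurable (absConv k f) := by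
  have h := (aestronglyMeasurable_conv_integrand hk hf).enorm.lintegral_prod_right'
  simpa only [enorm_mul] using! h

theorem convAt_of_absConv_lt_top {k f : E N → ℝ} (hk : AEStronglyMeasurable k)
    (hf : AEStronglyMeasurable f) {x : E N} (h : absConv k f x < ⊤) : ConvAt k f x := by
  refine ⟨hk.mul (aestronglyMeasurable_translate hf x), ?_⟩
  rw [hasFiniteIntegral_iff_enorm]
  simpa only [enorm_mul] using! h

theorem enorm_conv_le (k f : E N → ℝ) (x : E N) : ‖conv k f x‖ₑ ≤ absConv k f x := by
  rw [conv_apply]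
  refine (enorm_integral_le_lintegral_enorm _).trans (le_of_eq ?_)
  simp only [enorm_mul, absConv]

/-- This is the comparison of the L^1 and L^p norms of f(x - ·) for the measure |k(t)| dt, whose
total mass is ‖k‖_1. Integrating in x then yields Young's inequality by Tonelli and translation
invariance. -/
theorem absConv_rpow_le {k f : E N → ℝ} (hk : AEStronglyMeasurable k)
    (hf : AEStronglyMeasurable f) (hp : 1 ≤ p) (hp' : p ≠ ⊤) (x : E N) :
    absConv k f x ^ p.toReal ≤
      (∫⁻ t, ‖k t‖ₑ) ^ (p.toReal - 1) * ∫⁻ t, ‖k t‖ₑ * ‖f (x - t)‖ₑ ^ p.toReal := by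
  have hp0 : 0 < p.toReal := ENNReal.toReal_pos (zero_lt_one.trans_le hp).ne' hp'
  set ν : Measure (E N) := volume.withDensity fun t => ‖k t‖ₑ with hν
  have hac : ν ≪ volume := withDensity_absolutelyContinuous _ _
  have hfx := aestronglyMeasurable_translate hf x
  have h := eLpNorm_le_eLpNorm_mul_rpow_measure_univ (μ := ν) hp (hfx.mono_ac hac)
  rw [eLpNorm_one_eq_lintegral_enorm,
    eLpNorm_eq_lintegral_rpow_enorm_toReal (zero_lt_one.trans_le hp).ne' hp',
    lintegral_withDensity_eq_lintegral_mul₀ hk.enorm hfx.enorm,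
    lintegral_withDensity_eq_lintegral_mul₀ hk.enorm (hfx.enorm.pow_const _),
    withDensity_apply _ MeasurableSet.univ, Measure.restrict_univ] at h
  have h2 := ENNReal.rpow_le_rpow h hp0.le
  refine h2.trans (le_of_eq ?_)
  rw [ENNReal.mul_rpow_of_nonneg _ _ hp0.le, ← ENNReal.rpow_mul, ← ENNReal.rpow_mul, mul_comm]
  congr 2
  · rw [ENNReal.toReal_one]
    field_simp
  · rw [one_div_mul_cancel hp0.ne', ENNReal.rpow_one]
    rfl

theorem lintegral_absConv_rpow_le {k f : E N → ℝ} (hk : AEStronglyMeasurable k)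
    (hf : AEStronglyMeasurable f) (hp : 1 ≤ p) (hp' : p ≠ ⊤) :
    ∫⁻ x, absConv k f x ^ p.toReal ≤
      (∫⁻ t, ‖k t‖ₑ) ^ p.toReal * ∫⁻ t, ‖f t‖ₑ ^ p.toReal := by
  have hp1 : 1 ≤ p.toReal := by
    rw [← ENNReal.toReal_one]
    exact (ENNReal.toReal_le_toReal ENNReal.one_ne_top hp').2 hp
  have hmeas : AEMeasurable (fun z : E N × E N => ‖k z.2‖ₑ * ‖f (z.1 - z.2)‖ₑ ^ p.toReal)
      (volume.prod volume) := by
    refine (hk.comp_quasiMeasurePreserving Measure.quasiMeasurePreserving_snd).enorm.mul ?_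
    exact (hf.comp_quasiMeasurePreserving
      (quasiMeasurePreserving_sub volume volume)).enorm.pow_const _
  calc ∫⁻ x, absConv k f x ^ p.toReal
      ≤ ∫⁻ x, (∫⁻ t, ‖k t‖ₑ) ^ (p.toReal - 1) * ∫⁻ t, ‖k t‖ₑ * ‖f (x - t)‖ₑ ^ p.toReal :=
        lintegral_mono (absConv_rpow_le hk hf hp hp')
    _ = (∫⁻ t, ‖k t‖ₑ) ^ (p.toReal - 1) *
          ∫⁻ x, ∫⁻ t, ‖k t‖ₑ * ‖f (x - t)‖ₑ ^ p.toReal := by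
        rw [lintegral_const_mul'' _ hmeas.lintegral_prod_right']
    _ = (∫⁻ t, ‖k t‖ₑ) ^ (p.toReal - 1) *
          ((∫⁻ t, ‖k t‖ₑ) * ∫⁻ t, ‖f t‖ₑ ^ p.toReal) := by
        rw [lintegral_lintegral_swap hmeas, ← lintegral_mul_const'' _ hk.enorm]
        congr 1
        refine lintegral_congr fun t => ?_
        have : AEMeasurable (fun x => ‖f (x - t)‖ₑ ^ p.toReal) :=
          ((hf.comp_measurePreserving
            (measurePreserving_sub_right volume t)).enorm.pow_const _)
        rw [lintegral_const_mul'' _ this,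
          lintegral_sub_right_eq_self (fun x => ‖f x‖ₑ ^ p.toReal) t]
    _ = _ := by
        rw [← mul_assoc]
        congr 1
        nth_rewrite 2 [← ENNReal.rpow_one (∫⁻ t, ‖k t‖ₑ)]
        rw [← ENNReal.rpow_add_of_nonneg _ _ (by linarith) zero_le_one, sub_add_cancel]

theorem absConv_le_top {k f : E N → ℝ} (hf : MemLp f ⊤) (x : E N) :
    absConv k f x ≤ eLpNorm k 1 volume * eLpNorm f ⊤ volume := by
  have h : ∀ᵐ t, ‖f (x - t)‖ₑ ≤ eLpNorm f ⊤ volume := by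
    have h1 : ∀ᵐ t, ‖f t‖ₑ ≤ eLpNorm f ⊤ volume := by
      rw [eLpNorm_exponent_top]
      exact enorm_ae_le_eLpNormEssSup f volume
    exact (measurePreserving_sub_left' x).quasiMeasurePreserving.ae h1
  rw [eLpNorm_one_eq_lintegral_enorm, ← lintegral_mul_const' _ _ hf.2.ne]
  exact lintegral_mono_ae (h.mono fun t ht => by gcongr)

/-- Young's inequality for the convolution of the absolute values. -/
theorem eLpNorm_absConv_le {k f : E N → ℝ} (hp : 1 ≤ p) (hk : AEStronglyMeasurable k)
    (hf : MemLp f p) :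
    eLpNorm (absConv k f) p volume ≤ eLpNorm k 1 volume * eLpNorm f p volume := by
  rcases eq_or_ne p ⊤ with rfl | hp'
  · rw [eLpNorm_exponent_top]
    exact eLpNormEssSup_le_of_ae_enorm_bound (Eventually.of_forall fun x => absConv_le_top hf x)
  · have hp0 := (zero_lt_one.trans_le hp).ne'
    have hp1 : 0 < p.toReal := ENNReal.toReal_pos hp0 hp'
    rw [eLpNorm_eq_lintegral_rpow_enorm_toReal hp0 hp',
      eLpNorm_eq_lintegral_rpow_enorm_toReal (f := f) hp0 hp', eLpNorm_one_eq_lintegral_enorm]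
    refine (ENNReal.rpow_le_rpow (lintegral_absConv_rpow_le hk hf.1 hp hp')
      (by positivity)).trans (le_of_eq ?_)
    rw [ENNReal.mul_rpow_of_nonneg _ _ (by positivity), ← ENNReal.rpow_mul,
      mul_one_div_cancel hp1.ne', ENNReal.rpow_one]

theorem ae_absConv_lt_top {k f : E N → ℝ} (hp : 1 ≤ p) (hk : MemLp k 1)
    (hf : MemLp f p) : ∀ᵐ x, absConv k f x < ⊤ := by
  have h : eLpNorm (absConv k f) p volume < ⊤ :=
    (eLpNorm_absConv_le hp hk.1 hf).trans_lt (ENNReal.mul_lt_top hk.2 hf.2)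
  rcases eq_or_ne p ⊤ with rfl | hp'
  · exact Eventually.of_forall fun x =>
      (absConv_le_top hf x).trans_lt (ENNReal.mul_lt_top hk.2 hf.2)
  · have hp0 := (zero_lt_one.trans_le hp).ne'
    have hp1 : 0 < p.toReal := ENNReal.toReal_pos hp0 hp'
    have h2 := (eLpNorm_lt_top_iff_lintegral_rpow_enorm_lt_top hp0 hp').1 h
    have h3 := ae_lt_top' ((aemeasurable_absConv hk.1 hf.1).pow_const _) h2.ne
    filter_upwards [h3] with x hx
    exact (ENNReal.rpow_lt_top_iff_of_pos hp1).1 hx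

theorem ae_convAt {k f : E N → ℝ} (hp : 1 ≤ p) (hk : MemLp k 1) (hf : MemLp f p) :
    ∀ᵐ x, ConvAt k f x :=
  (ae_absConv_lt_top hp hk hf).mono fun _ hx => convAt_of_absConv_lt_top hk.1 hf.1 hx

theorem eLpNorm_conv_le {k f : E N → ℝ} (hp : 1 ≤ p) (hk : AEStronglyMeasurable k)
    (hf : MemLp f p) :
    eLpNorm (conv k f) p volume ≤ eLpNorm k 1 volume * eLpNorm f p volume :=
  (eLpNorm_mono_enorm fun x => by simpa using enorm_conv_le k f x).trans
    (eLpNorm_absConv_le hp hk hf)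

/-- Young's inequality. -/
theorem MemLp.conv {k f : E N → ℝ} (hp : 1 ≤ p) (hk : MemLp k 1) (hf : MemLp f p) :
    MemLp (conv k f) p :=
  ⟨aestronglyMeasurable_conv hk.1 hf.1,
    (eLpNorm_conv_le hp hk.1 hf).trans_lt (ENNReal.mul_lt_top hk.2 hf.2)⟩

theorem holderTriple_of_conj (hpq : 1 / p + 1 / q = 1) : ENNReal.HolderTriple q p 1 :=
  ⟨by rw [add_comm]; simpa using hpq⟩

/-- Hölder for K and a reflected translate of f. The bound holds at every point x, so K * f is a
bounded function and multiplication by it preserves every L^r. -/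
theorem absConv_le_holder {K f : E N → ℝ} (hpq : 1 / p + 1 / q = 1)
    (hK : AEStronglyMeasurable K) (hf : AEStronglyMeasurable f) (x : E N) :
    absConv K f x ≤ eLpNorm K q volume * eLpNorm f p volume := by
  have := holderTriple_of_conj hpq
  have h := eLpNorm_smul_le_mul_eLpNorm (p := q) (q := p) (r := 1)
    (aestronglyMeasurable_translate hf x) hK
  have h2 : eLpNorm (fun t => f (x - t)) p volume = eLpNorm f p volume :=
    eLpNorm_comp_measurePreserving hf (measurePreserving_sub_left' x)
  rw [h2, eLpNorm_one_eq_lintegral_enorm] at h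
  refine le_trans (le_of_eq ?_) h
  simp only [absConv, Pi.smul_apply', enorm_smul]

theorem convAt_of_conj {K f : E N → ℝ} (hpq : 1 / p + 1 / q = 1) (hK : MemLp K q)
    (hf : MemLp f p) (x : E N) : ConvAt K f x :=
  convAt_of_absConv_lt_top hK.1 hf.1
    ((absConv_le_holder hpq hK.1 hf.1 x).trans_lt (ENNReal.mul_lt_top hK.2 hf.2))

theorem abs_conv_le_of_conj {K : E N → ℝ} [Fact (1 ≤ p)] (hpq : 1 / p + 1 / q = 1)
    (hK : MemLp K q) (f : LpE N p) (x : E N) :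
    ‖conv K f x‖ ≤ (eLpNorm K q volume).toReal * ‖f‖ := by
  have h := (enorm_conv_le K f x).trans
    (absConv_le_holder hpq hK.1 (Lp.memLp f).1 x)
  rw [Lp.norm_def, ← ENNReal.toReal_mul, ← toReal_enorm]
  exact ENNReal.toReal_mono (ENNReal.mul_lt_top hK.2 (Lp.memLp f).2).ne h

/-! ### Convolution and the nonlinearity as bounded bilinear operators -/

section Operators

variable (p) [hp : Fact (1 ≤ p)]

/-- Convolution as a bounded bilinear map `L^1 × L^p → L^p`. -/
def convL : LpE N 1 →L[ℝ] LpE N p →L[ℝ] LpE N p :=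
  LinearMap.mkContinuous₂
    (LinearMap.mk₂ ℝ (fun (k : LpE N 1) (f : LpE N p) =>
        (MemLp.conv hp.out (Lp.memLp k) (Lp.memLp f)).toLp (conv k f))
      (fun k k' f => by
        rw [← MemLp.toLp_add, MemLp.toLp_eq_toLp_iff, conv_congr (Lp.coeFn_add k k') .rfl]
        filter_upwards [ae_convAt hp.out (Lp.memLp k) (Lp.memLp f),
          ae_convAt hp.out (Lp.memLp k') (Lp.memLp f)] with x h h'
        exact conv_add_left h h')
      (fun c k f => by
        rw [← MemLp.toLp_const_smul, MemLp.toLp_eq_toLp_iff, conv_congr (Lp.coeFn_smul c k) .rfl,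
          conv_smul_left])
      (fun k f f' => by
        rw [← MemLp.toLp_add, MemLp.toLp_eq_toLp_iff, conv_congr .rfl (Lp.coeFn_add f f')]
        filter_upwards [ae_convAt hp.out (Lp.memLp k) (Lp.memLp f),
          ae_convAt hp.out (Lp.memLp k) (Lp.memLp f')] with x h h'
        exact conv_add_right h h')
      (fun c k f => by
        rw [← MemLp.toLp_const_smul, MemLp.toLp_eq_toLp_iff, conv_congr .rfl (Lp.coeFn_smul c f),
          conv_smul_right]))
    1 (fun k f => by
      rw [one_mul, LinearMap.mk₂_apply, Lp.norm_toLp, Lp.norm_def, Lp.norm_def,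
        ← ENNReal.toReal_mul]
      exact ENNReal.toReal_mono (ENNReal.mul_lt_top (Lp.memLp k).2 (Lp.memLp f).2).ne
        (eLpNorm_conv_le hp.out (Lp.memLp k).1 (Lp.memLp f)))

theorem coeFn_convL (k : LpE N 1) (f : LpE N p) : convL p k f =ᵐ[volume] conv k f :=
  MemLp.coeFn_toLp (MemLp.conv hp.out (Lp.memLp k) (Lp.memLp f))

theorem norm_convL_le (k : LpE N 1) (f : LpE N p) : ‖convL p k f‖ ≤ ‖k‖ * ‖f‖ := by
  have h : ‖convL (N := N) p‖ ≤ 1 := LinearMap.mkContinuous₂_norm_le _ zero_le_one _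
  simpa using (convL p).le_of_opNorm₂_le_of_le h (le_refl ‖k‖) (le_refl ‖f‖)

variable {p} {K : E N → ℝ}

theorem memLp_mul_conv {r : ℝ≥0∞} (hpq : 1 / p + 1 / q = 1) (hK : MemLp K q) {f : E N → ℝ}
    (hf : MemLp f r) (g : LpE N p) : MemLp (fun x => f x * conv K g x) r := by
  refine hf.of_le_mul (c := (eLpNorm K q volume).toReal * ‖g‖)
    (hf.1.mul (aestronglyMeasurable_conv hK.1 (Lp.memLp g).1)) (Eventually.of_forall fun x => ?_)
  rw [norm_mul, mul_comm]
  gcongr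
  exact abs_conv_le_of_conj hpq hK g x

/-- The exponent r of the first factor is independent of p. With r ≠ p this is the linear estimate
that carries additional integrability along the flow. -/
theorem norm_le_of_ae_eq_mul_conv {r : ℝ≥0∞} [Fact (1 ≤ r)] (hpq : 1 / p + 1 / q = 1)
    (hK : MemLp K q) {f h : LpE N r} {g : LpE N p}
    (hh : h =ᵐ[volume] fun x => f x * conv K g x) :
    ‖h‖ ≤ (eLpNorm K q volume).toReal * ‖g‖ * ‖f‖ := by
  refine Lp.norm_le_mul_norm_of_ae_le_mul ?_
  filter_upwards [hh] with x hx
  rw [hx, norm_mul, mul_comm]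
  gcongr
  exact abs_conv_le_of_conj hpq hK g x

/-- The bounded bilinear map `(f, g) ↦ f (K * g)` on `L^p`, for `K ∈ L^q`. -/
def mulConvL (hpq : 1 / p + 1 / q = 1) (hK : MemLp K q) : LpE N p →L[ℝ] LpE N p →L[ℝ] LpE N p :=
  LinearMap.mkContinuous₂
    (LinearMap.mk₂ ℝ (fun (f g : LpE N p) =>
        (memLp_mul_conv hpq hK (Lp.memLp f) g).toLp (fun x => f x * conv K g x))
      (fun f f' g => by
        rw [← MemLp.toLp_add, MemLp.toLp_eq_toLp_iff]
        filter_upwards [Lp.coeFn_add f f'] with x h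
        rw [h, Pi.add_apply, add_mul]
        rfl)
      (fun c f g => by
        rw [← MemLp.toLp_const_smul, MemLp.toLp_eq_toLp_iff]
        filter_upwards [Lp.coeFn_smul c f] with x h
        rw [h, Pi.smul_apply, smul_mul_assoc]
        rfl)
      (fun f g g' => by
        rw [← MemLp.toLp_add, MemLp.toLp_eq_toLp_iff, conv_congr .rfl (Lp.coeFn_add g g')]
        refine Eventually.of_forall fun x => ?_
        simp only [Pi.add_apply]
        rw [conv_add_right (convAt_of_conj hpq hK (Lp.memLp g) x)
          (convAt_of_conj hpq hK (Lp.memLp g') x), mul_add])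
      (fun c f g => by
        rw [← MemLp.toLp_const_smul, MemLp.toLp_eq_toLp_iff, conv_congr .rfl (Lp.coeFn_smul c g),
          conv_smul_right]
        refine Eventually.of_forall fun x => ?_
        simp only [Pi.smul_apply, smul_eq_mul]
        ring))
    (eLpNorm K q volume).toReal (fun f g => by
      rw [LinearMap.mk₂_apply, mul_right_comm]
      exact norm_le_of_ae_eq_mul_conv hpq hK (MemLp.coeFn_toLp _))

theorem coeFn_mulConvL (hpq : 1 / p + 1 / q = 1) (hK : MemLp K q) (f g : LpE N p) :
    mulConvL hpq hK f g =ᵐ[volume] fun x => f x * conv K g x :=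
  MemLp.coeFn_toLp (memLp_mul_conv hpq hK (Lp.memLp f) g)

theorem norm_mulConvL_le (hpq : 1 / p + 1 / q = 1) (hK : MemLp K q) (f g : LpE N p) :
    ‖mulConvL hpq hK f g‖ ≤ (eLpNorm K q volume).toReal * ‖f‖ * ‖g‖ := by
  rw [mul_right_comm]
  exact norm_le_of_ae_eq_mul_conv hpq hK (coeFn_mulConvL hpq hK f g)

end Operators

/-- Associativity of convolution. -/
theorem conv_assoc {k l f : E N → ℝ} (hp : 1 ≤ p) (hk : MemLp k 1) (hl : MemLp l 1)
    (hf : MemLp f p) : conv (conv k l) f =ᵐ[volume] conv k (conv l f) := by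
  have h1 : ∀ᵐ y, ConvAt k l y := ae_convAt le_rfl hk hl
  have h2 : ∀ᵐ x, ConvAt (fun x => ‖l x‖) (fun x => ‖f x‖) x := ae_convAt hp hl.norm hf.norm
  have h3 : ∀ᵐ x, ConvAt (fun x => ‖k x‖) (conv (fun x => ‖l x‖) (fun x => ‖f x‖)) x :=
    ae_convAt hp hk.norm (MemLp.conv hp hl.norm hf.norm)
  filter_upwards [h3] with x hx
  exact convolution_assoc (ContinuousLinearMap.mul ℝ ℝ) (ContinuousLinearMap.mul ℝ ℝ)
    (ContinuousLinearMap.mul ℝ ℝ) (ContinuousLinearMap.mul ℝ ℝ) (fun a b c => mul_assoc a b c)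
    hk.1 hl.1 hf.1 h1 h2 hx

end

section

/-! ### The heat kernel -/

variable {N : ℕ}

theorem heatKernel_pos {t : ℝ} (ht : 0 < t) (x : E N) : 0 < heatKernel N t x := by
  unfold heatKernel
  positivity

theorem continuous_heatKernel (t : ℝ) : Continuous (heatKernel N t) := by
  unfold heatKernel
  fun_prop

theorem integral_heatKernel {t : ℝ} (ht : 0 < t) : ∫ x, heatKernel N t x = 1 := by
  have h := GaussianFourier.integral_rexp_neg_mul_sq_norm (V := E N) (b := 1 / (4 * t))
    (by positivity)
  have h2 : ∀ x : E N, heatKernel N t x =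
      (4 * Real.pi * t) ^ (-(N : ℝ) / 2) * Real.exp (-(1 / (4 * t)) * ‖x‖ ^ 2) := by
    intro x
    rw [heatKernel]
    congr 2
    ring
  simp_rw [h2]
  have h3 : Real.pi / (1 / (4 * t)) = 4 * Real.pi * t := by field_simp
  rw [integral_const_mul, h, finrank_euclideanSpace_fin, h3,
    ← Real.rpow_add (by positivity), neg_div, neg_add_cancel, Real.rpow_zero]

theorem integrable_heatKernel {t : ℝ} (ht : 0 < t) : Integrable (heatKernel N t) :=
  .of_integral_ne_zero (by rw [integral_heatKernel ht]; exact one_ne_zero)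

theorem partialDeriv_heatKernel (i : Fin N) (t : ℝ) (x : E N) :
    partialDeriv i (heatKernel N t) x = -(x i) / (2 * t) * heatKernel N t x := by
  have h1 : HasFDerivAt (fun y : E N => ‖y‖ ^ 2) (2 • innerSL ℝ x) x :=
    (hasStrictFDerivAt_norm_sq x).hasFDerivAt
  have h2 : HasFDerivAt (fun y : E N => -‖y‖ ^ 2 / (4 * t))
      ((4 * t)⁻¹ • -((2 : ℕ) • innerSL ℝ x : E N →L[ℝ] ℝ)) x := by
    simpa only [div_eq_inv_mul] using! h1.neg.const_smul (4 * t)⁻¹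
  have h3 := (h2.exp.const_mul ((4 * Real.pi * t) ^ (-(N : ℝ) / 2))).fderiv
  have h4 : innerSL ℝ x (EuclideanSpace.single i (1 : ℝ)) = x i := by
    rw [innerSL_apply_apply, EuclideanSpace.inner_single_right]
    simp
  unfold partialDeriv heatKernel
  rw [h3]
  simp only [FunLike.coe_smul, Pi.smul_apply, neg_apply, smul_eq_mul, two_smul, add_apply, h4]
  field_simp
  ring

/-- Up to a constant, heat kernels increase in time. -/
theorem heatKernel_le {a b t : ℝ} (ha : 0 < a) (hat : a ≤ t) (htb : t ≤ b) (x : E N) :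
    heatKernel N t x ≤ (b / a) ^ ((N : ℝ) / 2) * heatKernel N b x := by
  have ht := ha.trans_le hat
  have hb := ht.trans_le htb
  unfold heatKernel
  have h1 : (b / a) ^ ((N : ℝ) / 2) * (4 * Real.pi * b) ^ (-(N : ℝ) / 2) =
      (4 * Real.pi * a) ^ (-(N : ℝ) / 2) := by
    rw [neg_div, Real.rpow_neg (by positivity), Real.rpow_neg (by positivity), ← Real.inv_rpow
      (by positivity), ← Real.inv_rpow (by positivity), ← Real.mul_rpow (by positivity)
      (by positivity)]
    congr 1
    field_simp
  rw [← mul_assoc, h1]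
  gcongr ?_ * ?_
  · exact Real.rpow_le_rpow_of_nonpos (by positivity) (by gcongr)
      (by rw [neg_div, neg_nonpos]; positivity)
  · rw [Real.exp_le_exp, neg_div, neg_div, neg_le_neg_iff]
    gcongr

/-- Half of the Gaussian exponent is spent on the factor |x|/√t, the other half is G(2t, ·) up to
the constant 2^{N/2}. Integration gives the t^{-1/2} bound, and the pointwise form also serves as a
dominating function. -/
theorem abs_partialDeriv_heatKernel_le (i : Fin N) {t : ℝ} (ht : 0 < t) (x : E N) :
    ‖partialDeriv i (heatKernel N t) x‖ ≤
      2 ^ ((N : ℝ) / 2) * t ^ (-(1 / 2) : ℝ) * heatKernel N (2 * t) x := by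
  -- In this variable the absorbed factor is y e^{-y²/2} ≤ 1, which follows from e^z ≥ 1 + z and (y
  -- - 1)² ≥ 0.
  set y := ‖x‖ / (2 * √t) with hy
  have hst : 0 < √t := Real.sqrt_pos.2 ht
  have hsq : √t ^ 2 = t := Real.sq_sqrt ht.le
  have hy2 : y ^ 2 / 2 = ‖x‖ ^ 2 / (8 * t) := by
    rw [hy, div_pow, mul_pow, hsq]
    field_simp
    norm_num
  have h1 : y * Real.exp (-(‖x‖ ^ 2 / (8 * t))) ≤ 1 := by
    rw [← hy2, Real.exp_neg, ← div_eq_mul_inv, div_le_one (Real.exp_pos _)]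
    have := Real.add_one_le_exp (y ^ 2 / 2)
    nlinarith [sq_nonneg (y - 1)]
  have h2 : ‖x i‖ ≤ ‖x‖ := PiLp.norm_apply_le x i
  have h3 : t ^ (-(1 / 2) : ℝ) = 1 / √t := by
    rw [Real.rpow_neg ht.le, ← Real.sqrt_eq_rpow, one_div]
  have h4 : heatKernel N t x = 2 ^ ((N : ℝ) / 2) * heatKernel N (2 * t) x *
      Real.exp (-(‖x‖ ^ 2 / (8 * t))) := by
    unfold heatKernel
    have h5 : (2 : ℝ) ^ ((N : ℝ) / 2) * (4 * Real.pi * (2 * t)) ^ (-(N : ℝ) / 2) =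
        (4 * Real.pi * t) ^ (-(N : ℝ) / 2) := by
      rw [neg_div, Real.rpow_neg (by positivity), Real.rpow_neg (by positivity), ← Real.inv_rpow
        (by positivity), ← Real.inv_rpow (by positivity), ← Real.mul_rpow (by positivity)
        (by positivity)]
      congr 1
      field_simp
    have h7 : -‖x‖ ^ 2 / (4 * t) = -‖x‖ ^ 2 / (4 * (2 * t)) + -(‖x‖ ^ 2 / (8 * t)) := by
      field_simp
      ring
    rw [h7, Real.exp_add, ← h5]
    ring
  have h6 := heatKernel_pos (N := N) (show 0 < 2 * t by positivity) x
  have h8 : 0 ≤ 2 ^ ((N : ℝ) / 2) * heatKernel N (2 * t) x *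
      Real.exp (-(‖x‖ ^ 2 / (8 * t))) := by positivity
  rw [partialDeriv_heatKernel, h4, norm_mul, norm_div, norm_neg, Real.norm_of_nonneg
    (show 0 ≤ 2 * t by positivity), Real.norm_of_nonneg h8, h3]
  calc ‖x i‖ / (2 * t) * (2 ^ ((N : ℝ) / 2) * heatKernel N (2 * t) x *
        Real.exp (-(‖x‖ ^ 2 / (8 * t))))
      ≤ ‖x‖ / (2 * t) * (2 ^ ((N : ℝ) / 2) * heatKernel N (2 * t) x *
        Real.exp (-(‖x‖ ^ 2 / (8 * t)))) := by gcongr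
    _ = 2 ^ ((N : ℝ) / 2) * (1 / √t) * heatKernel N (2 * t) x *
        (y * Real.exp (-(‖x‖ ^ 2 / (8 * t)))) := by
        rw [hy]
        nth_rewrite 1 [← hsq]
        field_simp
    _ ≤ 2 ^ ((N : ℝ) / 2) * (1 / √t) * heatKernel N (2 * t) x * 1 := by gcongr
    _ = _ := mul_one _

theorem continuous_partialDeriv_heatKernel (i : Fin N) (t : ℝ) :
    Continuous (partialDeriv i (heatKernel N t)) := by
  rw [funext (partialDeriv_heatKernel i t)]
  have := continuous_heatKernel (N := N) t
  fun_prop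

theorem integrable_partialDeriv_heatKernel (i : Fin N) {t : ℝ} (ht : 0 < t) :
    Integrable (partialDeriv i (heatKernel N t)) :=
  ((integrable_heatKernel (by positivity)).const_mul _).mono'
    (continuous_partialDeriv_heatKernel i t).aestronglyMeasurable
    (Eventually.of_forall (abs_partialDeriv_heatKernel_le i ht))

/-- Completing the square in y. The second factor has integral 1 in y, so the semigroup law follows
by integration. -/
theorem heatKernel_mul_heatKernel {s t : ℝ} (hs : 0 < s) (ht : 0 < t) (x y : E N) :
    heatKernel N s y * heatKernel N t (x - y) = heatKernel N (s + t) x *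
      heatKernel N (s * t / (s + t)) (y - (s / (s + t)) • x) := by
  have hst : 0 < s + t := add_pos hs ht
  unfold heatKernel
  have h1 : (4 * Real.pi * s) ^ (-(N : ℝ) / 2) * (4 * Real.pi * t) ^ (-(N : ℝ) / 2) =
      (4 * Real.pi * (s + t)) ^ (-(N : ℝ) / 2) *
        (4 * Real.pi * (s * t / (s + t))) ^ (-(N : ℝ) / 2) := by
    rw [← Real.mul_rpow (by positivity) (by positivity),
      ← Real.mul_rpow (by positivity) (by positivity)]
    congr 1
    field_simp
  have h2 : -‖y‖ ^ 2 / (4 * s) + -‖x - y‖ ^ 2 / (4 * t) = -‖x‖ ^ 2 / (4 * (s + t)) +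
      -‖y - (s / (s + t)) • x‖ ^ 2 / (4 * (s * t / (s + t))) := by
    rw [norm_sub_sq_real, norm_sub_sq_real, inner_smul_right, norm_smul, real_inner_comm,
      Real.norm_of_nonneg (by positivity)]
    field_simp
    ring
  rw [mul_mul_mul_comm, h1, ← Real.exp_add, h2, Real.exp_add]
  ring

theorem conv_heatKernel {s t : ℝ} (hs : 0 < s) (ht : 0 < t) :
    conv (heatKernel N s) (heatKernel N t) = heatKernel N (s + t) := by
  funext x
  simp_rw [conv_apply, heatKernel_mul_heatKernel hs ht x, integral_const_mul]
  rw [integral_sub_right_eq_self (heatKernel N (s * t / (s + t))),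
    integral_heatKernel (by positivity), mul_one]

theorem heatKernel_neg (t : ℝ) (x : E N) : heatKernel N t (-x) = heatKernel N t x := by
  simp [heatKernel]

theorem integral_partialDeriv_heatKernel (i : Fin N) (t : ℝ) :
    ∫ x, partialDeriv i (heatKernel N t) x = 0 := by
  have h := integral_neg_eq_self (partialDeriv i (heatKernel N t)) volume
  have h2 : ∀ x, partialDeriv i (heatKernel N t) (-x) = -partialDeriv i (heatKernel N t) x := by
    intro x
    rw [partialDeriv_heatKernel, partialDeriv_heatKernel, heatKernel_neg, PiLp.neg_apply]
    ring
  simp_rw [h2, integral_neg] at h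
  linarith

theorem conv_partialDeriv_heatKernel (i : Fin N) {s t : ℝ} (hs : 0 < s) (ht : 0 < t) :
    conv (heatKernel N s) (partialDeriv i (heatKernel N t)) =
      partialDeriv i (heatKernel N (s + t)) := by
  funext x
  have hst : 0 < s + t := add_pos hs ht
  set r := s * t / (s + t) with hr
  have hr0 : 0 < r := by positivity
  set m : E N := (s / (s + t)) • x with hm
  -- Since x - y = (t/(s+t)) x - (y - m), the linear factor splits into a constant term, which
  -- produces ∂_i G(s + t, x), and a multiple of ∂_i G(r, y - m), which is odd about m and
  -- integrates to zero.
  have h1 : ∀ y, heatKernel N s y * partialDeriv i (heatKernel N t) (x - y) =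
      heatKernel N (s + t) x * (-(x i) / (2 * (s + t)) * heatKernel N r (y - m) -
        r / t * partialDeriv i (heatKernel N r) (y - m)) := by
    intro y
    rw [partialDeriv_heatKernel, mul_left_comm, heatKernel_mul_heatKernel hs ht x y, ← hr, ← hm,
      partialDeriv_heatKernel, PiLp.sub_apply, PiLp.sub_apply]
    have hmi : m i = s / (s + t) * x i := rfl
    rw [hmi]
    field_simp
    ring
  simp_rw [conv_apply, h1, integral_const_mul]
  rw [integral_sub, integral_const_mul, integral_const_mul,
    integral_sub_right_eq_self (heatKernel N r),
    integral_sub_right_eq_self (partialDeriv i (heatKernel N r)), integral_heatKernel hr0,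
    integral_partialDeriv_heatKernel, partialDeriv_heatKernel]
  · ring
  · exact ((integrable_heatKernel hr0).comp_sub_right m).const_mul _
  · exact ((integrable_partialDeriv_heatKernel i hr0).comp_sub_right m).const_mul _

end

section

variable {N : ℕ} {p : ℝ≥0∞}

/-! ### The heat kernel as a curve in `L^1` -/

/-- Dominated convergence on compact intervals of positive times. Continuity of the kernels in L^1
gives operator-norm continuity of the convolution operators for every p, including p = ∞. -/
theorem continuousOn_toL1 {F : ℝ → E N → ℝ} (hF : ∀ x, ContinuousOn (fun t => F t x) (Set.Ioi 0))
    (hmeas : ∀ t, Continuous (F t))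
    (hdom : ∀ a b : ℝ, 0 < a → a ≤ b → ∃ g : E N → ℝ, Integrable g ∧
      ∀ t ∈ Set.Icc a b, ∀ x, ‖F t x‖ ≤ g x)
    {Φ : ℝ → LpE N 1} (hΦ : ∀ t, 0 < t → Φ t =ᵐ[volume] F t) : ContinuousOn Φ (Set.Ioi 0) := by
  intro t₀ ht₀
  have ht₀' : 0 < t₀ := ht₀
  refine ContinuousAt.continuousWithinAt ?_
  rw [ContinuousAt, tendsto_iff_norm_sub_tendsto_zero]
  obtain ⟨g, hg, hFg⟩ := hdom (t₀ / 2) (2 * t₀) (by positivity) (by linarith)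
  have hmem : ∀ᶠ t in 𝓝 t₀, t ∈ Set.Icc (t₀ / 2) (2 * t₀) :=
    Icc_mem_nhds (by linarith) (by linarith)
  have hpos : ∀ᶠ t in 𝓝 t₀, 0 < t := lt_mem_nhds ht₀'
  have hlim : Tendsto (fun t => ∫ x, ‖F t x - F t₀ x‖) (𝓝 t₀) (𝓝 (∫ _ : E N, (0 : ℝ))) := by
    refine tendsto_integral_filter_of_dominated_convergence (fun x => g x + g x) ?_ ?_
      (hg.add hg) ?_
    · exact Eventually.of_forall fun t =>
        ((hmeas t).sub (hmeas t₀)).norm.aestronglyMeasurable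
    · filter_upwards [hmem] with t ht
      refine Eventually.of_forall fun x => ?_
      rw [norm_norm]
      exact (norm_sub_le _ _).trans (add_le_add (hFg t ht x)
        (hFg t₀ ⟨by linarith, by linarith⟩ x))
    · refine Eventually.of_forall fun x => ?_
      have h1 : Tendsto (fun t => F t x) (𝓝 t₀) (𝓝 (F t₀ x)) :=
        (hF x).continuousAt (Ioi_mem_nhds ht₀')
      simpa using (h1.sub_const (F t₀ x)).norm
  rw [integral_zero] at hlim
  refine hlim.congr' ?_
  filter_upwards [hpos] with t ht
  rw [L1.norm_eq_integral_norm]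
  refine integral_congr_ae ?_
  filter_upwards [hΦ t ht, hΦ t₀ ht₀', Lp.coeFn_sub (Φ t) (Φ t₀)] with x h1 h2 h3
  rw [h3, Pi.sub_apply, h1, h2]

/-- `G(t,·)` as an element of `L^1`. -/
def heatL (N : ℕ) (t : ℝ) : LpE N 1 :=
  if h : 0 < t then (memLp_one_iff_integrable.2 (integrable_heatKernel h)).toLp (heatKernel N t)
  else 0

/-- `∂_i G(t,·)` as an element of `L^1`. -/
def gradHeatL (i : Fin N) (t : ℝ) : LpE N 1 :=
  if h : 0 < t then (memLp_one_iff_integrable.2 (integrable_partialDeriv_heatKernel i h)).toLp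
    (partialDeriv i (heatKernel N t)) else 0

theorem coeFn_heatL {t : ℝ} (ht : 0 < t) : heatL N t =ᵐ[volume] heatKernel N t := by
  rw [heatL, dif_pos ht]
  exact MemLp.coeFn_toLp _

theorem coeFn_gradHeatL (i : Fin N) {t : ℝ} (ht : 0 < t) :
    gradHeatL i t =ᵐ[volume] partialDeriv i (heatKernel N t) := by
  rw [gradHeatL, dif_pos ht]
  exact MemLp.coeFn_toLp _

theorem norm_heatL {t : ℝ} (ht : 0 < t) : ‖heatL N t‖ = 1 := by
  rw [L1.norm_eq_integral_norm, ← integral_heatKernel (N := N) ht]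
  refine integral_congr_ae ?_
  filter_upwards [coeFn_heatL ht] with x hx
  rw [hx, Real.norm_of_nonneg (heatKernel_pos ht x).le]

theorem norm_gradHeatL_le (i : Fin N) {t : ℝ} (ht : 0 < t) :
    ‖gradHeatL i t‖ ≤ 2 ^ ((N : ℝ) / 2) * t ^ (-(1 / 2) : ℝ) := by
  rw [L1.norm_eq_integral_norm]
  have h2t : 0 < 2 * t := by positivity
  calc ∫ x, ‖gradHeatL i t x‖
      = ∫ x, ‖partialDeriv i (heatKernel N t) x‖ := by
        refine integral_congr_ae ?_
        filter_upwards [coeFn_gradHeatL i ht] with x hx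
        rw [hx]
    _ ≤ ∫ x, 2 ^ ((N : ℝ) / 2) * t ^ (-(1 / 2) : ℝ) * heatKernel N (2 * t) x :=
        integral_mono (integrable_partialDeriv_heatKernel i ht).norm
          ((integrable_heatKernel h2t).const_mul _) (abs_partialDeriv_heatKernel_le i ht)
    _ = _ := by rw [integral_const_mul, integral_heatKernel h2t, mul_one]

theorem continuousOn_heatKernel_time (x : E N) :
    ContinuousOn (fun t => heatKernel N t x) (Set.Ioi 0) := by
  intro t ht
  have ht' : 0 < t := ht
  refine ContinuousAt.continuousWithinAt ?_
  unfold heatKernel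
  refine ContinuousAt.mul ?_ ?_
  · exact ContinuousAt.rpow_const (by fun_prop) (Or.inl (by positivity))
  · refine Real.continuous_exp.continuousAt.comp ?_
    exact ContinuousAt.div (by fun_prop) (by fun_prop) (by positivity)

theorem continuousOn_heatL : ContinuousOn (heatL N) (Set.Ioi 0) := by
  refine continuousOn_toL1 (F := heatKernel N) continuousOn_heatKernel_time
    continuous_heatKernel (fun a b ha hab => ?_) fun t ht => coeFn_heatL ht
  refine ⟨_, (integrable_heatKernel (ha.trans_le hab)).const_mul ((b / a) ^ ((N : ℝ) / 2)),
    fun t ht x => ?_⟩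
  rw [Real.norm_of_nonneg (heatKernel_pos (ha.trans_le ht.1) x).le]
  exact heatKernel_le ha ht.1 ht.2 x

theorem continuousOn_gradHeatL (i : Fin N) : ContinuousOn (gradHeatL i) (Set.Ioi 0) := by
  refine continuousOn_toL1 (F := fun t => partialDeriv i (heatKernel N t)) (fun x => ?_)
    (continuous_partialDeriv_heatKernel i) (fun a b ha hab => ?_) fun t ht => coeFn_gradHeatL i ht
  · simp_rw [partialDeriv_heatKernel]
    refine ContinuousOn.mul ?_ (continuousOn_heatKernel_time x)
    refine ContinuousOn.div (by fun_prop) (by fun_prop) fun t ht => ?_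
    have : (0 : ℝ) < t := ht
    positivity
  · have h2a : 0 < 2 * a := by positivity
    refine ⟨_, (integrable_heatKernel (show 0 < 2 * b by linarith)).const_mul
      (2 ^ ((N : ℝ) / 2) * a ^ (-(1 / 2) : ℝ) * ((2 * b) / (2 * a)) ^ ((N : ℝ) / 2)),
      fun t ht x => ?_⟩
    have ht0 := ha.trans_le ht.1
    refine (abs_partialDeriv_heatKernel_le i ht0 x).trans ?_
    rw [mul_assoc _ (_ ^ ((N : ℝ) / 2)) (heatKernel N (2 * b) x)]
    have h3 := heatKernel_le h2a (show 2 * a ≤ 2 * t by linarith [ht.1])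
      (show 2 * t ≤ 2 * b by linarith [ht.2]) x
    have h4 := (heatKernel_pos (N := N) (show 0 < 2 * t by positivity) x).le
    have h5 : t ^ (-(1 / 2) : ℝ) ≤ a ^ (-(1 / 2) : ℝ) :=
      Real.rpow_le_rpow_of_nonpos ha ht.1 (by norm_num)
    gcongr

/-! ### Semigroup laws for the kernels in L^1 -/

section Semigroup

variable [hp : Fact (1 ≤ p)]

theorem convL_heatL_heatL {s t : ℝ} (hs : 0 < s) (ht : 0 < t) :
    convL 1 (heatL N s) (heatL N t) = heatL N (s + t) := by
  refine Lp.ext ((coeFn_convL 1 _ _).trans (.trans ?_ (coeFn_heatL (add_pos hs ht)).symm))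
  rw [conv_congr (coeFn_heatL hs) (coeFn_heatL ht), conv_heatKernel hs ht]

theorem convL_heatL_gradHeatL (i : Fin N) {s t : ℝ} (hs : 0 < s) (ht : 0 < t) :
    convL 1 (heatL N s) (gradHeatL i t) = gradHeatL i (s + t) := by
  refine Lp.ext ((coeFn_convL 1 _ _).trans (.trans ?_ (coeFn_gradHeatL i (add_pos hs ht)).symm))
  rw [conv_congr (coeFn_heatL hs) (coeFn_gradHeatL i ht), conv_partialDeriv_heatKernel i hs ht]

end Semigroup

/-! ### Duality with test functions -/

theorem IsTestFunction.memLp {φ : E N → ℝ} (h : IsTestFunction φ) (r : ℝ≥0∞) : MemLp φ r :=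
  h.1.continuous.memLp_of_hasCompactSupport h.2

theorem ae_eq_of_test {f g : E N → ℝ} (hf : LocallyIntegrable f) (hg : LocallyIntegrable g)
    (h : ∀ φ : E N → ℝ, IsTestFunction φ → ∫ x, f x * φ x = ∫ x, g x * φ x) :
    f =ᵐ[volume] g :=
  ae_eq_of_integral_contDiff_smul_eq hf hg fun φ h1 h2 => by
    simpa only [smul_eq_mul, mul_comm] using h φ ⟨h1, h2⟩

/-- `f ↦ ∫ f φ` is a bounded functional on `L^p`. -/
theorem exists_pairing [hp : Fact (1 ≤ p)] {φ : E N → ℝ} (hφ : IsTestFunction φ) :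
    ∃ ℓ : LpE N p →L[ℝ] ℝ, ∀ f, ℓ f = ∫ x, f x * φ x := by
  -- The exponent (1 - p⁻¹)⁻¹ is the Hölder conjugate of p, endpoints included.
  have := ENNReal.HolderConjugate.inv_one_sub_inv' hp.out
  have : Fact (1 ≤ (1 - p⁻¹)⁻¹) := by simp [fact_iff]
  refine ⟨((ContinuousLinearMap.mul ℝ ℝ).lpPairing volume p (1 - p⁻¹)⁻¹).flip
    ((hφ.memLp _).toLp φ), fun f => ?_⟩
  rw [ContinuousLinearMap.flip_apply, ContinuousLinearMap.lpPairing_eq_integral]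
  refine integral_congr_ae ?_
  filter_upwards [(hφ.memLp (1 - p⁻¹)⁻¹).coeFn_toLp] with x hx
  rw [hx]
  rfl

/-- Fubini turns the convolution into an average of translates of the test function. The
integrability hypotheses are kept general so as to cover both L^1 * L^p and L^q * L^p. -/
theorem integral_conv_mul {k f ψ : E N → ℝ} {r : ℝ≥0∞} (hr : 1 ≤ r)
    (hk : AEStronglyMeasurable k) (hf : AEStronglyMeasurable f) (hex : ∀ᵐ x, ConvAt k f x)
    (hconv : MemLp (conv (fun x => ‖k x‖) fun x => ‖f x‖) r) (hψ : Continuous ψ)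
    (hψc : HasCompactSupport ψ) :
    ∫ x, conv k f x * ψ x = ∫ y, k y * ∫ x, f x * ψ (x + y) := by
  have hmeas : AEStronglyMeasurable (fun z : E N × E N => k z.2 * f (z.1 - z.2) * ψ z.1)
      (volume.prod volume) :=
    (aestronglyMeasurable_conv_integrand hk hf).mul
      (hψ.comp continuous_fst).aestronglyMeasurable
  have hint : Integrable (fun z : E N × E N => k z.2 * f (z.1 - z.2) * ψ z.1)
      (volume.prod volume) := by
    rw [integrable_prod_iff hmeas]
    refine ⟨hex.mono fun x hx => Integrable.mul_const (f := fun t => k t * f (x - t)) hx (ψ x), ?_⟩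
    have h := (hconv.locallyIntegrable hr).integrable_smul_right_of_hasCompactSupport
      hψ.norm hψc.norm
    refine h.congr (Eventually.of_forall fun x => ?_)
    simp only [norm_mul, integral_mul_const, smul_eq_mul, conv_apply]
  calc ∫ x, conv k f x * ψ x = ∫ x, ∫ y, k y * f (x - y) * ψ x := by
        simp only [conv_apply, integral_mul_const]
    _ = ∫ y, ∫ x, k y * f (x - y) * ψ x := integral_integral_swap hint
    _ = ∫ y, k y * ∫ x, f x * ψ (x + y) := by
        refine integral_congr_ae (Eventually.of_forall fun y => ?_)
        simp only [mul_assoc, integral_const_mul]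
        rw [← integral_add_right_eq_self (fun x => f (x - y) * ψ x) y]
        simp

theorem integral_conv_mul_of_memLp {k f ψ : E N → ℝ} (hp : 1 ≤ p) (hk : MemLp k 1)
    (hf : MemLp f p) (hψ : Continuous ψ) (hψc : HasCompactSupport ψ) :
    ∫ x, conv k f x * ψ x = ∫ y, k y * ∫ x, f x * ψ (x + y) :=
  integral_conv_mul hp hk.1 hf.1 (ae_convAt hp hk hf) (MemLp.conv hp hk.norm hf.norm) hψ hψc

theorem integral_conv_mul_of_conj {q : ℝ≥0∞} {K f ψ : E N → ℝ} (hpq : 1 / p + 1 / q = 1)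
    (hK : MemLp K q) (hf : MemLp f p) (hψ : Continuous ψ) (hψc : HasCompactSupport ψ) :
    ∫ x, conv K f x * ψ x = ∫ y, K y * ∫ x, f x * ψ (x + y) := by
  refine integral_conv_mul (r := ⊤) le_top hK.1 hf.1
    (Eventually.of_forall (convAt_of_conj hpq hK hf)) ?_ hψ hψc
  refine ⟨aestronglyMeasurable_conv hK.1.norm hf.1.norm, ?_⟩
  rw [eLpNorm_exponent_top]
  refine (eLpNormEssSup_le_of_ae_enorm_bound (Eventually.of_forall fun x => ?_)).trans_lt
    (ENNReal.mul_lt_top hK.norm.2 hf.norm.2)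
  exact (enorm_conv_le _ _ _).trans (absConv_le_holder hpq hK.1.norm hf.1.norm x)

/-! ### The heat semigroup as an approximate identity -/

theorem heatKernel_sqrt_smul {t : ℝ} (ht : 0 < t) (z : E N) :
    heatKernel N t (√t • z) = (√t ^ N)⁻¹ * heatKernel N 1 z := by
  have hst : 0 < √t := Real.sqrt_pos.2 ht
  unfold heatKernel
  rw [norm_smul, Real.norm_of_nonneg hst.le, mul_pow, Real.sq_sqrt ht.le, mul_one, mul_one,
    Real.mul_rpow (by positivity) ht.le]
  have h1 : t ^ (-(N : ℝ) / 2) = (√t ^ N)⁻¹ := by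
    rw [Real.sqrt_eq_rpow, ← Real.rpow_natCast, ← Real.rpow_mul ht.le, ← Real.rpow_neg ht.le]
    congr 1
    ring
  have h2 : -(t * ‖z‖ ^ 2) / (4 * t) = -‖z‖ ^ 2 / 4 := by field_simp
  rw [h1, h2]
  ring

theorem integral_heatKernel_mul {t : ℝ} (ht : 0 < t) (w : E N → ℝ) :
    ∫ y, heatKernel N t y * w y = ∫ z, heatKernel N 1 z * w (√t • z) := by
  have hst : 0 < √t := Real.sqrt_pos.2 ht
  have h := Measure.integral_comp_smul_of_nonneg volume
    (fun y : E N => heatKernel N t y * w y) √t (hR := hst.le)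
  simp only [heatKernel_sqrt_smul ht, finrank_euclideanSpace_fin, smul_eq_mul, mul_assoc,
    integral_const_mul] at h
  have h3 : (√t ^ N)⁻¹ ≠ 0 := by positivity
  exact (mul_left_cancel₀ h3 h).symm

/-- Parabolic scaling fixes the kernel at time 1 and moves t into the argument of w, so dominated
convergence applies. -/
theorem tendsto_integral_heatKernel_mul {w : E N → ℝ} (hw : Continuous w) (h0 : w 0 = 0) {C : ℝ}
    (hC : ∀ y, ‖w y‖ ≤ C) :
    Tendsto (fun t => ∫ y, heatKernel N t y * w y) (𝓝[>] 0) (𝓝 0) := by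
  have h : Tendsto (fun t : ℝ => ∫ z, heatKernel N 1 z * w (√t • z)) (𝓝[>] 0)
      (𝓝 (∫ _ : E N, (0 : ℝ))) := by
    refine tendsto_integral_filter_of_dominated_convergence (fun z => heatKernel N 1 z * C)
      ?_ ?_ ((integrable_heatKernel one_pos).mul_const C) ?_
    · refine Eventually.of_forall fun t => ?_
      have := continuous_heatKernel (N := N) 1
      exact (by fun_prop : Continuous fun z => heatKernel N 1 z * w (√t • z)).aestronglyMeasurable
    · refine Eventually.of_forall fun t => Eventually.of_forall fun z => ?_
      have := (heatKernel_pos (N := N) one_pos z).le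
      rw [norm_mul, Real.norm_of_nonneg this]
      gcongr
      exact hC _
    · refine Eventually.of_forall fun z => ?_
      have h1 : Continuous fun t : ℝ => heatKernel N 1 z * w (√t • z) := by fun_prop
      have h2 := h1.tendsto 0
      simp only [Real.sqrt_zero, zero_smul, h0, mul_zero] at h2
      exact h2.mono_left nhdsWithin_le_nhds
  rw [integral_zero] at h
  refine h.congr' ?_
  filter_upwards [self_mem_nhdsWithin] with t ht
  exact (integral_heatKernel_mul ht w).symm

/-- `e^{tΔ} f → f` in `L^p` for `p < ∞`. -/
theorem tendsto_convL_heatL [hp : Fact (1 ≤ p)] (hp' : p ≠ ⊤) (f : LpE N p) :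
    Tendsto (fun t => convL p (heatL N t) f) (𝓝[>] 0) (𝓝 f) := by
  have : Fact (p ≠ ⊤) := ⟨hp'⟩
  -- The translate f(· - y). Its continuity in y as an element of L^p is where p < ∞ is needed.
  set τ : E N → LpE N p := fun y => DomAddAct.mk (-y) +ᵥ f with hτ
  have hτc : Continuous τ := by
    have h1 : Continuous fun y : E N => DomAddAct.mk (-y) :=
      DomAddAct.continuous_mk.comp continuous_neg
    exact h1.vadd continuous_const
  have hτ0 : τ 0 = f := by simp [hτ]
  have hτn : ∀ y, ‖τ y‖ = ‖f‖ := fun y => DomAddAct.norm_vadd_Lp _ _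
  have hτa : ∀ y, τ y =ᵐ[volume] fun x => f (x - y) := by
    intro y
    filter_upwards [DomAddAct.vadd_Lp_ae_eq (DomAddAct.mk (-y)) f] with x hx
    rw [hx]
    simp [sub_eq_neg_add]
  have hint : ∀ t, 0 < t → Integrable fun y => heatKernel N t y • τ y := by
    intro t ht
    refine (integrable_heatKernel ht).smul_bdd ‖f‖ hτc.aestronglyMeasurable ?_
    exact Eventually.of_forall fun y => (hτn y).le
  -- The convolution is a Bochner integral of translates, as pairing with test functions shows;
  -- hence ‖e^{tΔ}f - f‖ is at most the Gaussian average of ‖τ y - f‖.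
  have hJ : ∀ t, 0 < t → convL p (heatL N t) f = ∫ y, heatKernel N t y • τ y := by
    intro t ht
    refine Lp.ext (ae_eq_of_test ((Lp.memLp _).locallyIntegrable hp.out)
      ((Lp.memLp _).locallyIntegrable hp.out) fun φ hφ => ?_)
    obtain ⟨ℓ, hℓ⟩ := exists_pairing (p := p) hφ
    rw [← hℓ (∫ y, heatKernel N t y • τ y), ← ContinuousLinearMap.integral_comp_comm _ (hint t ht)]
    have h1 : ∫ x, (convL p (heatL N t) f) x * φ x = ∫ x, conv (heatKernel N t) f x * φ x := by
      rw [← conv_congr (coeFn_heatL ht) .rfl]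
      refine integral_congr_ae ?_
      filter_upwards [coeFn_convL p (heatL N t) f] with x hx
      rw [hx]
    rw [h1, integral_conv_mul_of_memLp hp.out
      (memLp_one_iff_integrable.2 (integrable_heatKernel ht)) (Lp.memLp f) hφ.1.continuous hφ.2]
    refine integral_congr_ae (Eventually.of_forall fun y => ?_)
    simp only [map_smul, smul_eq_mul]
    congr 1
    rw [hℓ, ← integral_sub_right_eq_self (fun x => f x * φ (x + y)) y]
    refine integral_congr_ae ?_
    filter_upwards [hτa y] with x hx
    rw [hx, sub_add_cancel]
  have hw := tendsto_integral_heatKernel_mul (w := fun y => ‖τ y - f‖) (C := ‖f‖ + ‖f‖)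
    (by fun_prop) (by simp [hτ0]) fun y => by
      rw [norm_norm]
      exact (norm_sub_le _ _).trans (by rw [hτn])
  rw [tendsto_iff_norm_sub_tendsto_zero]
  refine squeeze_zero' (Eventually.of_forall fun _ => norm_nonneg _) ?_ hw
  filter_upwards [self_mem_nhdsWithin] with t ht
  have ht' : (0 : ℝ) < t := ht
  have h2 : f = ∫ y, heatKernel N t y • f := by
    rw [integral_smul_const, integral_heatKernel ht', one_smul]
  have h3 : convL p (heatL N t) f - f = ∫ y, heatKernel N t y • (τ y - f) := by
    nth_rewrite 2 [h2]
    rw [hJ t ht', ← integral_sub (hint t ht') ((integrable_heatKernel ht').smul_const f)]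
    simp only [smul_sub]
  rw [h3]
  refine (norm_integral_le_integral_norm _).trans (le_of_eq ?_)
  refine integral_congr_ae (Eventually.of_forall fun y => ?_)
  simp only [norm_smul, Real.norm_of_nonneg (heatKernel_pos ht' y).le]

end

section

variable {N : ℕ} {p : ℝ≥0∞}

/-! ### Multi-index derivatives of test functions -/

theorem partialDeriv_comm {φ : E N → ℝ} (h : IsTestFunction φ) (i j : Fin N) :
    partialDeriv i (partialDeriv j φ) = partialDeriv j (partialDeriv i φ) := by
  funext x
  have hd : DifferentiableAt ℝ (fderiv ℝ φ) x :=
    ((h.1.fderiv_right (m := ∞) (by simp)).differentiable (by simp)) x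
  have hs : IsSymmSndFDerivAt ℝ φ x :=
    h.1.contDiffAt.isSymmSndFDerivAt (by
      rw [minSmoothness_of_isRCLikeNormedField]
      exact WithTop.coe_le_coe.2 le_top)
  have key : ∀ a b : Fin N, partialDeriv a (partialDeriv b φ) x =
      fderiv ℝ (fderiv ℝ φ) x (EuclideanSpace.single a 1) (EuclideanSpace.single b 1) := by
    intro a b
    have h1 := (hd.hasFDerivAt.clm_apply
      (hasFDerivAt_const (EuclideanSpace.single b (1 : ℝ)) x)).fderiv
    show fderiv ℝ (fun y => fderiv ℝ φ y (EuclideanSpace.single b 1)) x _ = _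
    rw [h1]
    simp
  rw [key, key]
  exact hs _ _

theorem IsTestFunction.iterate_partialDeriv {φ : E N → ℝ} (h : IsTestFunction φ) (i : Fin N)
    (k : ℕ) : IsTestFunction ((AggDiff.partialDeriv i)^[k] φ) := by
  induction k with
  | zero => exact h
  | succ k ih =>
    rw [Function.iterate_succ_apply']
    exact ih.partialDeriv i

theorem partialDeriv_iterate_comm {φ : E N → ℝ} (h : IsTestFunction φ) (i j : Fin N) (k : ℕ) :
    partialDeriv i ((partialDeriv j)^[k] φ) = (partialDeriv j)^[k] (partialDeriv i φ) := by
  induction k with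
  | zero => rfl
  | succ k ih =>
    rw [Function.iterate_succ_apply', Function.iterate_succ_apply', ← ih,
      partialDeriv_comm (h.iterate_partialDeriv j k)]

/-- The derivative `∂^γ` restricted to the variables listed in `l`. -/
def listDeriv (l : List (Fin N)) (γ : Fin N → ℕ) (φ : E N → ℝ) : E N → ℝ :=
  l.foldr (fun i g => (partialDeriv i)^[γ i] g) φ

theorem IsTestFunction.listDeriv {φ : E N → ℝ} (h : IsTestFunction φ) (l : List (Fin N))
    (γ : Fin N → ℕ) : IsTestFunction (listDeriv l γ φ) := by
  induction l with
  | nil => exact h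
  | cons i l ih => exact ih.iterate_partialDeriv i (γ i)

theorem partialDeriv_listDeriv {φ : E N → ℝ} (h : IsTestFunction φ) (l : List (Fin N))
    (γ : Fin N → ℕ) (i : Fin N) :
    partialDeriv i (listDeriv l γ φ) = listDeriv l γ (partialDeriv i φ) := by
  induction l with
  | nil => rfl
  | cons j l ih =>
    show partialDeriv i ((partialDeriv j)^[γ j] (listDeriv l γ φ)) =
      (partialDeriv j)^[γ j] (listDeriv l γ (partialDeriv i φ))
    rw [partialDeriv_iterate_comm (h.listDeriv l γ), ih]

/-- Without repetitions in the list the extra derivative occurs exactly once, and it can be moved to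
the innermost place because partial derivatives of test functions commute. -/
theorem listDeriv_add_single {φ : E N → ℝ} (h : IsTestFunction φ) (l : List (Fin N))
    (hl : l.Nodup) (γ : Fin N → ℕ) (i : Fin N) :
    listDeriv l (γ + Pi.single i 1) φ =
      if i ∈ l then listDeriv l γ (partialDeriv i φ) else listDeriv l γ φ := by
  induction l with
  | nil => simp [listDeriv]
  | cons j l ih =>
    have ih' := ih (List.nodup_cons.1 hl).2
    have hj := (List.nodup_cons.1 hl).1
    show (partialDeriv j)^[(γ + Pi.single i 1 : Fin N → ℕ) j] (listDeriv l (γ + Pi.single i 1) φ) =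
      if i ∈ j :: l then (partialDeriv j)^[γ j] (listDeriv l γ (partialDeriv i φ)) else
        (partialDeriv j)^[γ j] (listDeriv l γ φ)
    rw [ih']
    by_cases hij : i = j
    · subst hij
      rw [if_neg hj, if_pos List.mem_cons_self, Pi.add_apply, Pi.single_eq_same,
        Function.iterate_succ_apply, partialDeriv_listDeriv h]
    · rw [Pi.add_apply, Pi.single_eq_of_ne' hij, add_zero]
      by_cases hil : i ∈ l
      · rw [if_pos hil, if_pos (List.mem_cons_of_mem _ hil)]
      · rw [if_neg hil, if_neg (by simp [hij, hil])]

theorem multiDeriv_add_single {φ : E N → ℝ} (h : IsTestFunction φ) (γ : Fin N → ℕ) (i : Fin N) :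
    multiDeriv (γ + Pi.single i 1) φ = multiDeriv γ (partialDeriv i φ) := by
  have := listDeriv_add_single h (List.finRange N) (List.nodup_finRange N) γ i
  rwa [if_pos (List.mem_finRange i)] at this

theorem multiDeriv_partialDeriv {φ : E N → ℝ} (h : IsTestFunction φ) (γ : Fin N → ℕ) (i : Fin N) :
    multiDeriv γ (partialDeriv i φ) = partialDeriv i (multiDeriv γ φ) :=
  (partialDeriv_listDeriv h (List.finRange N) γ i).symm

theorem multiDeriv_zero (φ : E N → ℝ) : multiDeriv 0 φ = φ := by
  unfold multiDeriv
  induction List.finRange N with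
  | nil => rfl
  | cons i l ih => simp

theorem multiDeriv_single {φ : E N → ℝ} (h : IsTestFunction φ) (i : Fin N) :
    multiDeriv (Pi.single i 1) φ = partialDeriv i φ := by
  have := multiDeriv_add_single h 0 i
  rwa [zero_add, multiDeriv_zero] at this

theorem partialDeriv_translate (i : Fin N) (φ : E N → ℝ) (y : E N) :
    partialDeriv i (fun x => φ (x + y)) = fun x => partialDeriv i φ (x + y) := by
  funext x
  simp only [partialDeriv, fderiv_comp_add_right]

theorem multiDeriv_translate (γ : Fin N → ℕ) (φ : E N → ℝ) (y : E N) :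
    multiDeriv γ (fun x => φ (x + y)) = fun x => multiDeriv γ φ (x + y) := by
  unfold multiDeriv
  induction List.finRange N with
  | nil => rfl
  | cons i l ih =>
    rw [List.foldr_cons, List.foldr_cons, ih]
    generalize List.foldr _ φ l = g
    induction γ i with
    | zero => rfl
    | succ k ihk =>
      rw [Function.iterate_succ_apply', Function.iterate_succ_apply', ihk, partialDeriv_translate]

theorem IsTestFunction.translate {φ : E N → ℝ} (h : IsTestFunction φ) (y : E N) :
    IsTestFunction (fun x => φ (x + y)) :=
  ⟨h.1.comp (contDiff_id.add contDiff_const),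
    h.2.comp_homeomorph (Homeomorph.addRight y)⟩

theorem sum_add_single (γ : Fin N → ℕ) (i : Fin N) :
    ∑ j, (γ + Pi.single i 1 : Fin N → ℕ) j = ∑ j, γ j + 1 := by
  simp [Finset.sum_add_distrib]

theorem sum_single_one (i : Fin N) : ∑ j, (Pi.single i 1 : Fin N → ℕ) j = 1 := by
  simp

theorem exists_eq_add_single {γ : Fin N → ℕ} (h : γ ≠ 0) :
    ∃ (γ' : Fin N → ℕ) (i : Fin N), γ = γ' + Pi.single i 1 := by
  obtain ⟨i, hi⟩ := Function.ne_iff.1 h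
  refine ⟨γ - Pi.single i 1, i, ?_⟩
  rw [tsub_add_cancel_of_le]
  intro j
  by_cases hij : j = i
  · subst hij
    simpa using Nat.one_le_iff_ne_zero.2 hi
  · simp [hij]

/-! ### Weak derivatives -/

theorem HasWeakDeriv.congr {γ : Fin N → ℕ} {f f' g g' : E N → ℝ} (h : HasWeakDeriv γ f g)
    (hf : f =ᵐ[volume] f') (hg : g =ᵐ[volume] g') : HasWeakDeriv γ f' g' := by
  intro φ hφ
  have h1 : ∫ x, f' x * multiDeriv γ φ x = ∫ x, f x * multiDeriv γ φ x :=
    integral_congr_ae (hf.mono fun x hx => by simp only [hx])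
  have h2 : ∫ x, g' x * φ x = ∫ x, g x * φ x :=
    integral_congr_ae (hg.mono fun x hx => by simp only [hx])
  rw [h1, h2, h φ hφ]

theorem HasWeakDeriv.unique {γ : Fin N → ℕ} {f g g' : E N → ℝ} (h : HasWeakDeriv γ f g)
    (h' : HasWeakDeriv γ f g') (hg : LocallyIntegrable g) (hg' : LocallyIntegrable g') :
    g =ᵐ[volume] g' := by
  refine ae_eq_of_test hg hg' fun φ hφ => ?_
  have := (h φ hφ).symm.trans (h' φ hφ)
  exact mul_left_cancel₀ (pow_ne_zero _ (by norm_num)) this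

theorem hasWeakDeriv_zero (f : E N → ℝ) : HasWeakDeriv 0 f f := by
  intro φ _
  simp [multiDeriv_zero]

theorem hasWeakDeriv_single_iff {i : Fin N} {f g : E N → ℝ} :
    HasWeakDeriv (Pi.single i 1) f g ↔ ∀ φ, IsTestFunction φ →
      ∫ x, f x * partialDeriv i φ x = -∫ x, g x * φ x := by
  refine forall₂_congr fun φ hφ => ?_
  rw [multiDeriv_single hφ, sum_single_one, pow_one, neg_one_mul]

/-- The first derivative is tested against ∂^γ φ. Together with the converse
`HasWeakDeriv.add_single` it permits induction on the order of differentiation. -/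
theorem HasWeakDeriv.of_add_single {γ : Fin N → ℕ} {i : Fin N} {f g h : E N → ℝ}
    (hh : HasWeakDeriv (γ + Pi.single i 1) f h) (hg : HasWeakDeriv (Pi.single i 1) f g) :
    HasWeakDeriv γ g h := by
  intro φ hφ
  have h1 := hh φ hφ
  have h2 := hasWeakDeriv_single_iff.1 hg _ (hφ.multiDeriv γ)
  rw [multiDeriv_add_single hφ, multiDeriv_partialDeriv hφ, h2, sum_add_single, pow_succ] at h1
  linarith

theorem HasWeakDeriv.add_single {γ : Fin N → ℕ} {i : Fin N} {f g h : E N → ℝ}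
    (hh : HasWeakDeriv γ g h) (hg : HasWeakDeriv (Pi.single i 1) f g) :
    HasWeakDeriv (γ + Pi.single i 1) f h := by
  intro φ hφ
  have h1 := hh φ hφ
  have h2 := hasWeakDeriv_single_iff.1 hg _ (hφ.multiDeriv γ)
  rw [multiDeriv_add_single hφ, multiDeriv_partialDeriv hφ, h2, sum_add_single, pow_succ, h1]
  ring

theorem HasWeakDeriv.add [hp : Fact (1 ≤ p)] {γ : Fin N → ℕ} {f f' g g' : LpE N p}
    (h : HasWeakDeriv γ f g) (h' : HasWeakDeriv γ f' g') :
    HasWeakDeriv γ (f + f' : LpE N p) (g + g' : LpE N p) := by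
  intro φ hφ
  obtain ⟨ℓ, hℓ⟩ := exists_pairing (p := p) hφ
  obtain ⟨ℓ', hℓ'⟩ := exists_pairing (p := p) (hφ.multiDeriv γ)
  have h1 := h φ hφ
  have h2 := h' φ hφ
  rw [← hℓ, ← hℓ'] at h1 h2 ⊢
  rw [map_add, map_add, h1, h2, mul_add]

/-- Convolution commutes with weak derivatives. -/
theorem HasWeakDeriv.conv {γ : Fin N → ℕ} {k f g : E N → ℝ} (h : HasWeakDeriv γ f g)
    (hf : ∀ ψ : E N → ℝ, Continuous ψ → HasCompactSupport ψ →
      ∫ x, conv k f x * ψ x = ∫ y, k y * ∫ x, f x * ψ (x + y))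
    (hg : ∀ ψ : E N → ℝ, Continuous ψ → HasCompactSupport ψ →
      ∫ x, AggDiff.conv k g x * ψ x = ∫ y, k y * ∫ x, g x * ψ (x + y)) :
    HasWeakDeriv γ (AggDiff.conv k f) (AggDiff.conv k g) := by
  intro φ hφ
  have hφγ := hφ.multiDeriv γ
  rw [hf _ hφγ.1.continuous hφγ.2, hg _ hφ.1.continuous hφ.2, ← integral_const_mul]
  refine integral_congr_ae (Eventually.of_forall fun y => ?_)
  have h1 := h _ (hφ.translate y)
  rw [multiDeriv_translate] at h1
  simp only [h1]
  ring

theorem HasWeakDeriv.conv_memLp {γ : Fin N → ℕ} {k f g : E N → ℝ} (hp : 1 ≤ p)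
    (h : HasWeakDeriv γ f g) (hk : MemLp k 1) (hf : MemLp f p) (hg : MemLp g p) :
    HasWeakDeriv γ (AggDiff.conv k f) (AggDiff.conv k g) :=
  h.conv (fun _ h1 h2 => integral_conv_mul_of_memLp hp hk hf h1 h2)
    (fun _ h1 h2 => integral_conv_mul_of_memLp hp hk hg h1 h2)

theorem HasWeakDeriv.conv_conj {γ : Fin N → ℕ} {q : ℝ≥0∞} {K f g : E N → ℝ}
    (hpq : 1 / p + 1 / q = 1) (h : HasWeakDeriv γ f g) (hK : MemLp K q) (hf : MemLp f p)
    (hg : MemLp g p) : HasWeakDeriv γ (AggDiff.conv K f) (AggDiff.conv K g) :=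
  h.conv (fun _ h1 h2 => integral_conv_mul_of_conj hpq hK hf h1 h2)
    (fun _ h1 h2 => integral_conv_mul_of_conj hpq hK hg h1 h2)

end

section

variable {N : ℕ} {p : ℝ≥0∞}

/-! ### The product rule for weak derivatives -/

theorem partialDeriv_mul {f g : E N → ℝ} (hf : Differentiable ℝ f) (hg : Differentiable ℝ g)
    (i : Fin N) (x : E N) : partialDeriv i (fun x => f x * g x) x =
      f x * partialDeriv i g x + partialDeriv i f x * g x := by
  have h : fderiv ℝ (fun x => f x * g x) x = f x • fderiv ℝ g x + g x • fderiv ℝ f x :=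
    ((hf x).hasFDerivAt.mul (hg x).hasFDerivAt).fderiv
  simp only [partialDeriv]
  rw [h]
  simp only [add_apply, smul_apply, smul_eq_mul]
  ring

/-- The classical derivative of a smooth function is its weak derivative. -/
theorem hasWeakDeriv_of_contDiff {h : E N → ℝ} (hh : ContDiff ℝ ∞ h) (i : Fin N) :
    HasWeakDeriv (Pi.single i 1) h (partialDeriv i h) := by
  rw [hasWeakDeriv_single_iff]
  intro φ hφ
  have hd : Continuous (partialDeriv i h) :=
    ((hh.fderiv_right (m := ∞) (by simp)).clm_apply contDiff_const).continuous
  refine integral_mul_fderiv_eq_neg_fderiv_mul_of_integrable ?_ ?_ ?_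
    (fun x _ => hh.differentiable (by simp) x) (fun x _ => hφ.1.differentiable (by simp) x)
  · exact (hd.mul hφ.1.continuous).integrable_of_hasCompactSupport hφ.2.mul_left
  · exact (hh.continuous.mul (hφ.partialDeriv i).1.continuous).integrable_of_hasCompactSupport
      (hφ.partialDeriv i).2.mul_left
  · exact (hh.continuous.mul hφ.1.continuous).integrable_of_hasCompactSupport hφ.2.mul_left

theorem LocallyIntegrable.integrable_mul_test {f φ : E N → ℝ} (hf : LocallyIntegrable f)
    (hφ : IsTestFunction φ) : Integrable fun x => f x * φ x := by
  simpa [smul_eq_mul] using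
    hf.integrable_smul_right_of_hasCompactSupport hφ.1.continuous hφ.2

/-- A standard sequence of mollifiers. -/
def bump (N n : ℕ) : ContDiffBump (0 : E N) where
  rIn := 1 / (n + 1)
  rOut := 2 / (n + 1)
  rIn_pos := by positivity
  rIn_lt_rOut := by gcongr; norm_num

/-- The mollification of `h`. -/
def mollify (n : ℕ) (h : E N → ℝ) : E N → ℝ := conv ((bump N n).normed volume) h

theorem memLp_bump_normed (n : ℕ) (r : ℝ≥0∞) : MemLp ((bump N n).normed volume) r :=
  (bump N n).continuous_normed.memLp_of_hasCompactSupport (bump N n).hasCompactSupport_normed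

theorem contDiff_mollify (n : ℕ) {h : E N → ℝ} (hh : LocallyIntegrable h) :
    ContDiff ℝ ∞ (mollify n h) :=
  (bump N n).hasCompactSupport_normed.contDiff_convolution_left _
    (bump N n).contDiff_normed hh

theorem ae_tendsto_mollify {h : E N → ℝ} (hh : LocallyIntegrable h) :
    ∀ᵐ x, Tendsto (fun n => mollify n h x) atTop (𝓝 (h x)) := by
  have h1 : Tendsto (fun n => (bump N n).rOut) atTop (𝓝 0) := by
    have := (tendsto_one_div_add_atTop_nhds_zero_nat (𝕜 := ℝ)).const_mul 2
    simpa [bump, div_eq_mul_inv] using this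
  -- Almost everywhere convergence for merely locally integrable h requires comparable inner and
  -- outer radii.
  have h2 : ∀ᶠ n in atTop, (bump N n).rOut ≤ 2 * (bump N n).rIn :=
    Eventually.of_forall fun n => by
      simp only [bump]
      rw [mul_one_div]
  exact ContDiffBump.ae_convolution_tendsto_right_of_locallyIntegrable h1 h2 hh

theorem norm_mollify_le (n : ℕ) {h : E N → ℝ} (hh : MemLp h ⊤) (x : E N) :
    ‖mollify n h x‖ ≤ (eLpNorm h ⊤ volume).toReal := by
  have h1 : eLpNorm ((bump N n).normed volume) 1 volume = 1 := by
    have := (bump N n).integral_normed (μ := (volume : Measure (E N)))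
    rw [eLpNorm_one_eq_lintegral_enorm, ← ofReal_integral_norm_eq_lintegral_enorm
      (memLp_one_iff_integrable.1 (memLp_bump_normed n 1))]
    simp_rw [Real.norm_of_nonneg ((bump N n).nonneg_normed _)]
    rw [this, ENNReal.ofReal_one]
  have h2 := (enorm_conv_le ((bump N n).normed volume) h x).trans (absConv_le_top hh x)
  rw [h1, one_mul] at h2
  rw [← toReal_enorm]
  exact ENNReal.toReal_mono hh.2.ne h2

theorem partialDeriv_mollify {i : Fin N} (n : ℕ) {h h' : E N → ℝ} (hh : MemLp h ⊤)
    (hh' : MemLp h' ⊤) (hd : HasWeakDeriv (Pi.single i 1) h h') :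
    partialDeriv i (mollify n h) =ᵐ[volume] mollify n h' := by
  have hs := contDiff_mollify n (hh.locallyIntegrable le_top)
  refine (hasWeakDeriv_of_contDiff hs i).unique
    (hd.conv_memLp le_top (memLp_bump_normed n 1) hh hh') ?_ ?_
  · exact ((hs.fderiv_right (m := ∞) (by simp)).clm_apply
      contDiff_const).continuous.locallyIntegrable
  · exact (contDiff_mollify n (hh'.locallyIntegrable le_top)).continuous.locallyIntegrable

theorem tendsto_integral_mul_mollify {u h : E N → ℝ} (hu : Integrable u) (hh : MemLp h ⊤) :
    Tendsto (fun n => ∫ x, u x * mollify n h x) atTop (𝓝 (∫ x, u x * h x)) := by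
  refine tendsto_integral_of_dominated_convergence
    (fun x => ‖u x‖ * (eLpNorm h ⊤ volume).toReal) (fun n => ?_) (hu.norm.mul_const _)
    (fun n => Eventually.of_forall fun x => ?_) ?_
  · exact hu.1.mul
      (contDiff_mollify n (hh.locallyIntegrable le_top)).continuous.aestronglyMeasurable
  · rw [norm_mul]
    gcongr
    exact norm_mollify_le n hh x
  · filter_upwards [ae_tendsto_mollify (hh.locallyIntegrable le_top)] with x hx
    exact hx.const_mul _

theorem integrable_mul_mollify {u h : E N → ℝ} (hu : Integrable u) (hh : MemLp h ⊤) (n : ℕ) :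
    Integrable fun x => u x * mollify n h x :=
  hu.mul_bdd
    (contDiff_mollify n (hh.locallyIntegrable le_top)).continuous.aestronglyMeasurable
    (Eventually.of_forall (norm_mollify_le n hh))

/-- The product rule. -/
theorem HasWeakDeriv.mul {i : Fin N} {f f' h h' : E N → ℝ} (hf : LocallyIntegrable f)
    (hf' : LocallyIntegrable f') (hh : MemLp h ⊤) (hh' : MemLp h' ⊤)
    (hdf : HasWeakDeriv (Pi.single i 1) f f') (hdh : HasWeakDeriv (Pi.single i 1) h h') :
    HasWeakDeriv (Pi.single i 1) (fun x => f x * h x) (fun x => f' x * h x + f x * h' x) := by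
  rw [hasWeakDeriv_single_iff] at hdf ⊢
  intro φ hφ
  have hfφ := LocallyIntegrable.integrable_mul_test hf hφ
  have hf'φ := LocallyIntegrable.integrable_mul_test hf' hφ
  have hfdφ := LocallyIntegrable.integrable_mul_test hf (hφ.partialDeriv i)
  -- Only the bounded factor h is mollified: then (mollified h) φ is itself a test function for the
  -- weak derivative of f. The mollifications are uniformly bounded and converge almost everywhere,
  -- so the identity passes to the limit.
  have key : ∀ n, ∫ x, (f x * partialDeriv i φ x) * mollify n h x =
      -((∫ x, (f' x * φ x) * mollify n h x) + ∫ x, (f x * φ x) * mollify n h' x) := by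
    intro n
    have hs := contDiff_mollify n (hh.locallyIntegrable le_top)
    have hψ : IsTestFunction fun x => mollify n h x * φ x := ⟨hs.mul hφ.1, hφ.2.mul_left⟩
    have h1 := hdf _ hψ
    have h2 : ∫ x, f x * partialDeriv i (fun x => mollify n h x * φ x) x =
        (∫ x, (f x * partialDeriv i φ x) * mollify n h x) +
          ∫ x, (f x * φ x) * mollify n h' x := by
      rw [← integral_add (integrable_mul_mollify hfdφ hh n) (integrable_mul_mollify hfφ hh' n)]
      refine integral_congr_ae ?_
      filter_upwards [partialDeriv_mollify n hh hh' hdh] with x hx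
      rw [partialDeriv_mul (hs.differentiable (by simp)) (hφ.1.differentiable (by simp)), hx]
      ring
    have h3 : ∫ x, f' x * (mollify n h x * φ x) = ∫ x, (f' x * φ x) * mollify n h x :=
      integral_congr_ae (Eventually.of_forall fun x => by simp only; ring)
    rw [h2, h3] at h1
    linarith
  have hL := tendsto_integral_mul_mollify hfdφ hh
  have hR := ((tendsto_integral_mul_mollify hf'φ hh).add
    (tendsto_integral_mul_mollify hfφ hh')).neg
  have hlim := tendsto_nhds_unique (hL.congr key) hR
  have hbd : ∀ {u k : E N → ℝ}, Integrable u → MemLp k ⊤ → Integrable fun x => u x * k x :=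
    fun {u k} hu hk => hu.mul_of_top_left hk
  calc ∫ x, f x * h x * partialDeriv i φ x = ∫ x, (f x * partialDeriv i φ x) * h x :=
        integral_congr_ae (Eventually.of_forall fun x => by simp only; ring)
    _ = _ := hlim
    _ = _ := by
        rw [← integral_add (hbd hf'φ hh) (hbd hfφ hh')]
        congr 1
        exact integral_congr_ae (Eventually.of_forall fun x => by simp only; ring)

/-! ### Bounds on weak derivatives up to a given order -/

/-- All weak derivatives of `f` of order at most `n` are in `L^p` with norm at most `A`. -/
def SobBound (n : ℕ) (f : LpE N p) (A : ℝ) : Prop :=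
  ∀ γ : Fin N → ℕ, ∑ i, γ i ≤ n → ∃ h : LpE N p, HasWeakDeriv γ f h ∧ ‖h‖ ≤ A

theorem SobBound.mono {m n : ℕ} {f : LpE N p} {A : ℝ} (h : SobBound n f A) (hmn : m ≤ n) :
    SobBound m f A :=
  fun γ hγ => h γ (hγ.trans hmn)

theorem SobBound.mono_right {n : ℕ} {f : LpE N p} {A B : ℝ} (h : SobBound n f A) (hAB : A ≤ B) :
    SobBound n f B := fun γ hγ =>
  let ⟨g, hg, hgA⟩ := h γ hγ
  ⟨g, hg, hgA.trans hAB⟩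

theorem sobBound_zero {f : LpE N p} {A : ℝ} (h : ‖f‖ ≤ A) : SobBound 0 f A := by
  intro γ hγ
  have : γ = 0 := by
    funext i
    exact Nat.le_zero.1 ((Finset.single_le_sum (fun j _ => Nat.zero_le (γ j))
      (Finset.mem_univ i)).trans hγ)
  subst this
  exact ⟨f, hasWeakDeriv_zero f, h⟩

theorem SobBound.exists_deriv {n : ℕ} {f : LpE N p} {A : ℝ} (h : SobBound (n + 1) f A)
    (i : Fin N) : ∃ g : LpE N p, HasWeakDeriv (Pi.single i 1) f g ∧ SobBound n g A := by
  obtain ⟨g, hg, -⟩ := h (Pi.single i 1) (by rw [sum_single_one]; omega)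
  refine ⟨g, hg, fun γ hγ => ?_⟩
  obtain ⟨k, hk, hkA⟩ := h (γ + Pi.single i 1) (by rw [sum_add_single]; omega)
  exact ⟨k, hk.of_add_single hg, hkA⟩

/-- With `SobBound.exists_deriv` this describes order n + 1 recursively through first derivatives,
so product estimates need no multi-index Leibniz formula. -/
theorem sobBound_succ {n : ℕ} {f : LpE N p} {A : ℝ} (h0 : ‖f‖ ≤ A)
    (h : ∀ i, ∃ g : LpE N p, HasWeakDeriv (Pi.single i 1) f g ∧ SobBound n g A) :
    SobBound (n + 1) f A := by
  intro γ hγ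
  rcases eq_or_ne γ 0 with rfl | hγ0
  · exact ⟨f, hasWeakDeriv_zero f, h0⟩
  · obtain ⟨γ', i, rfl⟩ := exists_eq_add_single hγ0
    rw [sum_add_single] at hγ
    obtain ⟨g, hg, hgA⟩ := h i
    obtain ⟨k, hk, hkA⟩ := hgA γ' (by omega)
    exact ⟨k, hk.add_single hg, hkA⟩

variable [hp : Fact (1 ≤ p)]

theorem LpE.locallyIntegrable (f : LpE N p) : LocallyIntegrable f :=
  (Lp.memLp f).locallyIntegrable hp.out

theorem HasWeakDeriv.uniqueLp {γ : Fin N → ℕ} {f g g' : LpE N p} (h : HasWeakDeriv γ f g)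
    (h' : HasWeakDeriv γ f g') : g = g' :=
  Lp.ext (h.unique h' (LpE.locallyIntegrable g) (LpE.locallyIntegrable g'))

theorem SobBound.norm_le {n : ℕ} {f : LpE N p} {A : ℝ} (h : SobBound n f A) : ‖f‖ ≤ A := by
  obtain ⟨g, hg, hgA⟩ := h 0 (by simp)
  rwa [hg.uniqueLp (hasWeakDeriv_zero f)] at hgA

theorem SobBound.add {n : ℕ} {f g : LpE N p} {A B : ℝ} (hf : SobBound n f A)
    (hg : SobBound n g B) : SobBound n (f + g) (A + B) := by
  intro γ hγ
  obtain ⟨k, hk, hkA⟩ := hf γ hγ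
  obtain ⟨l, hl, hlB⟩ := hg γ hγ
  exact ⟨k + l, hk.add hl, (norm_add_le _ _).trans (add_le_add hkA hlB)⟩

theorem hasWeakDeriv_convL {γ : Fin N → ℕ} (k : LpE N 1) {f g : LpE N p}
    (h : HasWeakDeriv γ f g) : HasWeakDeriv γ (convL p k f) (convL p k g) :=
  (h.conv_memLp hp.out (Lp.memLp k) (Lp.memLp f) (Lp.memLp g)).congr
    (coeFn_convL p k f).symm (coeFn_convL p k g).symm

theorem SobBound.convL {n : ℕ} {f : LpE N p} {A : ℝ} (hf : SobBound n f A) (k : LpE N 1) :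
    SobBound n (convL p k f) (‖k‖ * A) := by
  intro γ hγ
  obtain ⟨g, hg, hgA⟩ := hf γ hγ
  refine ⟨AggDiff.convL p k g, hasWeakDeriv_convL k hg, (norm_convL_le p k g).trans ?_⟩
  gcongr

/-! ### Sobolev estimates for the nonlinearity -/

section Product

variable {q : ℝ≥0∞} {K : E N → ℝ}

theorem memLp_top_conv (hpq : 1 / p + 1 / q = 1) (hK : MemLp K q) (g : LpE N p) : MemLp (conv K g) ⊤ :=
  memLp_top_of_bound (aestronglyMeasurable_conv hK.1 (Lp.memLp g).1) _
    (Eventually.of_forall (abs_conv_le_of_conj hpq hK g))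

variable (hpq : 1 / p + 1 / q = 1) (hK : MemLp K q)

theorem hasWeakDeriv_mulConvL {i : Fin N} {f f' g g' : LpE N p}
    (hf : HasWeakDeriv (Pi.single i 1) f f') (hg : HasWeakDeriv (Pi.single i 1) g g') :
    HasWeakDeriv (Pi.single i 1) (mulConvL hpq hK f g)
      (mulConvL hpq hK f' g + mulConvL hpq hK f g' : LpE N p) := by
  have h := HasWeakDeriv.mul (LpE.locallyIntegrable f) (LpE.locallyIntegrable f')
    (memLp_top_conv hpq hK g) (memLp_top_conv hpq hK g') hf
    (hg.conv_conj hpq hK (Lp.memLp g) (Lp.memLp g'))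
  refine h.congr (coeFn_mulConvL hpq hK f g).symm ?_
  filter_upwards [coeFn_mulConvL hpq hK f' g, coeFn_mulConvL hpq hK f g',
    Lp.coeFn_add (mulConvL hpq hK f' g) (mulConvL hpq hK f g')] with x h1 h2 h3
  rw [h3, Pi.add_apply, h1, h2]

/-- Each differentiation replaces the product by two products of the same kind, so the constant
doubles with every order. -/
theorem SobBound.mulConvL {n : ℕ} {f g : LpE N p} {A B : ℝ} (hf : SobBound n f A)
    (hg : SobBound n g B) :
    SobBound n (mulConvL hpq hK f g) (2 ^ n * (eLpNorm K q volume).toReal * A * B) := by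
  set κ := (eLpNorm K q volume).toReal with hκ
  have hκ0 : 0 ≤ κ := ENNReal.toReal_nonneg
  have hA := (norm_nonneg _).trans hf.norm_le
  have hB := (norm_nonneg _).trans hg.norm_le
  have h0 : ‖AggDiff.mulConvL hpq hK f g‖ ≤ κ * A * B := by
    refine (norm_mulConvL_le hpq hK f g).trans ?_
    have h1 := hf.norm_le
    have h2 := hg.norm_le
    gcongr
  induction n generalizing f g with
  | zero =>
    refine sobBound_zero (h0.trans (le_of_eq ?_))
    ring
  | succ n ih =>
    refine sobBound_succ (h0.trans ?_) fun i => ?_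
    · have : (1 : ℝ) ≤ 2 ^ (n + 1) := one_le_pow₀ one_le_two
      calc κ * A * B = 1 * (κ * A * B) := (one_mul _).symm
        _ ≤ 2 ^ (n + 1) * (κ * A * B) := by gcongr
        _ = _ := by ring
    · obtain ⟨f', hf', hfA⟩ := hf.exists_deriv i
      obtain ⟨g', hg', hgB⟩ := hg.exists_deriv i
      refine ⟨_, hasWeakDeriv_mulConvL hpq hK hf' hg', ?_⟩
      have h1 := ih hfA (hg.mono (Nat.le_succ n)) ((norm_mulConvL_le hpq hK f' g).trans (by
        have h1 := hfA.norm_le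
        have h2 := hg.norm_le
        gcongr))
      have h2 := ih (hf.mono (Nat.le_succ n)) hgB ((norm_mulConvL_le hpq hK f g').trans (by
        have h1 := hf.norm_le
        have h2 := hgB.norm_le
        gcongr))
      refine (h1.add h2).mono_right (le_of_eq ?_)
      ring

/-- The estimate that is linear in the derivatives of highest order. -/
theorem SobBound.mulConvL_self {n : ℕ} {f : LpE N p} {A A' : ℝ} (hf : SobBound n f A)
    (hf' : SobBound (n + 1) f A') :
    SobBound (n + 1) (AggDiff.mulConvL hpq hK f f)
      (2 ^ (n + 1) * (eLpNorm K q volume).toReal * A * A') := by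
  set κ := (eLpNorm K q volume).toReal with hκ
  have hκ0 : 0 ≤ κ := ENNReal.toReal_nonneg
  have hA := (norm_nonneg _).trans hf.norm_le
  have hA' := (norm_nonneg _).trans hf'.norm_le
  refine sobBound_succ ?_ fun i => ?_
  · have : (1 : ℝ) ≤ 2 ^ (n + 1) := one_le_pow₀ one_le_two
    have h1 := hf.norm_le
    have h2 := hf'.norm_le
    calc _ ≤ κ * ‖f‖ * ‖f‖ := norm_mulConvL_le hpq hK f f
      _ ≤ κ * A * A' := by gcongr
      _ = 1 * (κ * A * A') := (one_mul _).symm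
      _ ≤ 2 ^ (n + 1) * (κ * A * A') := by gcongr
      _ = _ := by ring
  -- In ∂_i(f (K * f)) = g (K * f) + f (K * g) each term contains g once, with bound A' up to order
  -- n, next to f with bound A up to order n. This keeps the estimate linear in A'.
  · obtain ⟨g, hg, hgA⟩ := hf'.exists_deriv i
    refine ⟨_, hasWeakDeriv_mulConvL hpq hK hg hg, ?_⟩
    refine ((hgA.mulConvL hpq hK hf).add (hf.mulConvL hpq hK hgA)).mono_right (le_of_eq ?_)
    ring

end Product

end

section

/-! ### Sobolev spaces -/

section Lift

variable {X Y M : Type*} [NormedAddCommGroup X] [NormedSpace ℝ X] [NormedAddCommGroup Y]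
  [NormedSpace ℝ Y] [NormedAddCommGroup M] [NormedSpace ℝ M]

/-- A bounded map which becomes bilinear after composition with a linear injection is a bounded
bilinear map. -/
theorem exists_bilinear_of_injective {W : Type*} [AddCommGroup W] [Module ℝ W] (ι : M →ₗ[ℝ] W)
    (hι : Function.Injective ι) (f : X → Y → M) (b : X →ₗ[ℝ] Y →ₗ[ℝ] W)
    (hf : ∀ x y, ι (f x y) = b x y) (C : ℝ) (hC : ∀ x y, ‖f x y‖ ≤ C * ‖x‖ * ‖y‖) :
    ∃ B : X →L[ℝ] Y →L[ℝ] M, ∀ x y, B x y = f x y :=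
  ⟨LinearMap.mkContinuous₂ (LinearMap.mk₂ ℝ f
    (fun x x' y => hι (by simp [hf])) (fun c x y => hι (by simp [hf]))
    (fun x y y' => hι (by simp [hf])) (fun c x y => hι (by simp [hf]))) C hC, fun _ _ => rfl⟩

/-- A pair of bounded bilinear maps with values in a subspace of the product. -/
theorem exists_bilinear_prod {M' : Type*} [NormedAddCommGroup M'] [NormedSpace ℝ M']
    (S : Submodule ℝ (M × M')) (b : X →L[ℝ] Y →L[ℝ] M) (b' : X →L[ℝ] Y →L[ℝ] M')
    (h : ∀ x y, (b x y, b' x y) ∈ S) :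
    ∃ B : X →L[ℝ] Y →L[ℝ] S, ∀ x y, (B x y : M × M') = (b x y, b' x y) := by
  obtain ⟨B, hB⟩ := exists_bilinear_of_injective S.subtype S.injective_subtype
    (fun x y => ⟨(b x y, b' x y), h x y⟩)
    (LinearMap.mk₂ ℝ (fun x y => (b x y, b' x y)) (by simp) (by simp) (by simp) (by simp))
    (fun _ _ => rfl) (‖b‖ + ‖b'‖) (fun x y => by
      refine max_le ?_ ?_
      · refine (b.le_opNorm₂ x y).trans ?_
        gcongr
        exact le_add_of_nonneg_right b'.opNorm_nonneg
      · refine (b'.le_opNorm₂ x y).trans ?_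
        gcongr
        exact le_add_of_nonneg_left b.opNorm_nonneg)
  exact ⟨B, fun x y => by rw [hB]⟩

end Lift

variable {N m : ℕ} {p : ℝ≥0∞} [hp : Fact (1 ≤ p)]

namespace Sobolev

/-- The component `∂^γ u`. -/
def comp (γ : multiIndices N m) : Sobolev N m p →L[ℝ] LpE N p :=
  (PiLp.proj p (fun _ : multiIndices N m => LpE N p) γ).comp (sobolevSubmodule N m p).subtypeL

/-- The inclusion `W^{m,p} → L^p`. -/
def toLpL : Sobolev N m p →L[ℝ] LpE N p := comp (zeroIndex N m)

theorem toLp_add (u v : Sobolev N m p) : (u + v).toLp = u.toLp + v.toLp := toLpL.map_add u v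

theorem toLp_sum {ι : Type*} (s : Finset ι) (f : ι → Sobolev N m p) :
    (∑ i ∈ s, f i).toLp = ∑ i ∈ s, (f i).toLp := map_sum toLpL f s

theorem toLp_integral {f : ℝ → Sobolev N m p} {s : Set ℝ} (hf : IntegrableOn f s)
    [CompleteSpace (Sobolev N m p)] : ∫ t in s, (f t).toLp = (∫ t in s, f t).toLp :=
  toLpL.integral_comp_comm hf

theorem hasWeakDeriv (u : Sobolev N m p) (γ : multiIndices N m) :
    HasWeakDeriv γ.1 u.toLp (comp γ u) := u.2 γ

theorem norm_comp_le (u : Sobolev N m p) (γ : multiIndices N m) : ‖comp γ u‖ ≤ ‖u‖ :=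
  PiLp.norm_apply_le u.1 γ

theorem norm_toLp_le (u : Sobolev N m p) : ‖u.toLp‖ ≤ ‖u‖ := norm_comp_le u _

theorem ext_toLp {u v : Sobolev N m p} (h : u.toLp = v.toLp) : u = v := by
  refine Subtype.ext (PiLp.ext fun γ => ?_)
  have hu := u.hasWeakDeriv γ
  rw [h] at hu
  exact hu.uniqueLp (v.hasWeakDeriv γ)

theorem toLpL_injective : Function.Injective (toLpL : Sobolev N m p →L[ℝ] LpE N p) :=
  fun _ _ h => ext_toLp h

theorem sobBound (u : Sobolev N m p) {n : ℕ} (hn : n ≤ m) {A : ℝ}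
    (h : ∀ γ : multiIndices N m, ∑ i, γ.1 i ≤ n → ‖comp γ u‖ ≤ A) : SobBound n u.toLp A :=
  fun γ hγ =>
  let γ' : multiIndices N m := ⟨γ, mem_multiIndices.2 (hγ.trans hn)⟩
  ⟨comp γ' u, u.hasWeakDeriv γ', h γ' hγ⟩

theorem sobBound_norm (u : Sobolev N m p) : SobBound m u.toLp ‖u‖ :=
  u.sobBound le_rfl fun γ _ => u.norm_comp_le γ

theorem norm_comp_le_of_sobBound {u : Sobolev N m p} {n : ℕ} {A : ℝ} (h : SobBound n u.toLp A)
    (γ : multiIndices N m) (hγ : ∑ i, γ.1 i ≤ n) : ‖comp γ u‖ ≤ A := by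
  obtain ⟨g, hg, hgA⟩ := h γ.1 hγ
  rwa [(u.hasWeakDeriv γ).uniqueLp hg]

theorem exists_of_sobBound {f : LpE N p} {A : ℝ} (h : SobBound m f A) :
    ∃ u : Sobolev N m p, u.toLp = f := by
  choose g hg _ using h
  set v : PiLp p (fun _ : multiIndices N m => LpE N p) :=
    WithLp.toLp p fun γ => g γ.1 (mem_multiIndices.1 γ.2) with hv
  have h0 : v (zeroIndex N m) = f :=
    (hg 0 (by simp)).uniqueLp (hasWeakDeriv_zero f)
  refine ⟨⟨v, fun γ => ?_⟩, h0⟩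
  rw [h0]
  exact hg γ.1 _

/-- There are finitely many multi-indices, so the ℓ^p-sum norm is equivalent to the maximum of the
component norms. -/
theorem exists_norm_le (N m : ℕ) (p : ℝ≥0∞) [Fact (1 ≤ p)] : ∃ C : ℝ, 0 ≤ C ∧
    ∀ (u : Sobolev N m p) (A : ℝ), SobBound m u.toLp A → ‖u‖ ≤ C * A := by
  set e := (PiLp.continuousLinearEquiv p ℝ (fun _ : multiIndices N m => LpE N p)).symm with he
  refine ⟨‖e.toContinuousLinearMap‖, norm_nonneg _, fun u A hA => ?_⟩
  have h1 : u.1 = e.toContinuousLinearMap (fun γ => comp γ u) := rfl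
  have h2 : ‖u‖ = ‖u.1‖ := rfl
  rw [h2, h1]
  refine ContinuousLinearMap.le_opNorm_of_le _ ?_
  rw [pi_norm_le_iff_of_nonneg ((norm_nonneg _).trans hA.norm_le)]
  exact fun γ => norm_comp_le_of_sobBound hA γ (mem_multiIndices.1 γ.2)

/-- Each test function imposes an equation between continuous functionals on the components. -/
theorem isClosed_sobolevSubmodule :
    IsClosed (sobolevSubmodule N m p : Set (PiLp p fun _ : multiIndices N m => LpE N p)) := by
  have h : (sobolevSubmodule N m p : Set (PiLp p fun _ : multiIndices N m => LpE N p)) =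
      ⋂ (γ : multiIndices N m) (φ : {φ : E N → ℝ // IsTestFunction φ}),
        {u | ∫ x, u (zeroIndex N m) x * multiDeriv γ.1 φ.1 x =
          (-1) ^ (∑ i, γ.1 i) * ∫ x, u γ x * φ.1 x} := by
    ext u
    simp only [Set.mem_iInter, Set.mem_ofPred_eq, Subtype.forall]
    exact ⟨fun h γ hγ φ hφ => h ⟨γ, hγ⟩ φ hφ, fun h γ φ hφ => h γ.1 γ.2 φ hφ⟩
  rw [h]
  refine isClosed_iInter fun γ => isClosed_iInter fun φ => ?_
  obtain ⟨ℓ, hℓ⟩ := exists_pairing (p := p) φ.2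
  obtain ⟨ℓ', hℓ'⟩ := exists_pairing (p := p) (φ.2.multiDeriv γ.1)
  simp_rw [← hℓ, ← hℓ']
  refine isClosed_eq ?_ ?_
  · exact ℓ'.continuous.comp (PiLp.proj (𝕜 := ℝ) p (fun _ : multiIndices N m => LpE N p) _).continuous
  · exact continuous_const.mul
      (ℓ.continuous.comp (PiLp.proj (𝕜 := ℝ) p (fun _ : multiIndices N m => LpE N p) γ).continuous)

instance : CompleteSpace (Sobolev N m p) := isClosed_sobolevSubmodule.completeSpace_coe

/-- Lifts an operator from L^p to W^{m,p}: bilinearity is inherited because the inclusion in L^p is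
injective, and the weak-derivative bounds give continuity. -/
theorem exists_bilinear {X Y : Type*} [NormedAddCommGroup X] [NormedSpace ℝ X]
    [NormedAddCommGroup Y] [NormedSpace ℝ Y] (b : X →L[ℝ] Y →L[ℝ] LpE N p) (C : ℝ)
    (h : ∀ x y, SobBound m (b x y) (C * ‖x‖ * ‖y‖)) :
    ∃ B : X →L[ℝ] Y →L[ℝ] Sobolev N m p, ∀ x y, (B x y).toLp = b x y := by
  obtain ⟨D, hD0, hD⟩ := exists_norm_le N m p
  choose f hf using fun x y => exists_of_sobBound (h x y)
  obtain ⟨B, hB⟩ := exists_bilinear_of_injective (M := Sobolev N m p)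
    (toLpL : Sobolev N m p →L[ℝ] LpE N p).toLinearMap toLpL_injective f
    (LinearMap.mk₂ ℝ (fun x y => b x y) (by simp) (by simp) (by simp)
      (by simp)) hf (D * C) (fun x y => by
      refine (hD (f x y) (C * ‖x‖ * ‖y‖) (by rw [hf]; exact h x y)).trans (le_of_eq ?_)
      ring)
  exact ⟨B, fun x y => by rw [hB, hf]⟩

end Sobolev

/-! ### Function spaces with bounded convolution operators -/

/-- A Banach space of functions on which `L^1` acts by convolution and on which the bilinear maps
`(f, g) ↦ f (K_i * g)` are bounded. -/
structure ConvSpace (K : Fin N → E N → ℝ) (V : Type*) [NormedAddCommGroup V] [NormedSpace ℝ V] where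
  fn : V → E N → ℝ
  inj : ∀ u v, fn u =ᵐ[volume] fn v → u = v
  memLp : ∃ r : ℝ≥0∞, 1 ≤ r ∧ ∀ v, MemLp (fn v) r
  J : LpE N 1 →L[ℝ] V →L[ℝ] V
  Q : Fin N → V →L[ℝ] V →L[ℝ] V
  fn_J : ∀ k v, fn (J k v) =ᵐ[volume] conv k (fn v)
  fn_Q : ∀ i v w, fn (Q i v w) =ᵐ[volume] fun x => fn v x * conv (K i) (fn w) x

namespace ConvSpace

variable {K : Fin N → E N → ℝ} {V : Type*} [NormedAddCommGroup V] [NormedSpace ℝ V]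
  (H : ConvSpace K V)

theorem J_J (k l : LpE N 1) (v : V) : H.J k (H.J l v) = H.J (convL 1 k l) v := by
  obtain ⟨r, hr, hmem⟩ := H.memLp
  refine H.inj _ _ ?_
  refine (H.fn_J _ _).trans (.trans ?_ (H.fn_J _ _).symm)
  rw [conv_congr .rfl (H.fn_J l v), conv_congr (coeFn_convL 1 k l) .rfl]
  exact (conv_assoc hr (Lp.memLp k) (Lp.memLp l) (hmem v)).symm

/-- `∇ e^{tΔ} · (v (K * w))`. -/
def gradTerm (t : ℝ) : V →L[ℝ] V →L[ℝ] V :=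
  ∑ i, (ContinuousLinearMap.compL ℝ V V V (H.J (gradHeatL i t))).comp (H.Q i)

theorem gradTerm_apply (t : ℝ) (v w : V) :
    H.gradTerm t v w = ∑ i, H.J (gradHeatL i t) (H.Q i v w) := by
  simp [gradTerm]

theorem norm_J_gradHeatL_le (i : Fin N) {t : ℝ} (ht : 0 < t) :
    ‖H.J (gradHeatL i t)‖ ≤ ‖H.J‖ * 2 ^ ((N : ℝ) / 2) * t ^ (-(1 / 2) : ℝ) := by
  rw [mul_assoc]
  exact H.J.le_opNorm_of_le (norm_gradHeatL_le i ht)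

theorem norm_gradTerm_le {t : ℝ} (ht : 0 < t) : ‖H.gradTerm t‖ ≤
    (∑ i, ‖H.J‖ * 2 ^ ((N : ℝ) / 2) * ‖H.Q i‖) * t ^ (-(1 / 2) : ℝ) := by
  refine ContinuousLinearMap.opNorm_le_bound₂ _ (by positivity) fun v w => ?_
  rw [gradTerm_apply, Finset.sum_mul, Finset.sum_mul, Finset.sum_mul]
  refine (norm_sum_le _ _).trans (Finset.sum_le_sum fun i _ => ?_)
  calc ‖H.J (gradHeatL i t) (H.Q i v w)‖
      ≤ (‖H.J‖ * 2 ^ ((N : ℝ) / 2) * t ^ (-(1 / 2) : ℝ)) * (‖H.Q i‖ * ‖v‖ * ‖w‖) :=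
        (H.J (gradHeatL i t)).le_of_opNorm_le_of_le (H.norm_J_gradHeatL_le i ht)
          ((H.Q i).le_opNorm₂ v w)
    _ = _ := by ring

theorem continuousOn_gradTerm : ContinuousOn H.gradTerm (Set.Ioi 0) := by
  unfold gradTerm
  refine continuousOn_finsetSum _ fun i _ => ?_
  have h1 : ContinuousOn (fun t => H.J (gradHeatL i t)) (Set.Ioi 0) :=
    H.J.continuous.comp_continuousOn (continuousOn_gradHeatL i)
  exact ((ContinuousLinearMap.compL ℝ V V V).continuous.comp_continuousOn h1).clm_comp
    continuousOn_const

/-- The mild formulation of the equation in `V`. -/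
def mildSystem : MildSystem V where
  S t := H.J (heatL N t)
  P := H.gradTerm
  cS := ‖H.J‖
  cP := ∑ i, ‖H.J‖ * 2 ^ ((N : ℝ) / 2) * ‖H.Q i‖
  norm_S_le t ht := by simpa [norm_heatL ht] using H.J.le_opNorm (heatL N t)
  norm_P_le _ ht := H.norm_gradTerm_le ht
  continuousOn_S := H.J.continuous.comp_continuousOn continuousOn_heatL
  continuousOn_P := H.continuousOn_gradTerm
  S_S s t v hs ht := by rw [H.J_J, convL_heatL_heatL hs ht]
  S_P s t v w hs ht := by
    rw [gradTerm_apply, gradTerm_apply, map_sum]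
    refine Finset.sum_congr rfl fun i _ => ?_
    rw [H.J_J, convL_heatL_gradHeatL i hs ht]

theorem mildSystem_P : H.mildSystem.P = H.gradTerm := rfl

end ConvSpace

/-- `W^{m,p}` for `K ∈ L^q`, with conjugate exponents `p`, `q`. -/
theorem exists_convSpace_sobolev {q : ℝ≥0∞} {K : Fin N → E N → ℝ} (hpq : 1 / p + 1 / q = 1)
    (hK : ∀ i, MemLp (K i) q) :
    ∃ H : ConvSpace K (Sobolev N m p), ∀ u, H.fn u = u.toLp := by
  have hJ : ∃ J : LpE N 1 →L[ℝ] Sobolev N m p →L[ℝ] Sobolev N m p,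
      ∀ k u, (J k u).toLp = convL p k u.toLp := by
    refine Sobolev.exists_bilinear ((convL p).bilinearComp (.id ℝ _) Sobolev.toLpL) 1
      fun k u => ?_
    rw [one_mul]
    exact u.sobBound_norm.convL k
  have hQ : ∀ i, ∃ Q : Sobolev N m p →L[ℝ] Sobolev N m p →L[ℝ] Sobolev N m p,
      ∀ u v, (Q u v).toLp = mulConvL hpq (hK i) u.toLp v.toLp := fun i =>
    Sobolev.exists_bilinear ((mulConvL hpq (hK i)).bilinearComp Sobolev.toLpL Sobolev.toLpL) _
      fun u v => u.sobBound_norm.mulConvL hpq (hK i) v.sobBound_norm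
  obtain ⟨J, hJ⟩ := hJ
  choose Q hQ using hQ
  refine ⟨⟨fun u => u.toLp, fun u v h => Sobolev.ext_toLp (Lp.ext h),
    ⟨p, hp.out, fun v => Lp.memLp v.toLp⟩, J, Q, fun k v => ?_, fun i v w => ?_⟩, fun _ => rfl⟩
  · rw [hJ]
    exact coeFn_convL p k v.toLp
  · rw [hQ]
    exact coeFn_mulConvL hpq (hK i) v.toLp w.toLp

end

section

variable {N m : ℕ} {p : ℝ≥0∞} [hp : Fact (1 ≤ p)] {K : Fin N → E N → ℝ}

/-! ### Mild solutions in Sobolev spaces -/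

section Mild

variable {H : ConvSpace K (Sobolev N m p)} (hH : ∀ u, H.fn u = u.toLp)

include hH

theorem toLp_J (k : LpE N 1) (u : Sobolev N m p) : (H.J k u).toLp = convL p k u.toLp := by
  have h := H.fn_J k u
  rw [hH, hH] at h
  exact Lp.ext (h.trans (coeFn_convL p k u.toLp).symm)

theorem toLp_Q (i : Fin N) (u v : Sobolev N m p) :
    (H.Q i u v).toLp =ᵐ[volume] fun x => u.toLp x * conv (K i) v.toLp x := by
  simpa only [hH] using H.fn_Q i u v

theorem toLp_gradTerm (t : ℝ) (u v : Sobolev N m p) :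
    (H.gradTerm t u v).toLp = ∑ i, convL p (gradHeatL i t) (H.Q i u v).toLp := by
  rw [H.gradTerm_apply, Sobolev.toLp_sum]
  exact Finset.sum_congr rfl fun i _ => toLp_J hH (gradHeatL i t) (H.Q i u v)

theorem coeFn_gradTerm {t : ℝ} (ht : 0 < t) (u : Sobolev N m p) :
    (H.gradTerm t u u).toLp =ᵐ[volume] duhamelTerm K t u.toLp := by
  rw [toLp_gradTerm hH]
  refine (Lp.coeFn_finsetSum _ _).trans ?_
  have h : ∀ i, convL p (gradHeatL i t) (H.Q i u u).toLp =ᵐ[volume]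
      conv (partialDeriv i (heatKernel N t)) (fun y => u.toLp y * conv (K i) u.toLp y) := by
    intro i
    refine (coeFn_convL p _ _).trans ?_
    rw [conv_congr (coeFn_gradHeatL i ht) (toLp_Q hH i u u)]
  filter_upwards [ae_all_iff.2 h] with x hx
  rw [Finset.sum_apply]
  exact Finset.sum_congr rfl fun i _ => hx i

theorem coeFn_S {t : ℝ} (ht : 0 < t) (u : Sobolev N m p) :
    (H.mildSystem.S t u).toLp =ᵐ[volume] heatFlow t u.toLp := by
  have h : (H.mildSystem.S t u).toLp = convL p (heatL N t) u.toLp := toLp_J hH _ _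
  rw [h]
  refine (coeFn_convL p _ _).trans ?_
  rw [conv_congr (coeFn_heatL ht) .rfl]
  rfl

/-- Convolution commutes with weak derivatives, which reduces convergence of the heat flow in
W^{m,p} to convergence in L^p for each component. -/
theorem comp_J (k : LpE N 1) (u : Sobolev N m p) (γ : multiIndices N m) :
    Sobolev.comp γ (H.J k u) = convL p k (Sobolev.comp γ u) := by
  have h1 := (H.J k u).hasWeakDeriv γ
  rw [toLp_J hH] at h1
  exact h1.uniqueLp (hasWeakDeriv_convL k (u.hasWeakDeriv γ))

/-- `e^{tΔ} u → u` in `W^{m,p}` for `p < ∞`. -/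
theorem tendsto_S (hp' : p ≠ ⊤) (u : Sobolev N m p) :
    Tendsto (fun t => H.mildSystem.S t u) (𝓝[>] 0) (𝓝 u) := by
  obtain ⟨C, hC0, hC⟩ := Sobolev.exists_norm_le N m p
  rw [tendsto_iff_norm_sub_tendsto_zero]
  have hlim : Tendsto (fun t => C * ∑ γ : multiIndices N m,
      ‖convL p (heatL N t) (Sobolev.comp γ u) - Sobolev.comp γ u‖) (𝓝[>] 0) (𝓝 0) := by
    have h1 := (tendsto_finsetSum (Finset.univ : Finset (multiIndices N m)) fun γ _ =>
      tendsto_iff_norm_sub_tendsto_zero.1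
        (tendsto_convL_heatL hp' (Sobolev.comp γ u))).const_mul C
    simpa using h1
  refine squeeze_zero (fun _ => norm_nonneg _) (fun t => ?_) hlim
  refine hC _ _ (Sobolev.sobBound _ le_rfl fun γ _ => ?_)
  have h2 : Sobolev.comp γ (H.mildSystem.S t u - u) =
      convL p (heatL N t) (Sobolev.comp γ u) - Sobolev.comp γ u := by
    rw [map_sub]
    congr 1
    exact comp_J hH _ _ _
  rw [h2]
  exact Finset.single_le_sum (f := fun γ : multiIndices N m =>
    ‖convL p (heatL N t) (Sobolev.comp γ u) - Sobolev.comp γ u‖)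
    (fun _ _ => norm_nonneg _) (Finset.mem_univ γ)

/-- The curve `u` on `(0,∞)` with initial value `z₀`. -/
def withInitial {V : Type*} (z₀ : V) (u : ℝ → V) (t : ℝ) : V := if t ≤ 0 then z₀ else u t

omit hH in
theorem withInitial_of_pos {V : Type*} (z₀ : V) (u : ℝ → V) {t : ℝ} (ht : 0 < t) :
    withInitial z₀ u t = u t := if_neg ht.not_ge

omit hH in
theorem withInitial_zero {V : Type*} (z₀ : V) (u : ℝ → V) : withInitial z₀ u 0 = z₀ :=
  if_pos le_rfl

variable {T : EReal} {ρ₀ : Sobolev N m p} {u : ℝ → Sobolev N m p}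

theorem tendsto_initial (hT : 0 < T) (hu : H.mildSystem.IsSol id ρ₀ T u) (hp' : p ≠ ⊤) :
    Tendsto u (𝓝[>] 0) (𝓝 ρ₀) := by
  have h := (hu.tendsto_zero (fun _ => le_rfl) hT).add (tendsto_S hH hp' ρ₀)
  simpa using h

theorem inSolutionClass_of_isSol (hT : 0 < T) (hu : H.mildSystem.IsSol id ρ₀ T u) :
    InSolutionClass T (withInitial ρ₀ u) := by
  have hIoo : ContinuousOn (withInitial ρ₀ u) {t : ℝ | 0 < t ∧ (t : EReal) < T} :=
    hu.continuousOn.congr fun t ht => withInitial_of_pos ρ₀ u ht.1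
  refine ⟨fun hp' t ht => ?_, hIoo, fun T' hT' => ?_⟩
  · rcases ht.1.eq_or_lt with h0 | h0
    · subst h0
      have h1 : Tendsto (withInitial ρ₀ u) (𝓝[>] 0) (𝓝 (withInitial ρ₀ u 0)) := by
        rw [withInitial_zero]
        refine (tendsto_initial hH hT hu hp').congr' ?_
        filter_upwards [self_mem_nhdsWithin] with t ht
        exact (withInitial_of_pos ρ₀ u ht).symm
      have h2 : ContinuousWithinAt (withInitial ρ₀ u) (Set.Ici 0) 0 :=
        continuousWithinAt_Ioi_iff_Ici.1 h1
      exact h2.mono fun t ht => ht.1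
    · exact (hIoo.continuousAt ((MildSystem.isOpen_Ioo_EReal T).mem_nhds
        ⟨h0, ht.2⟩)).continuousWithinAt
  · obtain ⟨C, hC⟩ := hu.bounded T' hT'
    refine ⟨max C ‖ρ₀‖, fun t ht => ?_⟩
    rcases ht.1.eq_or_lt with h0 | h0
    · subst h0
      rw [withInitial_zero]
      exact le_max_right _ _
    · rw [withInitial_of_pos ρ₀ u h0]
      exact (hC t ⟨h0, ht.2⟩).trans (le_max_left _ _)

theorem attainsData_of_isSol (hT : 0 < T) (hu : H.mildSystem.IsSol id ρ₀ T u) :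
    AttainsData ρ₀ (withInitial ρ₀ u) := by
  refine ⟨withInitial_zero ρ₀ u, fun t => H.mildSystem.S t ρ₀, fun t ht => coeFn_S hH ht ρ₀, ?_⟩
  refine (hu.tendsto_zero (fun _ => le_rfl) hT).congr' ?_
  filter_upwards [self_mem_nhdsWithin] with t ht
  rw [withInitial_of_pos ρ₀ u ht]

theorem isMildSolution_of_isSol (hu : H.mildSystem.IsSol id ρ₀ T u) :
    IsMildSolution K ρ₀.toLp T (fun t => (withInitial ρ₀ u t).toLp) := by
  refine ⟨fun t ht htT => ?_, fun t ht htT => ?_⟩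
  · obtain ⟨C, hC⟩ := hu.bounded t htT
    have hc : ContinuousOn (fun s => (withInitial ρ₀ u s).toLp) (Set.Ioc 0 t) := by
      refine (Sobolev.toLpL.continuous.comp_continuousOn (hu.continuousOn_Ioo htT)).congr
        fun s hs => ?_
      simp only [withInitial_of_pos ρ₀ u hs.1]
      rfl
    refine Integrable.mono' (g := fun _ => C) (integrableOn_const measure_Ioc_lt_top.ne)
      (hc.aestronglyMeasurable measurableSet_Ioc) ?_
    refine (ae_restrict_iff' measurableSet_Ioc).2 (Eventually.of_forall fun s hs => ?_)
    rw [withInitial_of_pos ρ₀ u hs.1]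
    exact (Sobolev.norm_toLp_le _).trans (hC s hs)
  · obtain ⟨C, hC⟩ := hu.bounded t htT
    have hint := H.mildSystem.integrableOn_integrand
      ((hu.continuousOn_Ioo htT).mono Set.Ioo_subset_Ioc_self)
      fun s hs => hC s ⟨hs.1, hs.2.le⟩
    refine ⟨fun s => (H.gradTerm (t - s) (u s) (u s)).toLp, ?_, ?_, ?_⟩
    · refine (ae_restrict_iff' measurableSet_Ioo).2 (Eventually.of_forall fun s hs => ?_)
      simp only [withInitial_of_pos ρ₀ u hs.1]
      exact coeFn_gradTerm hH (sub_pos.2 hs.2) (u s)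
    · exact Sobolev.toLpL.integrable_comp hint
    · have h1 : ∫ s in Set.Ioo 0 t, (H.gradTerm (t - s) (u s) (u s)).toLp =
          (H.mildSystem.duhamel u t).toLp := by
        exact Sobolev.toLp_integral hint
      have h2 : ((withInitial ρ₀ u t).toLp : E N → ℝ) =
          ((H.mildSystem.S t ρ₀).toLp + (H.mildSystem.duhamel u t).toLp : LpE N p) := by
        rw [withInitial_of_pos ρ₀ u ht, hu.eq t ht htT, Sobolev.toLp_add]
        simp only [id_eq]
      refine (EventuallyEq.of_eq h2).trans ((Lp.coeFn_add _ _).trans ?_)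
      exact (coeFn_S hH ht ρ₀).add (.of_eq (congrArg (fun f : LpE N p => (f : E N → ℝ)) h1.symm))

/-- The solution class makes the Duhamel integral exist already in W^{m,p}. Its image in L^p is the
given Bochner integral, and injectivity of the inclusion lifts the equation; so uniqueness of the
abstract system applies to every mild solution in the class. -/
theorem isSol_of_isMildSolution {σ : ℝ → Sobolev N m p} (hσ : InSolutionClass T σ)
    (hmild : IsMildSolution K ρ₀.toLp T (fun t => (σ t).toLp)) :
    H.mildSystem.IsSol id ρ₀ T σ := by
  refine ⟨hσ.continuousOn_Ioo, fun T' hT' => ?_, fun t ht htT => ?_⟩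
  · obtain ⟨C, hC⟩ := hσ.bounded T' hT'
    exact ⟨C, fun t ht => hC t ⟨ht.1.le, ht.2⟩⟩
  · obtain ⟨C, hC⟩ := hσ.bounded t htT
    have hint := H.mildSystem.integrableOn_integrand (g := σ) (t := t)
      (hσ.continuousOn_Ioo.mono fun s hs => ⟨hs.1, (EReal.coe_lt_coe_iff.2 hs.2).trans htT⟩)
      fun s hs => hC s ⟨hs.1.le, hs.2.le⟩
    obtain ⟨Φ, hΦ, -, heq⟩ := hmild.2 t ht htT
    have h1 : ∫ s in Set.Ioo 0 t, Φ s = (H.mildSystem.duhamel σ t).toLp := by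
      refine Eq.trans ?_ (Sobolev.toLp_integral hint)
      refine integral_congr_ae ?_
      filter_upwards [hΦ, ae_restrict_mem measurableSet_Ioo] with s hs hs'
      exact Lp.ext (hs.trans (coeFn_gradTerm hH (sub_pos.2 hs'.2) (σ s)).symm)
    refine Sobolev.ext_toLp (Lp.ext (heq.trans ?_))
    rw [h1]
    have h2 : (H.mildSystem.S t ρ₀ + H.mildSystem.duhamel (fun s => id (σ s)) t).toLp =
      (H.mildSystem.S t ρ₀).toLp + (H.mildSystem.duhamel σ t).toLp := Sobolev.toLp_add _ _
    rw [h2]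
    refine .trans ?_ (Lp.coeFn_add _ _).symm
    exact (coeFn_S hH ht ρ₀).symm.add .rfl

end Mild

end

section

/-! ### Persistence of regularity for abstract systems -/

/-- A solution stays in a smaller space as long as it exists in the larger one, provided that the
norm of the smaller space is controlled by seminorms which obey linear estimates, one after the
other. -/
theorem MildSystem.exists_isSol_of_tower {Z X : Type*} [NormedAddCommGroup Z] [NormedSpace ℝ Z]
    [CompleteSpace Z] [NormedAddCommGroup X] [NormedSpace ℝ X] [CompleteSpace X]
    (G : MildSystem Z) (Y : MildSystem X) (π : Z →L[ℝ] X)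
    (hS : ∀ t z, 0 < t → π (G.S t z) = Y.S t (π z))
    (hP : ∀ t z w, 0 < t → π (G.P t z w) = Y.P t (π z) (π w))
    {V : ℕ → Type*} [∀ n, NormedAddCommGroup (V n)] [∀ n, NormedSpace ℝ (V n)]
    [∀ n, CompleteSpace (V n)] (R : ∀ n, Z →L[ℝ] V n) {k : ℕ} {C : ℕ → ℝ} {D : ℝ}
    (hC : ∀ n, 0 ≤ C n) (hD : 0 ≤ D)
    (h_zero : ∀ τ z, 0 < τ →
      ‖R 0 (G.P τ z z)‖ ≤ C 0 * τ ^ (-(1 / 2) : ℝ) * ‖π z‖ * ‖R 0 z‖)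
    (h_succ : ∀ n < k, ∀ τ z, 0 < τ →
      ‖R (n + 1) (G.P τ z z)‖ ≤ C (n + 1) * τ ^ (-(1 / 2) : ℝ) * ‖R n z‖ * ‖R (n + 1) z‖)
    (h_heat : ∀ n ≤ k, ∀ t z, 0 < t → ‖R n (G.S t z)‖ ≤ ‖R n z‖)
    (h_norm : ∀ z, ‖z‖ ≤ max ‖π z‖ (D * ‖R k z‖))
    {z₀ : Z} {T : EReal} {u : ℝ → X} (hu : Y.IsSol id (π z₀) T u)
    (hmax : ∀ (T' : EReal) (v : ℝ → X), 0 < T' → Y.IsSol id (π z₀) T' v →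
      T' ≤ T ∧ ∀ t : ℝ, 0 < t → (t : EReal) < T' → v t = u t) :
    ∃ w : ℝ → Z, G.IsSol id z₀ T w ∧ ∀ t : ℝ, 0 < t → (t : EReal) < T → π (w t) = u t := by
  obtain ⟨S, w, hS0, hw, -, hblow⟩ := G.exists_maximal z₀
  obtain ⟨hST, hwu⟩ := hmax S _ hS0 (hw.map π hS hP)
  have hTS : T ≤ S := by
    -- If existence in Z ended at S < T, then π(w) = u would be bounded up to S. The seminorms R 0,
    -- …, R k are then bounded one after the other, contrary to blow-up of w in Z.
    by_contra! hlt
    obtain ⟨S, rfl⟩ : ∃ S' : ℝ, (S' : EReal) = S :=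
      ⟨S.toReal, EReal.coe_toReal (hlt.trans_le le_top).ne ((EReal.bot_lt_zero.trans hS0).ne')⟩
    obtain ⟨M, hM⟩ := hu.bounded S hlt
    have hb1 : ∀ t ∈ Set.Ioo 0 S, ‖π (w t)‖ ≤ M := fun t ht => by
      rw [hwu t ht.1 (by exact_mod_cast ht.2)]
      exact hM t ⟨ht.1, ht.2.le⟩
    have hb2 : ∀ n ≤ k, ∃ B, ∀ t ∈ Set.Ioo 0 S, ‖R n (w t)‖ ≤ B := by
      intro n
      induction n with
      | zero =>
        intro hn
        exact hw.bounded_map (R 0) π (hC 0) h_zero hb1 fun t ht => h_heat 0 hn t z₀ ht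
      | succ n ih =>
        intro hn
        obtain ⟨B, hB⟩ := ih (by omega)
        exact hw.bounded_map (R (n + 1)) (R n) (hC (n + 1)) (h_succ n hn) hB
          fun t ht => h_heat (n + 1) hn t z₀ ht
    obtain ⟨B, hB⟩ := hb2 k le_rfl
    have hS0 : 0 < S := by exact_mod_cast hS0
    have hev := (hblow S rfl).eventually_gt_atTop (max M (D * B))
    obtain ⟨t, ht, htS⟩ := (hev.and (Ioo_mem_nhdsLT hS0)).exists
    refine ht.not_ge ((h_norm _).trans (max_le_max (hb1 t htS) ?_))
    exact mul_le_mul_of_nonneg_left (hB t htS) hD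
  obtain rfl : S = T := le_antisymm hST hTS
  exact ⟨w, hw, hwu⟩

/-! ### Lower order seminorms -/

section Truncation

variable {N m : ℕ} {p : ℝ≥0∞} [hp : Fact (1 ≤ p)]

/-- The derivatives of `u` up to order `n`, with the supremum of their norms. -/
def Sobolev.lower (n : ℕ) : Sobolev N m p →L[ℝ]
    ({γ : multiIndices N m // ∑ i, γ.1 i ≤ n} → LpE N p) :=
  ContinuousLinearMap.pi fun γ => Sobolev.comp γ.1

namespace Sobolev

theorem sobBound_lower {n : ℕ} (hn : n ≤ m) (u : Sobolev N m p) :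
    SobBound n u.toLp ‖lower n u‖ :=
  u.sobBound hn fun γ hγ => norm_le_pi_norm (lower n u) ⟨γ, hγ⟩

theorem norm_lower_le {n : ℕ} {u : Sobolev N m p} {A : ℝ} (h : SobBound n u.toLp A) :
    ‖lower n u‖ ≤ A := by
  rw [pi_norm_le_iff_of_nonneg ((norm_nonneg _).trans h.norm_le)]
  exact fun γ => norm_comp_le_of_sobBound h γ.1 γ.2

theorem exists_norm_le_lower (N m : ℕ) (p : ℝ≥0∞) [Fact (1 ≤ p)] : ∃ C : ℝ, 0 ≤ C ∧
    ∀ u : Sobolev N m p, ‖u‖ ≤ C * ‖lower m u‖ := by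
  obtain ⟨C, hC0, hC⟩ := exists_norm_le N m p
  exact ⟨C, hC0, fun u => hC u _ (u.sobBound_lower le_rfl)⟩

end Sobolev

variable {K : Fin N → E N → ℝ} {H : ConvSpace K (Sobolev N m p)}

theorem norm_lower_S_le (hH : ∀ u, H.fn u = u.toLp) {n : ℕ} (hn : n ≤ m) {t : ℝ} (ht : 0 < t)
    (u : Sobolev N m p) :
    ‖Sobolev.lower n (H.mildSystem.S t u)‖ ≤ ‖Sobolev.lower n u‖ := by
  refine Sobolev.norm_lower_le ?_
  have h1 := (u.sobBound_lower hn).convL (heatL N t)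
  rw [norm_heatL ht, one_mul, ← toLp_J hH] at h1
  exact h1

/-- Bounds of the nonlinearity carry over to the gradient term. -/
theorem norm_lower_gradTerm_le (hH : ∀ u, H.fn u = u.toLp) {n : ℕ} {u : Sobolev N m p}
    {κ : Fin N → ℝ} {B B' : ℝ} (h : ∀ i, SobBound n (H.Q i u u).toLp (κ i * B * B'))
    {τ : ℝ} (hτ : 0 < τ) :
    ‖Sobolev.lower n (H.gradTerm τ u u)‖ ≤
      (∑ i, 2 ^ ((N : ℝ) / 2) * κ i) * τ ^ (-(1 / 2) : ℝ) * B * B' := by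
  have hsum : (∑ i, 2 ^ ((N : ℝ) / 2) * κ i) * τ ^ (-(1 / 2) : ℝ) * B * B' =
      ∑ i, 2 ^ ((N : ℝ) / 2) * κ i * τ ^ (-(1 / 2) : ℝ) * B * B' := by
    simp only [Finset.sum_mul]
  rw [hsum, H.gradTerm_apply, map_sum]
  refine norm_sum_le_of_le _ fun i _ => ?_
  have h0 : 0 ≤ κ i * B * B' := (norm_nonneg _).trans (h i).norm_le
  have h1 := (h i).convL (gradHeatL i τ)
  rw [← toLp_J hH] at h1
  refine (Sobolev.norm_lower_le h1).trans ?_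
  refine (mul_le_mul_of_nonneg_right (norm_gradHeatL_le i hτ) h0).trans (le_of_eq ?_)
  ring

theorem toLp_Q_eq (hH : ∀ u, H.fn u = u.toLp) {q : ℝ≥0∞} (hpq : 1 / p + 1 / q = 1)
    (hK : ∀ i, MemLp (K i) q) (i : Fin N) (u v : Sobolev N m p) :
    (H.Q i u v).toLp = mulConvL hpq (hK i) u.toLp v.toLp :=
  Lp.ext ((toLp_Q hH i u v).trans (coeFn_mulConvL hpq (hK i) u.toLp v.toLp).symm)

end Truncation

/-! ### Intersections of function spaces -/

variable {N : ℕ} {p : ℝ≥0∞} [hp : Fact (1 ≤ p)] {p' : ℝ≥0∞} [hp' : Fact (1 ≤ p')]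

section Inter

variable {X X' : Type*} [NormedAddCommGroup X] [NormedSpace ℝ X] [NormedAddCommGroup X']
  [NormedSpace ℝ X']

/-- The intersection of two function spaces `X ⊆ L^p` and `X' ⊆ L^{p'}`. -/
def interSubmodule (ι : X →L[ℝ] LpE N p) (ι' : X' →L[ℝ] LpE N p') : Submodule ℝ (X × X') where
  carrier := {z | ι z.1 =ᵐ[volume] ι' z.2}
  zero_mem' := by
    show ι 0 =ᵐ[volume] ι' 0
    rw [map_zero, map_zero]
    exact (Lp.coeFn_zero ℝ p volume).trans (Lp.coeFn_zero ℝ p' volume).symm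
  add_mem' {a b} ha hb := by
    have ha' : ι a.1 =ᵐ[volume] ι' a.2 := ha
    show ι (a.1 + b.1) =ᵐ[volume] ι' (a.2 + b.2)
    rw [map_add, map_add]
    exact (Lp.coeFn_add _ _).trans ((ha'.add hb).trans (Lp.coeFn_add _ _).symm)
  smul_mem' c a ha := by
    have ha' : ι a.1 =ᵐ[volume] ι' a.2 := ha
    show ι (c • a.1) =ᵐ[volume] ι' (c • a.2)
    rw [map_smul, map_smul]
    exact (Lp.coeFn_smul _ _).trans ((ha'.const_smul c).trans (Lp.coeFn_smul _ _).symm)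

variable (ι : X →L[ℝ] LpE N p) (ι' : X' →L[ℝ] LpE N p')

theorem mem_interSubmodule {z : X × X'} :
    z ∈ interSubmodule ι ι' ↔ ι z.1 =ᵐ[volume] ι' z.2 := Iff.rfl

/-- Almost everywhere equality of the two components is tested by integrals against test functions,
each continuous in both components. Closedness provides the completeness needed to solve the
equation in the intersection. -/
theorem isClosed_interSubmodule : IsClosed (interSubmodule ι ι' : Set (X × X')) := by
  have h : (interSubmodule ι ι' : Set (X × X')) = ⋂ φ : {φ : E N → ℝ // IsTestFunction φ},
        {z | ∫ x, ι z.1 x * φ.1 x = ∫ x, ι' z.2 x * φ.1 x} := by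
    ext z
    simp only [Set.mem_iInter, Set.mem_ofPred_eq, Subtype.forall, SetLike.mem_coe,
      mem_interSubmodule]
    refine ⟨fun h φ _ => integral_congr_ae ?_, fun h => ae_eq_of_test
      ((Lp.memLp _).locallyIntegrable hp.out) ((Lp.memLp _).locallyIntegrable hp'.out) h⟩
    filter_upwards [h] with x hx
    rw [hx]
  rw [h]
  refine isClosed_iInter fun φ => ?_
  obtain ⟨ℓ, hℓ⟩ := exists_pairing (p := p) φ.2
  obtain ⟨ℓ', hℓ'⟩ := exists_pairing (p := p') φ.2
  simp_rw [← hℓ, ← hℓ']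
  exact isClosed_eq ((ℓ.comp ι).continuous.comp continuous_fst)
    ((ℓ'.comp ι').continuous.comp continuous_snd)

instance [CompleteSpace X] [CompleteSpace X'] : CompleteSpace (interSubmodule ι ι') :=
  (isClosed_interSubmodule ι ι').completeSpace_coe

variable {ι ι'}

/-- The inclusion of the intersection in the first space. -/
def interFst : interSubmodule ι ι' →L[ℝ] X :=
  (ContinuousLinearMap.fst ℝ X X').comp (interSubmodule ι ι').subtypeL

/-- The inclusion of the intersection in the second space. -/
def interSnd : interSubmodule ι ι' →L[ℝ] X' :=
  (ContinuousLinearMap.snd ℝ X X').comp (interSubmodule ι ι').subtypeL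

theorem interFst_ae_eq (z : interSubmodule ι ι') :
    ι (interFst z) =ᵐ[volume] ι' (interSnd z) := z.2

theorem norm_inter_le {z : interSubmodule ι ι'} {R : ℝ} (h : ‖interFst z‖ ≤ R)
    (h' : ‖interSnd z‖ ≤ R) : ‖z‖ ≤ R := max_le h h'

variable {K : Fin N → E N → ℝ}

/-- On both spaces the operators are given by the same formulas for functions, so they map pairs
representing one function to such pairs. -/
theorem exists_convSpace_inter {H : ConvSpace K X} {H' : ConvSpace K X'}
    (hH : ∀ u, H.fn u = ι u) (hH' : ∀ u, H'.fn u = ι' u) :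
    ∃ G : ConvSpace K (interSubmodule ι ι'),
      (∀ k z, interFst (G.J k z) = H.J k (interFst z)) ∧
      (∀ k z, interSnd (G.J k z) = H'.J k (interSnd z)) ∧
      (∀ i z w, interFst (G.Q i z w) = H.Q i (interFst z) (interFst w)) ∧
      (∀ i z w, interSnd (G.Q i z w) = H'.Q i (interSnd z) (interSnd w)) := by
  set S := interSubmodule ι ι' with hSdef
  have hz : ∀ z : S, H.fn (interFst z) =ᵐ[volume] H'.fn (interSnd z) := fun z => by
    rw [hH, hH']
    exact interFst_ae_eq z
  have hS : ∀ x x', H.fn x =ᵐ[volume] H'.fn x' → (x, x') ∈ S := fun x x' h => by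
    rwa [hH, hH'] at h
  set π : S →L[ℝ] X := interFst with hπ
  set π' : S →L[ℝ] X' := interSnd with hπ'
  obtain ⟨J, hJ⟩ := exists_bilinear_prod S (H.J.bilinearComp (.id ℝ _) π)
    (H'.J.bilinearComp (.id ℝ _) π') fun k z => by
      refine hS _ _ ((H.fn_J k _).trans (.trans ?_ (H'.fn_J k _).symm))
      exact .of_eq (conv_congr .rfl (hz z))
  have hQ : ∀ i, ∃ Q : S →L[ℝ] S →L[ℝ] S, ∀ z w, (Q z w : X × X') =
      (H.Q i (interFst z) (interFst w), H'.Q i (interSnd z) (interSnd w)) := fun i =>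
    exists_bilinear_prod S ((H.Q i).bilinearComp π π) ((H'.Q i).bilinearComp π' π') fun z w => by
        refine hS _ _ ((H.fn_Q i _ _).trans (.trans ?_ (H'.fn_Q i _ _).symm))
        filter_upwards [hz z] with x hx
        exact congrArg₂ (· * ·) hx (congrFun (conv_congr .rfl (hz w)) x)
  choose Q hQ using hQ
  have hJ1 : ∀ k z, interFst (J k z) = H.J k (interFst z) := fun k z => congrArg Prod.fst (hJ k z)
  have hJ2 : ∀ k z, interSnd (J k z) = H'.J k (interSnd z) := fun k z => congrArg Prod.snd (hJ k z)
  have hQ1 : ∀ i z w, interFst (Q i z w) = H.Q i (interFst z) (interFst w) := fun i z w =>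
    congrArg Prod.fst (hQ i z w)
  have hQ2 : ∀ i z w, interSnd (Q i z w) = H'.Q i (interSnd z) (interSnd w) := fun i z w =>
    congrArg Prod.snd (hQ i z w)
  obtain ⟨r, hr, hmem⟩ := H.memLp
  refine ⟨⟨fun z => H.fn (interFst z), fun z w h => ?_, ⟨r, hr, fun v => hmem _⟩, J, Q,
    fun k z => ?_, fun i z w => ?_⟩, hJ1, hJ2, hQ1, hQ2⟩
  · exact Subtype.ext (Prod.ext (H.inj _ _ h)
      (H'.inj _ _ ((hz z).symm.trans (h.trans (hz w)))))
  · rw [hJ1]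
    exact H.fn_J k _
  · rw [hQ1]
    exact H.fn_Q i _ _

/-- The maximal solution in `X` is a solution in `X'` if the initial value is in `X'`, provided that
the norm of `X'` is controlled by seminorms which obey linear estimates, one after the other. -/
theorem exists_isSol_inter [CompleteSpace X] [CompleteSpace X'] {H : ConvSpace K X}
    {H' : ConvSpace K X'} (hH : ∀ u, H.fn u = ι u) (hH' : ∀ u, H'.fn u = ι' u)
    {V : ℕ → Type*} [∀ n, NormedAddCommGroup (V n)] [∀ n, NormedSpace ℝ (V n)]
    [∀ n, CompleteSpace (V n)] (R : ∀ n, X' →L[ℝ] V n) {k : ℕ} {C : ℕ → ℝ} {D : ℝ}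
    (hC : ∀ n, 0 ≤ C n) (hD : 0 ≤ D)
    (h_zero : ∀ τ x x', 0 < τ → ι x =ᵐ[volume] ι' x' →
      ‖R 0 (H'.mildSystem.P τ x' x')‖ ≤ C 0 * τ ^ (-(1 / 2) : ℝ) * ‖x‖ * ‖R 0 x'‖)
    (h_succ : ∀ n < k, ∀ τ x', 0 < τ →
      ‖R (n + 1) (H'.mildSystem.P τ x' x')‖ ≤
        C (n + 1) * τ ^ (-(1 / 2) : ℝ) * ‖R n x'‖ * ‖R (n + 1) x'‖)
    (h_heat : ∀ n ≤ k, ∀ t x', 0 < t → ‖R n (H'.mildSystem.S t x')‖ ≤ ‖R n x'‖)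
    (h_norm : ∀ x', ‖x'‖ ≤ D * ‖R k x'‖)
    {x₀ : X} {x₀' : X'} (h₀ : ι x₀ =ᵐ[volume] ι' x₀') {T : EReal} {u : ℝ → X}
    (hu : H.mildSystem.IsSol id x₀ T u)
    (hmax : ∀ (T' : EReal) (v : ℝ → X), 0 < T' → H.mildSystem.IsSol id x₀ T' v →
      T' ≤ T ∧ ∀ t : ℝ, 0 < t → (t : EReal) < T' → v t = u t) :
    ∃ v : ℝ → X', H'.mildSystem.IsSol id x₀' T v ∧
      ∀ t : ℝ, 0 < t → (t : EReal) < T → ι' (v t) =ᵐ[volume] ι (u t) := by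
  obtain ⟨G, hJ1, hJ2, hQ1, hQ2⟩ := exists_convSpace_inter hH hH'
  have hS1 : ∀ t z, interFst (G.mildSystem.S t z) = H.mildSystem.S t (interFst z) :=
    fun t z => hJ1 (heatL N t) z
  have hS2 : ∀ t z, interSnd (G.mildSystem.S t z) = H'.mildSystem.S t (interSnd z) :=
    fun t z => hJ2 (heatL N t) z
  have hP1 : ∀ t z w, interFst (G.mildSystem.P t z w) =
      H.mildSystem.P t (interFst z) (interFst w) := by
    intro t z w
    simp only [ConvSpace.mildSystem_P, ConvSpace.gradTerm_apply, map_sum, hJ1, hQ1]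
  have hP2 : ∀ t z w, interSnd (G.mildSystem.P t z w) =
      H'.mildSystem.P t (interSnd z) (interSnd w) := by
    intro t z w
    simp only [ConvSpace.mildSystem_P, ConvSpace.gradTerm_apply, map_sum, hJ2, hQ2]
  -- From here on only the four intertwining identities with the two component systems matter.
  generalize G.mildSystem = Y at hS1 hS2 hP1 hP2
  obtain ⟨w, hw, hwu⟩ := Y.exists_isSol_of_tower H.mildSystem interFst
    (fun t z _ => hS1 t z) (fun t z w _ => hP1 t z w) (fun n => (R n).comp interSnd) (k := k)
    hC hD
    (fun τ z hτ => by
      rw [ContinuousLinearMap.comp_apply, ContinuousLinearMap.comp_apply, hP2]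
      exact h_zero τ _ _ hτ (interFst_ae_eq z))
    (fun n hn τ z hτ => by
      rw [ContinuousLinearMap.comp_apply, ContinuousLinearMap.comp_apply,
        ContinuousLinearMap.comp_apply, hP2]
      exact h_succ n hn τ _ hτ)
    (fun n hn t z ht => by
      rw [ContinuousLinearMap.comp_apply, ContinuousLinearMap.comp_apply, hS2]
      exact h_heat n hn t _ ht)
    (fun z => norm_inter_le (le_max_left _ _) ((h_norm _).trans (le_max_right _ _)))
    (z₀ := ⟨(x₀, x₀'), h₀⟩) hu hmax
  refine ⟨fun t => interSnd (w t),
    hw.map interSnd (fun t z _ => hS2 t z) (fun t z w _ => hP2 t z w), fun t ht htT => ?_⟩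
  rw [← hwu t ht htT]
  exact (interFst_ae_eq (w t)).symm

end Inter

/-! ### Persistence of regularity -/

variable {m m' : ℕ} {K : Fin N → E N → ℝ}

/-- The linear estimate for the `L^{p'}` norm of a solution bounded in `L^p`. -/
theorem norm_lower_zero_P_le {H : ConvSpace K (Sobolev N m p)} (hH : ∀ u, H.fn u = u.toLp)
    {q : ℝ≥0∞} (hpq : 1 / p' + 1 / q = 1) (hK : ∀ i, MemLp (K i) q) {τ : ℝ} (hτ : 0 < τ)
    {x : Sobolev N m' p'} {x' : Sobolev N m p} (hx : x.toLp =ᵐ[volume] x'.toLp) :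
    ‖Sobolev.lower 0 (H.mildSystem.P τ x' x')‖ ≤
      (∑ i, 2 ^ ((N : ℝ) / 2) * (eLpNorm (K i) q volume).toReal) * τ ^ (-(1 / 2) : ℝ) *
        ‖x‖ * ‖Sobolev.lower 0 x'‖ := by
  refine norm_lower_gradTerm_le hH (fun i => sobBound_zero ?_) hτ
  refine (norm_le_of_ae_eq_mul_conv hpq (hK i) (f := x'.toLp) (g := x.toLp) ?_).trans ?_
  · refine (toLp_Q hH i x' x').trans ?_
    rw [conv_congr .rfl hx.symm]
  · gcongr
    · exact x.norm_toLp_le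
    · exact (x'.sobBound_lower (Nat.zero_le _)).norm_le

/-- The linear estimate for derivatives of order `n + 1`, given bounds up to order `n`. -/
theorem norm_lower_succ_P_le {H : ConvSpace K (Sobolev N m p)} (hH : ∀ u, H.fn u = u.toLp)
    {q : ℝ≥0∞} (hpq : 1 / p + 1 / q = 1) (hK : ∀ i, MemLp (K i) q) {τ : ℝ} (hτ : 0 < τ)
    {n : ℕ} (hn : n < m) (x : Sobolev N m p) :
    ‖Sobolev.lower (n + 1) (H.mildSystem.P τ x x)‖ ≤
      (∑ i, 2 ^ ((N : ℝ) / 2) * (2 ^ (n + 1) * (eLpNorm (K i) q volume).toReal)) *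
        τ ^ (-(1 / 2) : ℝ) * ‖Sobolev.lower n x‖ * ‖Sobolev.lower (n + 1) x‖ := by
  refine norm_lower_gradTerm_le hH (fun i => ?_) hτ
  rw [toLp_Q_eq hH hpq hK]
  exact (x.sobBound_lower hn.le).mulConvL_self hpq (hK i) (x.sobBound_lower hn)

set_option maxHeartbeats 1000000 in
/-- The maximal solution in `W^{m,p}` is a solution in `W^{m',p'}` if the initial value is in
`W^{m',p'}`. -/
theorem exists_isSol_sobolev {H : ConvSpace K (Sobolev N m p)} (hH : ∀ u, H.fn u = u.toLp)
    {H' : ConvSpace K (Sobolev N m' p')} (hH' : ∀ u, H'.fn u = u.toLp) {q q' : ℝ≥0∞}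
    (hpq : 1 / p + 1 / q = 1) (hK : ∀ i, MemLp (K i) q)
    (hpq' : 1 / p' + 1 / q' = 1) (hK' : ∀ i, MemLp (K i) q') {x₀ : Sobolev N m p}
    {x₀' : Sobolev N m' p'} (h₀ : x₀.toLp =ᵐ[volume] x₀'.toLp)
    {T : EReal} {u : ℝ → Sobolev N m p} (hu : H.mildSystem.IsSol id x₀ T u)
    (hmax : ∀ (T' : EReal) (v : ℝ → Sobolev N m p), 0 < T' →
      H.mildSystem.IsSol id x₀ T' v →
      T' ≤ T ∧ ∀ t : ℝ, 0 < t → (t : EReal) < T' → v t = u t) :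
    ∃ v : ℝ → Sobolev N m' p', H'.mildSystem.IsSol id x₀' T v ∧
      ∀ t : ℝ, 0 < t → (t : EReal) < T → (v t).toLp =ᵐ[volume] (u t).toLp := by
  obtain ⟨D, hD0, hD⟩ := Sobolev.exists_norm_le_lower N m' p'
  refine exists_isSol_inter (ι := Sobolev.toLpL) (ι' := Sobolev.toLpL) hH hH'
    (fun n => Sobolev.lower n) (k := m') (D := D)
    -- At order zero K is measured in L^q, paired with the L^p bound of the solution. At higher
    -- orders it is measured in L^{q'}, paired with the L^{p'} bounds of lower order already
    -- obtained.
    (C := fun n => n.casesOn (∑ i, 2 ^ ((N : ℝ) / 2) * (eLpNorm (K i) q volume).toReal)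
      fun n => ∑ i, 2 ^ ((N : ℝ) / 2) * (2 ^ (n + 1) * (eLpNorm (K i) q' volume).toReal))
    (fun n => ?_) hD0
    (fun τ x x' hτ hx => norm_lower_zero_P_le hH' hpq hK hτ hx)
    (fun n hn τ x' hτ => norm_lower_succ_P_le hH' hpq' hK' hτ hn x')
    (fun n hn t x' ht => norm_lower_S_le hH' hn ht x')
    hD h₀ hu hmax
  cases n with
  | zero =>
    show 0 ≤ ∑ i, 2 ^ ((N : ℝ) / 2) * (eLpNorm (K i) q volume).toReal
    positivity
  | succ n =>
    show 0 ≤ ∑ i, 2 ^ ((N : ℝ) / 2) * (2 ^ (n + 1) * (eLpNorm (K i) q' volume).toReal)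
    positivity

end

end AggDiff

end

/-! ### The main theorem -/

theorem mainTheorem6 (N : ℕ) (hN : 1 ≤ N) (m : ℕ) (p q : ℝ≥0∞) [Fact (1 ≤ p)]
    (hpq : 1 / p + 1 / q = 1)
    (W : AggDiff.E N → ℝ) (hW : LocallyIntegrable W)
    (K : Fin N → AggDiff.E N → ℝ) (hWK : AggDiff.IsWeakGradient W K)
    (hK : ∀ i, MemLp (K i) q)
    (ρ₀ : AggDiff.Sobolev N m p) :
    ∃ (Tmax : EReal) (ρ : ℝ → AggDiff.Sobolev N m p),
      0 < Tmax ∧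
      -- `ρ` is a mild solution on `[0, Tmax)` with initial condition `ρ₀`
      AggDiff.InSolutionClass Tmax ρ ∧
      AggDiff.AttainsData ρ₀ ρ ∧
      AggDiff.IsMildSolution K ρ₀.toLp Tmax (fun t => (ρ t).toLp) ∧
      -- maximality and uniqueness
      (∀ (T : EReal) (σ : ℝ → AggDiff.Sobolev N m p), 0 < T →
        AggDiff.InSolutionClass T σ →
        AggDiff.IsMildSolution K ρ₀.toLp T (fun t => (σ t).toLp) →
        T ≤ Tmax ∧
          ∀ t : ℝ, 0 ≤ t → (t : EReal) < T → (p ≠ ⊤ ∨ 0 < t) → σ t = ρ t) ∧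
      -- blow-up
      (∀ T : ℝ, Tmax = (T : EReal) → Tendsto (fun t => ‖ρ t‖) (𝓝[<] T) atTop) ∧
      -- persistence of additional integrability and regularity
      (∀ (m' : ℕ) (p' q' : ℝ≥0∞) [Fact (1 ≤ p')], 1 / p' + 1 / q' = 1 →
        (∀ i, MemLp (K i) q') →
        ∀ ρ₀' : AggDiff.Sobolev N m' p', ⇑ρ₀'.toLp =ᵐ[volume] ⇑ρ₀.toLp →
        ∃ ρ' : ℝ → AggDiff.Sobolev N m' p',
          (∀ t : ℝ, 0 ≤ t → (t : EReal) < Tmax → ⇑(ρ' t).toLp =ᵐ[volume] ⇑(ρ t).toLp) ∧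
          AggDiff.InSolutionClass Tmax ρ' ∧
          AggDiff.AttainsData ρ₀' ρ') := by
  obtain ⟨H, hH⟩ := AggDiff.exists_convSpace_sobolev (m := m) hpq hK
  obtain ⟨Tmax, u, hpos, hu, hmax, hblow⟩ := H.mildSystem.exists_maximal ρ₀
  refine ⟨Tmax, AggDiff.withInitial ρ₀ u, hpos, AggDiff.inSolutionClass_of_isSol hH hpos hu,
    AggDiff.attainsData_of_isSol hH hpos hu, AggDiff.isMildSolution_of_isSol hH hu,
    fun T σ hT hσ hmild => ?_, fun T hT => ?_, ?_⟩
  · have hsol := AggDiff.isSol_of_isMildSolution hH hσ hmild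
    obtain ⟨hle, heq⟩ := hmax T σ hT hsol
    refine ⟨hle, fun t ht htT hpt => ?_⟩
    rcases ht.eq_or_lt with rfl | ht0
    -- The mild equation constrains σ only at positive times. For p < ∞ the value σ(0) is the limit
    -- of σ at 0⁺ by continuity, and this limit is ρ₀ because the heat flow is strongly continuous.
    · have hp : p ≠ ⊤ := hpt.resolve_right (lt_irrefl 0)
      rw [AggDiff.withInitial_zero]
      refine tendsto_nhds_unique ?_ (AggDiff.tendsto_initial hH hT hsol hp)
      refine (hσ.continuousOn_Ico hp 0 ⟨le_rfl, htT⟩).mono_left ?_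
      obtain ⟨t₁, ht₁, ht₁T⟩ := EReal.lt_iff_exists_real_btwn.1 hT
      have hmem := Ioo_mem_nhdsGT (show (0 : ℝ) < t₁ by exact_mod_cast ht₁)
      refine nhdsWithin_le_of_mem (mem_of_superset hmem fun t ht => ⟨ht.1.le, ?_⟩)
      exact (EReal.coe_lt_coe_iff.2 ht.2).trans ht₁T
    · rw [AggDiff.withInitial_of_pos _ _ ht0]
      exact heq t ht0 htT
  · refine (hblow T hT).congr' ?_
    have hT0 : 0 < T := by rw [hT] at hpos; exact_mod_cast hpos
    filter_upwards [Ioo_mem_nhdsLT hT0] with t ht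
    rw [AggDiff.withInitial_of_pos _ _ ht.1]
  · intro m' p' q' _ hpq' hK' ρ₀' hρ
    obtain ⟨H', hH'⟩ := AggDiff.exists_convSpace_sobolev (m := m') hpq' hK'
    obtain ⟨v, hv, hvu⟩ := AggDiff.exists_isSol_sobolev hH hH' hpq hK hpq' hK' hρ.symm hu hmax
    refine ⟨AggDiff.withInitial ρ₀' v, fun t ht htT => ?_,
      AggDiff.inSolutionClass_of_isSol hH' hpos hv, AggDiff.attainsData_of_isSol hH' hpos hv⟩
    rcases ht.eq_or_lt with rfl | ht0
    · simpa only [AggDiff.withInitial_zero] using hρ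
    · simpa only [AggDiff.withInitial_of_pos _ _ ht0] using hvu t ht0 htT
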